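/- Let $(X,d)$ be a separable metric space that is locally complete (every point has a complete neighbourhood), and let $\mu$ be a Borel measure on $X$ with $0<\mu(B(x,r))<\infty$ for every ball $B(x,r)$, $x\in X$, $r>0$. A rectifiable curve is a continuous map $\gamma:[0,1]\to X$ of finite length (constant curves are allowed), and for Borel $g:X\to[0,\infty]$ put $\int_\gamma g\,ds=\mathrm{Len}(\gamma)\int_0^1 g(\tilde\gamma(t))\,dt$, where $\tilde\gamma$ is the constant-speed parametrization of $\gamma$ on $[0,1]$. A Borel function $g:X\to[0,\infty]$ is an upper gradient of $u:X\to[-\infty,\infty]$ if $|u(\gamma(0))-u(\gamma(1))|\le\int_\gamma g\,ds$ for every rectifiable curve $\gamma$, where $|\infty-\infty|$ and $|(-\infty)-(-\infty)|$ are read as $\infty$. Let $E,F\subset X$ be closed, non-empty, disjoint sets with $d(E,F)=\inf_{a\in E,b\in F}d(a,b)>0$, and let $1\le p<\infty$. For a collection $W$ of pairs $(u,g)$ with $g$ an upper gradient of $u$, let $$\mathrm{Cap}_p^{W}(E,F)=\inf\Big\{\int_X g^p\,d\mu : (u,g)\in W,\ u|_E=0,\ u|_F=1\Big\}.$$ Write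 $\mathrm{Cap}_p$ when $W$ consists of all pairs $(u,g)$ with $u:X\to[-\infty,\infty]$ and $g$ an upper gradient of $u$; $\mathrm{Cap}_p^{\mathrm{cont}}$ when moreover $u$ is real-valued and continuous; $\mathrm{Cap}_p^{\mathrm{lip}}$ when moreover $u$ is real-valued and locally Lipschitz; and $\mathrm{Cap}_p^{(\mathrm{lip},\mathrm{lip})}$ when moreover both $u$ and $g$ are finite-valued and locally Lipschitz. Then $$\mathrm{Cap}_p(E,F)=\mathrm{Cap}_p^{\mathrm{cont}}(E,F)=\mathrm{Cap}_p^{\mathrm{lip}}(E,F)=\mathrm{Cap}_p^{(\mathrm{lip},\mathrm{lip})}(E,F).$$ Let moreover $\mathrm{Mod}_p(E,F)=\inf_\rho\int_X\rho^p\,d\mu$, where the infimum is over all Borel functions $\rho:X\to[0,\infty]$ with $\int_\gamma\rho\,ds\ge1$ for every rectifiable curve $\gamma$ with $\gamma(0)\in E$ and $\gamma(1)\in F$, and let $\mathrm{Mod}_p^{c}(E,F)$ be the infimum over those such $\rho$ that are finite-valued and continuous. Then $$\mathrm{Cap}_p(E,F)=\mathrm{Mod}_p(E,F)=\mathrm{Mod}_p^{c}(E,F).$$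 -/

import Mathlib

open Set MeasureTheory
open scoped Topology NNReal ENNReal

/-- A metric space is locally complete if every point has a complete neighbourhood. -/
def IsLocallyComplete (X : Type*) [MetricSpace X] : Prop :=
  ∀ x : X, ∃ U ∈ 𝓝 x, IsComplete U

/-- The distance `d(A, B) = inf {d(a, b) : a ∈ A, b ∈ B}` between two sets. -/
noncomputable def setDistance {X : Type*} [MetricSpace X] (A B : Set X) : ℝ≥0∞ :=
  ⨅ a ∈ A, ⨅ b ∈ B, edist a b

/-- The length of the curve `γ : [0,1] → X` (only the restriction of `γ` to `[0,1]` matters). -/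
noncomputable def curveLength {X : Type*} [MetricSpace X] (γ : ℝ → X) : ℝ≥0∞ :=
  eVariationOn γ (Icc 0 1)

/-- `γ` restricted to `[0,1]` is a rectifiable curve: continuous and of finite length.
Constant curves are allowed. -/
def IsRectifiableCurve {X : Type*} [MetricSpace X] (γ : ℝ → X) : Prop :=
  ContinuousOn γ (Icc 0 1) ∧ curveLength γ ≠ ⊤

/-- The constant-speed parametrization on `[0,1]` of a rectifiable curve `γ : [0,1] → X`:
the arc-length parametrization of `γ`, run at speed `Len γ`. -/
noncomputable def constantSpeedParametrization {X : Type*} [MetricSpace X] (γ : ℝ → X) :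
    ℝ → X :=
  fun t => naturalParameterization γ (Icc 0 1) 0 (t * (curveLength γ).toReal)

/-- The path integral `∫_γ g ds = Len(γ) ∫₀¹ g(γ̃(t)) dt` of a nonnegative function `g` along a
rectifiable curve `γ` with constant-speed parametrization `γ̃`. -/
noncomputable def pathIntegral {X : Type*} [MetricSpace X] (g : X → ℝ≥0∞) (γ : ℝ → X) : ℝ≥0∞ :=
  curveLength γ * ∫⁻ t in Icc (0 : ℝ) 1, g (constantSpeedParametrization γ t)

/-- The Borel function `g : X → [0,∞]` is an upper gradient of `u : X → [-∞,∞]`.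
In `EReal` one has `⊤ - ⊤ = ⊥ - ⊥ = ⊥` and `EReal.abs ⊥ = ⊤`, so the left-hand side follows the
convention `|∞ - ∞| = |(-∞) - (-∞)| = ∞`. -/
def IsUpperGradient {X : Type*} [MetricSpace X] [MeasurableSpace X]
    (g : X → ℝ≥0∞) (u : X → EReal) : Prop :=
  Measurable g ∧ ∀ γ : ℝ → X, IsRectifiableCurve γ →
    (u (γ 0) - u (γ 1)).abs ≤ pathIntegral g γ

/-- All pairs `(u, g)` where `u` is a function on `X` and `g` is an upper gradient of `u`. -/
def upperGradientPairs (X : Type*) [MetricSpace X] [MeasurableSpace X] :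
    Set ((X → EReal) × (X → ℝ≥0∞)) :=
  {q | IsUpperGradient q.2 q.1}

/-- The pairs `(u, g)` where `u` is real-valued and continuous. -/
def contPairs (X : Type*) [MetricSpace X] [MeasurableSpace X] :
    Set ((X → EReal) × (X → ℝ≥0∞)) :=
  {q | q ∈ upperGradientPairs X ∧ ∃ v : X → ℝ, Continuous v ∧ q.1 = fun x => (v x : EReal)}

/-- The pairs `(u, g)` where `u` is real-valued and locally Lipschitz. -/
def lipPairs (X : Type*) [MetricSpace X] [MeasurableSpace X] :
    Set ((X → EReal) × (X → ℝ≥0∞)) :=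
  {q | q ∈ upperGradientPairs X ∧
    ∃ v : X → ℝ, LocallyLipschitz v ∧ q.1 = fun x => (v x : EReal)}

/-- The pairs `(u, g)` where both `u` and `g` are finite-valued and locally Lipschitz. -/
def lipLipPairs (X : Type*) [MetricSpace X] [MeasurableSpace X] :
    Set ((X → EReal) × (X → ℝ≥0∞)) :=
  {q | q ∈ lipPairs X ∧
    ∃ h : X → ℝ≥0, LocallyLipschitz h ∧ q.2 = fun x => (h x : ℝ≥0∞)}

/-- The condenser `p`-capacity of `(E, F)` computed with the pairs `(u, g)` in the collection `W`:
the infimum of `∫ g ^ p dμ` over `(u, g) ∈ W` with `u = 0` on `E` and `u = 1` on `F`. -/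
noncomputable def condenserCapacityWith {X : Type*} [MetricSpace X] [MeasurableSpace X]
    (W : Set ((X → EReal) × (X → ℝ≥0∞))) (μ : Measure X) (p : ℝ) (E F : Set X) : ℝ≥0∞ :=
  ⨅ q ∈ {q ∈ W | (∀ x ∈ E, q.1 x = 0) ∧ (∀ x ∈ F, q.1 x = 1)}, ∫⁻ x, q.2 x ^ p ∂μ

/-- The condenser `p`-capacity `Cap_p(E, F)`. -/
noncomputable def condenserCapacity {X : Type*} [MetricSpace X] [MeasurableSpace X]
    (μ : Measure X) (p : ℝ) (E F : Set X) : ℝ≥0∞ :=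
  condenserCapacityWith (upperGradientPairs X) μ p E F

/-- The family `Γ(E, F)` of rectifiable curves from `E` to `F`. -/
def curvesBetween {X : Type*} [MetricSpace X] (E F : Set X) : Set (ℝ → X) :=
  {γ | IsRectifiableCurve γ ∧ γ 0 ∈ E ∧ γ 1 ∈ F}

/-- The Borel functions `ρ : X → [0,∞]` that are admissible for the curve family `Γ`. -/
def admissibleFunctions {X : Type*} [MetricSpace X] [MeasurableSpace X] (Γ : Set (ℝ → X)) :
    Set (X → ℝ≥0∞) :=
  {ρ | Measurable ρ ∧ ∀ γ ∈ Γ, 1 ≤ pathIntegral ρ γ}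

/-- The `p`-modulus of the curve family `Γ`. -/
noncomputable def curveModulus {X : Type*} [MetricSpace X] [MeasurableSpace X]
    (μ : Measure X) (p : ℝ) (Γ : Set (ℝ → X)) : ℝ≥0∞ :=
  ⨅ ρ ∈ admissibleFunctions Γ, ∫⁻ x, ρ x ^ p ∂μ

/-- The `p`-modulus of `Γ` computed with admissible functions that are finite-valued and
continuous. -/
noncomputable def continuousCurveModulus {X : Type*} [MetricSpace X] [MeasurableSpace X]
    (μ : Measure X) (p : ℝ) (Γ : Set (ℝ → X)) : ℝ≥0∞ :=
  ⨅ ρ ∈ {ρ ∈ admissibleFunctions Γ |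
    ∃ h : X → ℝ≥0, Continuous h ∧ ρ = fun x => (h x : ℝ≥0∞)}, ∫⁻ x, ρ x ^ p ∂μ

open Filter

/-! Only one inequality has content: the capacity over locally Lipschitz pairs is at most the
modulus. The collections of pairs are nested, and an upper gradient of a function that is `0` on `E`
and `1` on `F` is admissible, so all the other infima lie between these two.

Let `ρ₀` be admissible. At arbitrarily small cost in the integral it is raised to a lower
semicontinuous weight (Vitali–Carathéodory), then to a coercive one. For this, `X` is exhausted by
complete sets `{h ≤ k}` of finite measure; by tightness the weight can be made bounded below on each
of them and large off compact subsets (`exists_coercive_majorant`). Lipschitz functions `ρ_n`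
increase to the resulting weight `ρ`. Curves are replaced by chains of points with steps at most `1
/ (n + 1)`, weighted by `ρ_n`: an infimum of chain costs changes at rate `ρ_n` between nearby points
even if no curve joins them. Coercivity keeps chains of bounded cost close to compact sets, so as `n
→ ∞` they subconverge to a curve, and the cost is lower semicontinuous
(`IsCoerciveOn.exists_curve`).

This compactness is used twice. First, the infimum over `k` of the supremum over `n` of the least
chain cost from `E` is a measurable function `u` with upper gradient `ρ`; it equals `1` on `F`,
because cheaper chains would converge to a curve contradicting admissibility
(`exists_measurable_potential`). Secondly, by Lusin's theorem `u` is continuous on compact sets `K`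
filling almost all of `{h ≤ k}`. Chains that may also start in `K`, at initial cost `u`, give
functions with Lipschitz weight below `ρ` that approximate `u` uniformly on `K` and `1` uniformly on
`F`. Here `d(E, F) > 0` forces a chain from `E` to `F` to travel a definite distance.

Finally the approximants `f i` are glued by a partition of unity in `h`. The extra weight is at most
a sum of constants times `|f i - u|`, which is small in `L^p`. Division by `1 - ε`, truncation at
`1` and `ε → 0` finish the proof. -/

theorem lintegral_Icc_zero_eq_mul (F : ℝ → ℝ≥0∞) {a : ℝ} (ha : 0 < a) :
    ∫⁻ s in Icc 0 a, F s = ENNReal.ofReal a * ∫⁻ t in Icc (0 : ℝ) 1, F (t * a) := by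
  have hvol := Real.smul_map_volume_mul_right ha.ne'
  rw [abs_of_pos ha] at hvol
  have hpre : (fun t : ℝ => t * a) ⁻¹' Icc 0 a = Icc 0 1 := by
    ext t
    simp only [mem_preimage, mem_Icc]
    constructor
    · rintro ⟨h1, h2⟩
      exact ⟨by nlinarith, by nlinarith⟩
    · rintro ⟨h1, h2⟩
      exact ⟨by positivity, by nlinarith⟩
  have he : MeasurableEmbedding (fun t : ℝ => t * a) :=
    (MeasurableEquiv.mulRight₀ a ha.ne').measurableEmbedding
  conv_lhs => rw [← hvol]
  rw [Measure.restrict_smul, lintegral_smul_measure, he.restrict_map, he.lintegral_map, hpre]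
  rfl

/-! ### Arc length and path integrals along Lipschitz curves -/

section Variation

variable {X : Type*} [MetricSpace X]

theorem IsRectifiableCurve.locallyBoundedVariationOn {γ : ℝ → X} (hγ : IsRectifiableCurve γ) :
    LocallyBoundedVariationOn γ (Icc 0 1) :=
  BoundedVariationOn.locallyBoundedVariationOn hγ.2

theorem variationOnFromTo_zero_one (γ : ℝ → X) :
    variationOnFromTo γ (Icc 0 1) 0 1 = (curveLength γ).toReal := by
  rw [variationOnFromTo.eq_of_le _ _ zero_le_one, inter_self, curveLength]

/-- At a point of continuity of `γ` the variation over shrinking intervals on either side tends to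
zero. With the intermediate value theorem, every arc length up to the total one is attained. -/
theorem IsRectifiableCurve.continuousOn_variation {γ : ℝ → X} (hγ : IsRectifiableCurve γ) :
    ContinuousOn (variationOnFromTo γ (Icc 0 1) 0) (Icc 0 1) := by
  intro x hx
  have hloc := hγ.locallyBoundedVariationOn
  have hbv : BoundedVariationOn γ (Icc 0 1) := hγ.2
  have hleft := hbv.tendsto_eVariationOn_Icc_zero_left (x := x)
    ((hγ.1 x hx).mono inter_subset_left)
  have hright := hbv.tendsto_eVariationOn_Icc_zero_right x
    ((hγ.1 x hx).mono inter_subset_left)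
  have hl := (ENNReal.tendsto_toReal ENNReal.zero_ne_top).comp hleft
  have hr := (ENNReal.tendsto_toReal ENNReal.zero_ne_top).comp hright
  have hsum := hl.add hr
  simp only [ENNReal.toReal_zero, add_zero] at hsum
  rw [ContinuousWithinAt, tendsto_iff_dist_tendsto_zero]
  refine squeeze_zero' (Eventually.of_forall fun _ => dist_nonneg) ?_ hsum
  filter_upwards [self_mem_nhdsWithin] with y hy
  have hadd := variationOnFromTo.add hloc (left_mem_Icc.2 zero_le_one) hx hy
  rw [Real.dist_eq, ← hadd, add_sub_cancel_left]
  simp only [Function.comp_apply]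
  rcases le_total x y with hxy | hyx
  · rw [variationOnFromTo.eq_of_le _ _ hxy, abs_of_nonneg ENNReal.toReal_nonneg]
    exact le_add_of_nonneg_left ENNReal.toReal_nonneg
  · rw [variationOnFromTo.eq_of_ge _ _ hyx, abs_neg, abs_of_nonneg ENNReal.toReal_nonneg]
    exact le_add_of_nonneg_right ENNReal.toReal_nonneg

theorem IsRectifiableCurve.image_variation {γ : ℝ → X} (hγ : IsRectifiableCurve γ) {s : ℝ}
    (hs : s ∈ Icc 0 (curveLength γ).toReal) :
    ∃ t ∈ Icc (0 : ℝ) 1, variationOnFromTo γ (Icc 0 1) 0 t = s := by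
  have h := intermediate_value_Icc (zero_le_one' ℝ) hγ.continuousOn_variation
  rw [variationOnFromTo.self, variationOnFromTo_zero_one] at h
  exact h hs

theorem IsRectifiableCurve.naturalParameterization_variation {γ : ℝ → X}
    (hγ : IsRectifiableCurve γ) {t : ℝ} (ht : t ∈ Icc (0 : ℝ) 1) :
    naturalParameterization γ (Icc 0 1) 0 (variationOnFromTo γ (Icc 0 1) 0 t) = γ t :=
  edist_eq_zero.1 (edist_naturalParameterization_eq_zero hγ.locallyBoundedVariationOn
    (left_mem_Icc.2 zero_le_one) ht)

theorem IsRectifiableCurve.lipschitzOnWith_naturalParameterization {γ : ℝ → X}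
    (hγ : IsRectifiableCurve γ) :
    LipschitzOnWith 1 (naturalParameterization γ (Icc 0 1) 0) (Icc 0 (curveLength γ).toReal) := by
  have hloc := hγ.locallyBoundedVariationOn
  have key : ∀ a ∈ Icc (0 : ℝ) 1, ∀ b ∈ Icc (0 : ℝ) 1, a ≤ b → dist (γ a) (γ b) ≤
      dist (variationOnFromTo γ (Icc 0 1) 0 a) (variationOnFromTo γ (Icc 0 1) 0 b) := by
    intro a ha b hb hab
    have hadd := variationOnFromTo.add hloc (left_mem_Icc.2 zero_le_one) ha hb
    rw [dist_comm (variationOnFromTo _ _ _ _), Real.dist_eq, ← hadd, add_sub_cancel_left,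
      variationOnFromTo.eq_of_le _ _ hab, abs_of_nonneg ENNReal.toReal_nonneg, dist_edist]
    exact ENNReal.toReal_mono (hloc a b ha hb)
      (eVariationOn.edist_le γ ⟨ha, le_rfl, hab⟩ ⟨hb, hab, le_rfl⟩)
  refine LipschitzOnWith.of_dist_le_mul fun s hs s' hs' => ?_
  obtain ⟨a, ha, rfl⟩ := hγ.image_variation hs
  obtain ⟨b, hb, rfl⟩ := hγ.image_variation hs'
  rw [hγ.naturalParameterization_variation ha, hγ.naturalParameterization_variation hb,
    NNReal.coe_one, one_mul]
  rcases le_total a b with hab | hba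
  · exact key a ha b hb hab
  · rw [dist_comm, dist_comm (variationOnFromTo _ _ _ _)]
    exact key b hb a ha hba

theorem IsRectifiableCurve.pathIntegral_eq {γ : ℝ → X} (hγ : IsRectifiableCurve γ)
    (g : X → ℝ≥0∞) : pathIntegral g γ =
      ∫⁻ s in Icc 0 (curveLength γ).toReal, g (naturalParameterization γ (Icc 0 1) 0 s) := by
  rw [pathIntegral]
  rcases eq_or_ne (curveLength γ) 0 with h0 | h0
  · simp [h0]
  · rw [lintegral_Icc_zero_eq_mul _ (ENNReal.toReal_pos h0 hγ.2), ENNReal.ofReal_toReal hγ.2]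
    rfl

/-- A rectifiable curve has a `1`-Lipschitz parametrization, over which path integrals are
integrals over an interval. -/
theorem IsRectifiableCurve.exists_lipschitz {γ : ℝ → X} (hγ : IsRectifiableCurve γ) :
    ∃ (c : ℝ → X) (L : ℝ), 0 ≤ L ∧ LipschitzWith 1 c ∧ c 0 = γ 0 ∧ c L = γ 1 ∧
      ∀ g : X → ℝ≥0∞, pathIntegral g γ = ∫⁻ t in Icc 0 L, g (c t) := by
  set N := naturalParameterization γ (Icc 0 1) 0 with hN
  have hL : 0 ≤ (curveLength γ).toReal := ENNReal.toReal_nonneg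
  have hc : EqOn (fun t => N (projIcc 0 _ hL t)) N (Icc 0 (curveLength γ).toReal) := by
    intro t ht
    simp only [projIcc_of_mem hL ht]
  refine ⟨fun t => N (projIcc 0 _ hL t), (curveLength γ).toReal, hL, ?_, ?_, ?_, ?_⟩
  · refine LipschitzWith.of_dist_le_mul fun s t => ?_
    refine (hγ.lipschitzOnWith_naturalParameterization.dist_le_mul _ (projIcc 0 _ hL s).2 _
      (projIcc 0 _ hL t).2).trans ?_
    have := (LipschitzWith.projIcc hL).dist_le_mul s t
    simpa [Subtype.dist_eq] using this
  · rw [hc (left_mem_Icc.2 hL), ← hγ.naturalParameterization_variation (left_mem_Icc.2 zero_le_one),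
      variationOnFromTo.self]
  · rw [hc (right_mem_Icc.2 hL),
      ← hγ.naturalParameterization_variation (right_mem_Icc.2 zero_le_one),
      variationOnFromTo_zero_one]
  · intro g
    rw [hγ.pathIntegral_eq]
    refine setLIntegral_congr_fun measurableSet_Icc fun t ht => ?_
    simp only [projIcc_of_mem hL ht, hN]

theorem LipschitzWith.isRectifiableCurve {L : ℝ≥0} {σ : ℝ → X} (hσ : LipschitzWith L σ) :
    IsRectifiableCurve σ :=
  ⟨hσ.continuous.continuousOn, by
    have h : LocallyBoundedVariationOn σ (Icc 0 1) := hσ.locallyBoundedVariationOn _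
    simpa [curveLength, BoundedVariationOn] using
      h 0 1 (left_mem_Icc.2 zero_le_one) (right_mem_Icc.2 zero_le_one)⟩

theorem LipschitzWith.lipschitzOnWith_variation {L : ℝ≥0} {σ : ℝ → X} (hσ : LipschitzWith L σ) :
    LipschitzOnWith L (variationOnFromTo σ (Icc 0 1) 0) (Icc 0 1) := by
  have hloc := hσ.isRectifiableCurve.locallyBoundedVariationOn
  have key : ∀ a ∈ Icc (0 : ℝ) 1, ∀ b ∈ Icc (0 : ℝ) 1, a ≤ b →
      dist (variationOnFromTo σ (Icc 0 1) 0 a) (variationOnFromTo σ (Icc 0 1) 0 b)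
        ≤ L * dist a b := by
    intro a ha b hb hab
    have hadd := variationOnFromTo.add hloc (left_mem_Icc.2 zero_le_one) ha hb
    rw [dist_comm (variationOnFromTo _ _ _ _), Real.dist_eq, ← hadd, add_sub_cancel_left,
      variationOnFromTo.eq_of_le _ _ hab, abs_of_nonneg ENNReal.toReal_nonneg]
    have h1 : eVariationOn σ (Icc 0 1 ∩ Icc a b) ≤ L * ENNReal.ofReal (b - a) := by
      refine (eVariationOn.mono σ inter_subset_right).trans ?_
      rw [← eVariationOn_id_Icc]
      exact (hσ.lipschitzOnWith (s := univ)).comp_eVariationOn_le (mapsTo_univ id _)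
    rw [dist_comm, Real.dist_eq, abs_of_nonneg (sub_nonneg.2 hab)]
    refine (ENNReal.toReal_mono (by finiteness) h1).trans ?_
    rw [ENNReal.toReal_mul, ENNReal.toReal_ofReal (sub_nonneg.2 hab), ENNReal.coe_toReal]
  refine LipschitzOnWith.of_dist_le_mul fun a ha b hb => ?_
  rcases le_total a b with hab | hba
  · exact key a ha b hb hab
  · rw [dist_comm, dist_comm a]
    exact key b hb a ha hba

/-- The curve `σ` is its arc-length parametrization composed with the variation function. The latter
is `L`-Lipschitz, so it enlarges Lebesgue measure, being one-dimensional Hausdorff measure, at most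
by the factor `L`. Comparison with the pushforward measure then takes the place of an area formula
and needs no measurability of `g`. -/
theorem LipschitzWith.pathIntegral_le {L : ℝ≥0} {σ : ℝ → X} (hσ : LipschitzWith L σ)
    (g : X → ℝ≥0∞) : pathIntegral g σ ≤ L * ∫⁻ t in Icc (0 : ℝ) 1, g (σ t) := by
  have hrect := hσ.isRectifiableCurve
  obtain ⟨ℓ, hℓ, hℓeq⟩ := hσ.lipschitzOnWith_variation.extend_real
  rw [hrect.pathIntegral_eq]
  have hmeas : volume.restrict (Icc 0 (curveLength σ).toReal) ≤
      (L : ℝ≥0∞) • Measure.map ℓ (volume.restrict (Icc (0 : ℝ) 1)) := by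
    refine Measure.le_intro fun S hS _ => ?_
    rw [Measure.restrict_apply hS, Measure.smul_apply, Measure.map_apply hℓ.continuous.measurable hS,
      Measure.restrict_apply (hℓ.continuous.measurable hS), smul_eq_mul]
    have hsub : S ∩ Icc 0 (curveLength σ).toReal ⊆ ℓ '' (ℓ ⁻¹' S ∩ Icc 0 1) := by
      rintro s ⟨hsS, hs⟩
      obtain ⟨t, ht, rfl⟩ := hrect.image_variation hs
      exact ⟨t, ⟨by simpa [← hℓeq ht] using hsS, ht⟩, (hℓeq ht).symm⟩
    refine (measure_mono hsub).trans ?_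
    have := hℓ.hausdorffMeasure_image_le zero_le_one (ℓ ⁻¹' S ∩ Icc 0 1)
    rwa [hausdorffMeasure_real, ENNReal.rpow_one] at this
  refine (lintegral_mono' hmeas le_rfl).trans ?_
  rw [lintegral_smul_measure, smul_eq_mul]
  refine mul_le_mul' le_rfl ?_
  refine (lintegral_map_le (μ := volume.restrict (Icc (0 : ℝ) 1))
    (fun s => g (naturalParameterization σ (Icc 0 1) 0 s)) ℓ).trans (le_of_eq ?_)
  refine setLIntegral_congr_fun measurableSet_Icc fun t ht => ?_
  simp only [← hℓeq ht, hrect.naturalParameterization_variation ht]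

/-- Integrating along a `1`-Lipschitz curve bounds the path integral from above. -/
theorem LipschitzWith.pathIntegral_mul_le {c : ℝ → X} (hc : LipschitzWith 1 c) {L : ℝ}
    (hL : 0 ≤ L) (g : X → ℝ≥0∞) :
    IsRectifiableCurve (fun t => c (t * L)) ∧
      pathIntegral g (fun t => c (t * L)) ≤ ∫⁻ t in Icc 0 L, g (c t) := by
  have hσ : LipschitzWith L.toNNReal (fun t => c (t * L)) := by
    refine LipschitzWith.of_dist_le_mul fun s t => ?_
    refine (hc.dist_le_mul _ _).trans (le_of_eq ?_)
    rw [NNReal.coe_one, one_mul, Real.dist_eq, Real.dist_eq, ← sub_mul, abs_mul, abs_of_nonneg hL,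
      Real.coe_toNNReal L hL, mul_comm]
  refine ⟨hσ.isRectifiableCurve, (hσ.pathIntegral_le g).trans ?_⟩
  rcases hL.eq_or_lt with rfl | hL'
  · simp
  · rw [lintegral_Icc_zero_eq_mul _ hL']
    rfl

end Variation

/-- A function on an interval whose right slopes are bounded by a continuous function `G` is
controlled by the integral of `G`. -/
theorem abs_sub_le_integral_of_slope_le {φ G : ℝ → ℝ} (hφ : Continuous φ) (hG : Continuous G)
    (h : ∀ t, ∀ ε > 0, ∀ᶠ z in 𝓝[>] t, |φ z - φ t| ≤ (G t + ε) * (z - t)) {L : ℝ} (hL : 0 ≤ L) :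
    |φ L - φ 0| ≤ ∫ t in (0 : ℝ)..L, G t := by
  have hder : ∀ x, HasDerivAt (fun y => ∫ t in (0 : ℝ)..y, G t) (G x) x := fun x =>
    intervalIntegral.integral_hasDerivAt_right (hG.intervalIntegrable _ _)
      hG.aestronglyMeasurable.stronglyMeasurableAtFilter hG.continuousAt
  refine image_le_of_liminf_slope_right_le_deriv_boundary (f := fun z => |φ z - φ 0|)
    (B := fun y => ∫ t in (0 : ℝ)..y, G t) (B' := G) (a := 0) (b := L) (by fun_prop) (by simp)
    (fun x _ => (hder x).continuousAt.continuousWithinAt) (fun x _ => (hder x).hasDerivWithinAt)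
    (fun x _ r hr => ?_) (right_mem_Icc.2 hL)
  refine Eventually.frequently ?_
  filter_upwards [h x ((r - G x) / 2) (by linarith), self_mem_nhdsWithin] with z hz hxz
  have hpos : 0 < z - x := sub_pos.2 hxz
  rw [slope_def_field, div_lt_iff₀ hpos]
  have h1 : |φ z - φ 0| - |φ x - φ 0| ≤ |φ z - φ x| := by
    have := abs_sub_abs_le_abs_sub (φ z - φ 0) (φ x - φ 0)
    rwa [sub_sub_sub_cancel_right] at this
  nlinarith

/-! ### Lipschitz approximation of lower semicontinuous weights from below -/

section LipschitzApproximation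

variable {X : Type*} [MetricSpace X]

/-- The inf-convolution of `min ρ n` with `n * edist`. -/
noncomputable def infConv (ρ : X → ℝ≥0∞) (n : ℕ) (x : X) : ℝ≥0∞ :=
  ⨅ y, min (ρ y) n + n * edist x y

theorem infConv_le (ρ : X → ℝ≥0∞) (n : ℕ) (x : X) : infConv ρ n x ≤ ρ x :=
  (iInf_le _ x).trans (by simp)

theorem infConv_le_natCast (ρ : X → ℝ≥0∞) (n : ℕ) (x : X) : infConv ρ n x ≤ n :=
  (iInf_le _ x).trans (by simp)

theorem infConv_ne_top (ρ : X → ℝ≥0∞) (n : ℕ) (x : X) : infConv ρ n x ≠ ⊤ :=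
  ne_top_of_le_ne_top (ENNReal.natCast_ne_top n) (infConv_le_natCast ρ n x)

theorem infConv_mono (ρ : X → ℝ≥0∞) (x : X) : Monotone fun n => infConv ρ n x := by
  intro m n hmn
  have h : (m : ℝ≥0∞) ≤ n := by exact_mod_cast hmn
  exact iInf_mono fun y => add_le_add (min_le_min le_rfl h) (by gcongr)

theorem infConv_le_add (ρ : X → ℝ≥0∞) (n : ℕ) (x x' : X) :
    infConv ρ n x ≤ infConv ρ n x' + n * edist x x' := by
  rw [infConv, infConv, ENNReal.iInf_add]
  refine iInf_mono fun y => ?_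
  rw [add_assoc, ← mul_add]
  gcongr
  rw [add_comm]
  exact edist_triangle _ _ _

/-- Competitors within distance `r` of `x` are controlled by the values of `ρ` there, while the
others pay at least `n * r`. For large `n` only the values of `ρ` near `x` matter. -/
theorem le_infConv {ρ : X → ℝ≥0∞} {n : ℕ} {x : X} {a : ℝ≥0∞} {r : ℝ}
    (h : ∀ y, dist x y < r → a ≤ ρ y) (han : a ≤ n) (har : a ≤ n * ENNReal.ofReal r) :
    a ≤ infConv ρ n x := by
  refine le_iInf fun y => ?_
  by_cases hy : dist x y < r
  · exact (le_min (h y hy) han).trans (le_add_of_nonneg_right zero_le)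
  · refine har.trans (le_trans ?_ (le_add_of_nonneg_left zero_le))
    gcongr
    rw [edist_dist]
    exact ENNReal.ofReal_le_ofReal (not_lt.1 hy)

theorem eventually_le_natCast_mul (a : ℝ≥0) {r : ℝ} (hr : 0 < r) :
    ∀ᶠ n : ℕ in atTop, (a : ℝ≥0∞) ≤ n ∧ (a : ℝ≥0∞) ≤ n * ENNReal.ofReal r := by
  have h1 : ∀ᶠ n : ℕ in atTop, (a : ℝ) ≤ n := tendsto_natCast_atTop_atTop.eventually_ge_atTop _
  have h2 : ∀ᶠ n : ℕ in atTop, (a : ℝ) / r ≤ n :=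
    tendsto_natCast_atTop_atTop.eventually_ge_atTop _
  filter_upwards [h1, h2] with n h1 h2
  constructor
  · exact_mod_cast h1
  · rw [div_le_iff₀ hr] at h2
    rw [← ENNReal.ofReal_natCast, ← ENNReal.ofReal_mul (Nat.cast_nonneg _),
      ← ENNReal.ofReal_coe_nnreal]
    exact ENNReal.ofReal_le_ofReal h2

theorem iSup_infConv {ρ : X → ℝ≥0∞} (hρ : LowerSemicontinuous ρ) (x : X) :
    ⨆ n, infConv ρ n x = ρ x := by
  refine le_antisymm (iSup_le fun n => infConv_le ρ n x) ?_
  refine ENNReal.le_of_forall_nnreal_lt fun a ha => ?_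
  obtain ⟨r, hr, hball⟩ := Metric.eventually_nhds_iff.1 (hρ x a ha)
  obtain ⟨n, hn1, hn2⟩ := (eventually_le_natCast_mul a hr).exists
  exact (le_infConv (fun y hy => (hball (by rwa [dist_comm])).le) hn1 hn2).trans
    (le_iSup (fun n => infConv ρ n x) n)

/-- Real-valued Lipschitz functions increasing to a lower semicontinuous function `ρ`. -/
noncomputable def lipApprox (ρ : X → ℝ≥0∞) (n : ℕ) (x : X) : ℝ := (infConv ρ n x).toReal

theorem lipApprox_nonneg (ρ : X → ℝ≥0∞) (n : ℕ) (x : X) : 0 ≤ lipApprox ρ n x :=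
  ENNReal.toReal_nonneg

theorem ofReal_lipApprox (ρ : X → ℝ≥0∞) (n : ℕ) (x : X) :
    ENNReal.ofReal (lipApprox ρ n x) = infConv ρ n x :=
  ENNReal.ofReal_toReal (infConv_ne_top ρ n x)

theorem lipApprox_le_natCast (ρ : X → ℝ≥0∞) (n : ℕ) (x : X) : lipApprox ρ n x ≤ n := by
  simpa [lipApprox] using
    ENNReal.toReal_mono (ENNReal.natCast_ne_top n) (infConv_le_natCast ρ n x)

theorem lipApprox_mono (ρ : X → ℝ≥0∞) (x : X) : Monotone fun n => lipApprox ρ n x :=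
  fun _ n hmn => ENNReal.toReal_mono (infConv_ne_top ρ n x) (infConv_mono ρ x hmn)

theorem lipschitzWith_lipApprox (ρ : X → ℝ≥0∞) (n : ℕ) : LipschitzWith n (lipApprox ρ n) := by
  refine LipschitzWith.of_le_add_mul _ fun x y => ?_
  have h := ENNReal.toReal_mono (by finiteness [infConv_ne_top ρ n y]) (infConv_le_add ρ n x y)
  rw [ENNReal.toReal_add (infConv_ne_top ρ n y) (by finiteness), ENNReal.toReal_mul,
    ENNReal.toReal_natCast, ← dist_edist] at h
  simpa [lipApprox] using h

theorem le_lipApprox {ρ : X → ℝ≥0∞} {n : ℕ} {x : X} {a : ℝ≥0} (h : (a : ℝ≥0∞) ≤ infConv ρ n x) :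
    (a : ℝ) ≤ lipApprox ρ n x := by
  simpa [lipApprox] using ENNReal.toReal_mono (infConv_ne_top ρ n x) h

end LipschitzApproximation

/-! ### Weighted chains of points and their least cost -/

section Chains

variable {X : Type*} [MetricSpace X]

/-- `z 0, …, z N` is a chain of points of `Y` with steps of size at most `δ`. -/
structure IsChainIn (Y : Set X) (δ : ℝ) (N : ℕ) (z : ℕ → X) : Prop where
  mem : ∀ i ≤ N, z i ∈ Y
  step : ∀ i < N, dist (z i) (z (i + 1)) ≤ δ

/-- The `g`-weighted length of a chain. -/
noncomputable def chainCost (g : X → ℝ) (N : ℕ) (z : ℕ → X) : ℝ :=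
  ∑ i ∈ Finset.range N, g (z i) * dist (z i) (z (i + 1))

theorem chainCost_nonneg {g : X → ℝ} (hg : ∀ x, 0 ≤ g x) (N : ℕ) (z : ℕ → X) :
    0 ≤ chainCost g N z :=
  Finset.sum_nonneg fun _ _ => mul_nonneg (hg _) dist_nonneg

/-- Telescoping along the chain: a discrete upper gradient inequality. With a suitable test function
`Φ` it bounds chain costs from below. -/
theorem abs_sub_le_chainCost {g : X → ℝ} (hg : ∀ x, 0 ≤ g x) {N : ℕ} {z : ℕ → X} {Φ : X → ℝ}
    (h : ∀ k < N, |Φ (z (k + 1)) - Φ (z k)| ≤ g (z k) * dist (z k) (z (k + 1)))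
    {i l : ℕ} (hi : i ≤ N) (hl : l ≤ N) : |Φ (z i) - Φ (z l)| ≤ chainCost g N z := by
  wlog hil : i ≤ l generalizing i l
  · rw [abs_sub_comm]
    exact this hl hi (le_of_not_ge hil)
  have h1 : |Φ (z i) - Φ (z l)| ≤
      ∑ k ∈ Finset.Ico i l, g (z k) * dist (z k) (z (k + 1)) := by
    rw [abs_sub_comm, ← Finset.sum_Ico_sub (fun k => Φ (z k)) hil]
    refine (Finset.abs_sum_le_sum_abs _ _).trans (Finset.sum_le_sum fun k hk => h k ?_)
    exact (Finset.mem_Ico.1 hk).2.trans_le hl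
  refine h1.trans (Finset.sum_le_sum_of_subset_of_nonneg ?_ fun k _ _ =>
    mul_nonneg (hg _) dist_nonneg)
  intro k hk
  exact Finset.mem_range.2 ((Finset.mem_Ico.1 hk).2.trans_le hl)

/-- The costs of chains ending at `x`, with initial cost `M`. -/
def chainCosts (Y : Set X) (δ : ℝ) (g M : X → ℝ) (x : X) : Set ℝ :=
  {c | ∃ N z, IsChainIn Y δ N z ∧ z N = x ∧ c = M (z 0) + chainCost g N z}

/-- The least cost, truncated at `1`, of a chain in `Y` ending at `x`. -/
noncomputable def chainInf (Y : Set X) (δ : ℝ) (g M : X → ℝ) (x : X) : ℝ :=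
  sInf (insert 1 (chainCosts Y δ g M x))

variable {Y : Set X} {δ : ℝ} {g M : X → ℝ}

theorem chainCosts_nonneg (hg : ∀ x, 0 ≤ g x) (hM : ∀ x, 0 ≤ M x) {x : X} {c : ℝ}
    (hc : c ∈ insert 1 (chainCosts Y δ g M x)) : 0 ≤ c := by
  rcases hc with rfl | ⟨N, z, -, -, rfl⟩
  · exact zero_le_one
  · exact add_nonneg (hM _) (chainCost_nonneg hg N z)

theorem bddBelow_chainCosts (hg : ∀ x, 0 ≤ g x) (hM : ∀ x, 0 ≤ M x) (x : X) :
    BddBelow (insert 1 (chainCosts Y δ g M x)) :=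
  ⟨0, fun _ hc => chainCosts_nonneg hg hM hc⟩

theorem chainInf_nonneg (hg : ∀ x, 0 ≤ g x) (hM : ∀ x, 0 ≤ M x) (x : X) :
    0 ≤ chainInf Y δ g M x :=
  le_csInf (insert_nonempty _ _) fun _ hc => chainCosts_nonneg hg hM hc

theorem chainInf_le_one (hg : ∀ x, 0 ≤ g x) (hM : ∀ x, 0 ≤ M x) (x : X) :
    chainInf Y δ g M x ≤ 1 :=
  csInf_le (bddBelow_chainCosts hg hM x) (mem_insert _ _)

theorem chainInf_le_initial (hg : ∀ x, 0 ≤ g x) (hM : ∀ x, 0 ≤ M x) {x : X} (hx : x ∈ Y) :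
    chainInf Y δ g M x ≤ M x := by
  refine csInf_le (bddBelow_chainCosts hg hM x) (mem_insert_of_mem _ ⟨0, fun _ => x, ⟨?_, ?_⟩,
    rfl, ?_⟩)
  · exact fun _ _ => hx
  · exact fun _ h => absurd h (Nat.not_lt_zero _)
  · simp [chainCost]

theorem exists_chain_of_chainInf_lt {x : X} {a : ℝ} (h : chainInf Y δ g M x < a) (ha : a ≤ 1) :
    ∃ N z, IsChainIn Y δ N z ∧ z N = x ∧ M (z 0) + chainCost g N z < a := by
  obtain ⟨c, hc, hca⟩ := exists_lt_of_csInf_lt (insert_nonempty _ _) h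
  rcases hc with rfl | ⟨N, z, hz, hzx, rfl⟩
  · exact absurd hca (not_lt.2 ha)
  · exact ⟨N, z, hz, hzx, hca⟩

/-- A nearly optimal chain ending at `x` is prolonged by a single step to `y`. No curve between the
points is needed, which is the reason for working with chains. If the value at `x` is within `ε` of
the truncation level `1`, there may be no such chain, but then the bound is trivial. -/
theorem chainInf_le_add (hg : ∀ x, 0 ≤ g x) (hM : ∀ x, 0 ≤ M x) {x y : X} (hy : y ∈ Y)
    (hxy : dist x y ≤ δ) : chainInf Y δ g M y ≤ chainInf Y δ g M x + g x * dist x y := by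
  refine le_of_forall_pos_le_add fun ε hε => ?_
  have hpos : 0 ≤ g x * dist x y := mul_nonneg (hg x) dist_nonneg
  rcases le_or_gt 1 (chainInf Y δ g M x + ε) with h1 | h1
  · linarith [chainInf_le_one (Y := Y) (δ := δ) hg hM y]
  obtain ⟨N, z, hz, rfl, hcost⟩ := exists_chain_of_chainInf_lt
    (lt_add_of_pos_right (chainInf Y δ g M x) hε) h1.le
  have hold : ∀ i ≤ N, Function.update z (N + 1) y i = z i := fun i hi =>
    Function.update_of_ne (by omega) _ _
  have hnew : Function.update z (N + 1) y (N + 1) = y := Function.update_self _ _ _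
  have hmem : M (z 0) + chainCost g N z + g (z N) * dist (z N) y ∈
      insert 1 (chainCosts Y δ g M y) := by
    refine mem_insert_of_mem _ ⟨N + 1, Function.update z (N + 1) y, ⟨?_, ?_⟩, hnew, ?_⟩
    · intro i hi
      rcases Nat.le_succ_iff.1 hi with hi | rfl
      · rw [hold i hi]
        exact hz.mem i hi
      · rwa [hnew]
    · intro i hi
      rcases Nat.lt_succ_iff_lt_or_eq.1 hi with hi | rfl
      · rw [hold i hi.le, hold (i + 1) hi]
        exact hz.step i hi
      · rwa [hold i le_rfl, hnew]
    · rw [chainCost, chainCost, Finset.sum_range_succ, hold 0 (Nat.zero_le _), hold N le_rfl, hnew,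
        add_assoc]
      congr 2
      refine Finset.sum_congr rfl fun i hi => ?_
      rw [hold i (Finset.mem_range.1 hi).le, hold (i + 1) (Finset.mem_range.1 hi)]
  have := csInf_le (bddBelow_chainCosts hg hM y) hmem
  rw [chainInf]
  linarith

theorem abs_chainInf_sub_le (hg : ∀ x, 0 ≤ g x) (hM : ∀ x, 0 ≤ M x) {x y : X} (hx : x ∈ Y)
    (hy : y ∈ Y) (hxy : dist x y ≤ δ) :
    |chainInf Y δ g M x - chainInf Y δ g M y| ≤ max (g x) (g y) * dist x y := by
  rw [abs_sub_le_iff]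
  have h1 := chainInf_le_add hg hM hy hxy
  have h2 := chainInf_le_add hg hM hx (dist_comm x y ▸ hxy)
  rw [dist_comm y x] at h2
  have h3 : g x * dist x y ≤ max (g x) (g y) * dist x y := by gcongr; exact le_max_left _ _
  have h4 : g y * dist x y ≤ max (g x) (g y) * dist x y := by gcongr; exact le_max_right _ _
  constructor <;> linarith

theorem chainInf_anti_set (hg : ∀ x, 0 ≤ g x) (hM : ∀ x, 0 ≤ M x) {Y' : Set X} (h : Y ⊆ Y')
    (x : X) : chainInf Y' δ g M x ≤ chainInf Y δ g M x := by
  refine csInf_le_csInf (bddBelow_chainCosts hg hM x) (insert_nonempty _ _) (insert_subset_insert ?_)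
  rintro c ⟨N, z, hz, hzx, rfl⟩
  exact ⟨N, z, ⟨fun i hi => h (hz.mem i hi), hz.step⟩, hzx, rfl⟩

theorem chainInf_of_notMem {x : X} (hx : x ∉ Y) : chainInf Y δ g M x = 1 := by
  have : chainCosts Y δ g M x = ∅ := by
    rw [eq_empty_iff_forall_notMem]
    rintro c ⟨N, z, hz, rfl, -⟩
    exact hx (hz.mem N le_rfl)
  rw [chainInf, this, insert_empty_eq, csInf_singleton]

theorem continuousOn_chainInf (hδ : 0 < δ) (hgc : Continuous g) (hg : ∀ x, 0 ≤ g x)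
    (hM : ∀ x, 0 ≤ M x) : ContinuousOn (chainInf Y δ g M) Y := by
  intro x hx
  rw [ContinuousWithinAt, tendsto_iff_dist_tendsto_zero]
  have hlim : Tendsto (fun y => max (g y) (g x) * dist y x) (𝓝[Y] x) (𝓝 0) := by
    have : Continuous fun y => max (g y) (g x) * dist y x := by fun_prop
    simpa using (this.tendsto x).mono_left nhdsWithin_le_nhds
  refine squeeze_zero' (Eventually.of_forall fun _ => dist_nonneg) ?_ hlim
  filter_upwards [self_mem_nhdsWithin, nhdsWithin_le_nhds (Metric.closedBall_mem_nhds x hδ)]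
    with y hy hyx
  exact abs_chainInf_sub_le hg hM hy hx hyx

theorem measurable_chainInf [MeasurableSpace X] [BorelSpace X] (hY : IsClosed Y) (hδ : 0 < δ)
    (hgc : Continuous g) (hg : ∀ x, 0 ≤ g x) (hM : ∀ x, 0 ≤ M x) :
    Measurable (chainInf Y δ g M) := by
  classical
  have h := (continuousOn_chainInf hδ hgc hg hM).measurable_piecewise
    (continuousOn_const (c := (1 : ℝ)) (s := Yᶜ)) hY.measurableSet
  convert h using 1
  ext x
  by_cases hx : x ∈ Y
  · simp [hx]
  · simp [hx, chainInf_of_notMem hx]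

/-- The truncated chain cost grows along a curve at most like the integral of `g`. -/
theorem chainInf_le_add_lintegral (hδ : 0 < δ) (hgc : Continuous g) (hg : ∀ x, 0 ≤ g x)
    (hM : ∀ x, 0 ≤ M x) {c : ℝ → X} (hc : LipschitzWith 1 c) (hcY : ∀ t, c t ∈ Y) {L : ℝ}
    (hL : 0 ≤ L) : ENNReal.ofReal (chainInf Y δ g M (c L)) ≤
      ENNReal.ofReal (chainInf Y δ g M (c 0)) + ∫⁻ t in Icc 0 L, ENNReal.ofReal (g (c t)) := by
  have hφ : Continuous fun t => chainInf Y δ g M (c t) :=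
    (continuousOn_chainInf hδ hgc hg hM).comp_continuous hc.continuous hcY
  have hG : Continuous fun t => g (c t) := hgc.comp hc.continuous
  have hmain := abs_sub_le_integral_of_slope_le hφ hG (fun t ε hε => ?_) hL
  · have hint : ENNReal.ofReal (∫ t in (0 : ℝ)..L, g (c t)) =
        ∫⁻ t in Icc 0 L, ENNReal.ofReal (g (c t)) := by
      rw [intervalIntegral.integral_of_le hL, ← integral_Icc_eq_integral_Ioc,
        ofReal_integral_eq_lintegral_ofReal (hG.integrableOn_Icc)
          (Eventually.of_forall fun t => hg _)]
    rw [← hint, ← ENNReal.ofReal_add (chainInf_nonneg hg hM _)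
      (intervalIntegral.integral_nonneg hL fun t _ => hg _)]
    have habs := le_abs_self (chainInf Y δ g M (c L) - chainInf Y δ g M (c 0))
    exact ENNReal.ofReal_le_ofReal (by linarith)
  · have h1 : ∀ᶠ z in 𝓝[>] t, g (c z) < g (c t) + ε :=
      nhdsWithin_le_nhds ((hG.tendsto t).eventually_lt_const (by linarith))
    have h2 : ∀ᶠ z in 𝓝[>] t, dist z t ≤ δ :=
      nhdsWithin_le_nhds (Metric.closedBall_mem_nhds t hδ)
    filter_upwards [h1, h2, self_mem_nhdsWithin] with z hz1 hz2 hz3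
    have hd : dist (c z) (c t) ≤ z - t := by
      have := hc.dist_le_mul z t
      rwa [NNReal.coe_one, one_mul, Real.dist_eq, abs_of_pos (sub_pos.2 hz3)] at this
    have hd' : dist (c z) (c t) ≤ δ := by
      refine (hc.dist_le_mul z t).trans ?_
      simpa using hz2
    refine (abs_chainInf_sub_le hg hM (hcY z) (hcY t) hd').trans ?_
    have hmax : max (g (c z)) (g (c t)) ≤ g (c t) + ε := max_le hz1.le (by linarith)
    have := hg (c t)
    gcongr

end Chains

/-! ### Chains as step functions of unit speed -/

section ChainCurve

variable {X : Type*} [MetricSpace X]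

/-- The length of the first `i` steps of a chain. -/
noncomputable def chainLength (z : ℕ → X) (i : ℕ) : ℝ :=
  ∑ k ∈ Finset.range i, dist (z k) (z (k + 1))

theorem chainLength_zero (z : ℕ → X) : chainLength z 0 = 0 := Finset.sum_range_zero _

theorem chainLength_succ (z : ℕ → X) (i : ℕ) :
    chainLength z (i + 1) = chainLength z i + dist (z i) (z (i + 1)) :=
  Finset.sum_range_succ _ _

theorem chainLength_mono (z : ℕ → X) : Monotone (chainLength z) :=
  monotone_nat_of_le_succ fun i => by
    rw [chainLength_succ]
    exact le_add_of_nonneg_right dist_nonneg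

theorem chainLength_nonneg (z : ℕ → X) (i : ℕ) : 0 ≤ chainLength z i :=
  Finset.sum_nonneg fun _ _ => dist_nonneg

theorem dist_le_chainLength_sub (z : ℕ → X) {i j : ℕ} (hij : i ≤ j) :
    dist (z i) (z j) ≤ chainLength z j - chainLength z i := by
  rw [chainLength, chainLength, ← Finset.sum_Ico_eq_sub _ hij]
  exact dist_le_Ico_sum_dist z hij

open Classical in
/-- The index of the point of the chain which is occupied at time `t`. -/
noncomputable def chainIndex (N : ℕ) (z : ℕ → X) (t : ℝ) : ℕ :=
  Nat.findGreatest (fun i => chainLength z i ≤ t) N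

/-- The step function which traverses a chain at unit speed. -/
noncomputable def chainCurve (N : ℕ) (z : ℕ → X) (t : ℝ) : X := z (chainIndex N z t)

theorem chainIndex_le (N : ℕ) (z : ℕ → X) (t : ℝ) : chainIndex N z t ≤ N :=
  Nat.findGreatest_le _

theorem chainLength_chainIndex_le (N : ℕ) (z : ℕ → X) {t : ℝ} (ht : 0 ≤ t) :
    chainLength z (chainIndex N z t) ≤ t := by
  classical
  exact Nat.findGreatest_spec (P := fun i => chainLength z i ≤ t) (Nat.zero_le N)
    (by rwa [chainLength_zero])

theorem lt_chainLength_of_chainIndex_lt {N : ℕ} {z : ℕ → X} {t : ℝ} {i : ℕ}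
    (h : chainIndex N z t < i) (hi : i ≤ N) : t < chainLength z i :=
  not_le.1 (Nat.findGreatest_is_greatest h hi)

theorem chainIndex_mono (N : ℕ) (z : ℕ → X) : Monotone (chainIndex N z) := by
  intro s t hst
  exact Nat.findGreatest_mono_left (fun i hi => hi.trans hst) N

theorem chainIndex_eq {N : ℕ} {z : ℕ → X} {t : ℝ} {i : ℕ} (hi : i < N)
    (h1 : chainLength z i ≤ t) (h2 : t < chainLength z (i + 1)) : chainIndex N z t = i := by
  classical
  refine le_antisymm ?_ (Nat.le_findGreatest hi.le h1)
  by_contra! hlt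
  have h3 := chainLength_chainIndex_le N z ((chainLength_nonneg z i).trans h1)
  exact absurd (h2.trans_le (chainLength_mono z hlt)) (not_lt.2 h3)

theorem chainCurve_chainLength (N : ℕ) (z : ℕ → X) : chainCurve N z (chainLength z N) = z N := by
  classical
  have : chainIndex N z (chainLength z N) = N :=
    le_antisymm (chainIndex_le _ _ _) (Nat.le_findGreatest le_rfl le_rfl)
  rw [chainCurve, this]

theorem chainCurve_zero (N : ℕ) (z : ℕ → X) : chainCurve N z 0 = z 0 := by
  have h1 := dist_le_chainLength_sub z (Nat.zero_le (chainIndex N z 0))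
  rw [chainLength_zero, sub_zero] at h1
  exact (dist_le_zero.1 (h1.trans (chainLength_chainIndex_le N z le_rfl))).symm

variable {Y : Set X} {δ : ℝ} {N : ℕ} {z : ℕ → X}

theorem IsChainIn.chainCurve_mem (hz : IsChainIn Y δ N z) (t : ℝ) : chainCurve N z t ∈ Y :=
  hz.mem _ (chainIndex_le _ _ _)

/-- The vertex following the one occupied at time `s` is reached only after `s`, so the vertex
occupied at `s` has chain length more than `s - δ`. The vertex occupied at a later time `t` has
chain length at most `t`. Hence the speed is at most one, up to a single jump. -/
theorem IsChainIn.dist_chainCurve_le (hz : IsChainIn Y δ N z) (hδ : 0 ≤ δ) (s t : ℝ) :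
    dist (chainCurve N z s) (chainCurve N z t) ≤ |s - t| + δ := by
  wlog hst : s ≤ t generalizing s t
  · rw [dist_comm, abs_sub_comm]
    exact this t s (le_of_not_ge hst)
  have hij := chainIndex_mono N z hst
  rcases hij.eq_or_lt with h | h
  · rw [chainCurve, chainCurve, h, dist_self]
    positivity
  have hiN : chainIndex N z s < N := h.trans_le (chainIndex_le N z t)
  -- For negative times the index takes its default value `0`, so it cannot have increased up to
  -- such a time.
  have h0t : 0 ≤ t := by
    by_contra! ht
    refine absurd h (not_lt.2 ?_)
    have : chainIndex N z t = 0 := by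
      rw [chainIndex, Nat.findGreatest_eq_zero_iff]
      intro i _ _
      exact not_le.2 (ht.trans_le (chainLength_nonneg z i))
    omega
  have h1 := lt_chainLength_of_chainIndex_lt (Nat.lt_succ_self (chainIndex N z s)) hiN
  rw [Nat.succ_eq_add_one, chainLength_succ] at h1
  have h2 := hz.step _ hiN
  have h3 := chainLength_chainIndex_le N z h0t
  have h4 := dist_le_chainLength_sub z hij
  rw [abs_sub_comm, abs_of_nonneg (sub_nonneg.2 hst), chainCurve, chainCurve]
  linarith

/-- During each half-open time interval the step function rests at the initial vertex of the step,
which is where `chainCost` evaluates the weight. -/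
theorem lintegral_chainCurve_le {g : X → ℝ} (hg : ∀ x, 0 ≤ g x) (N : ℕ) (z : ℕ → X) :
    ∫⁻ t in Ico 0 (chainLength z N), ENNReal.ofReal (g (chainCurve N z t)) ≤
      ENNReal.ofReal (chainCost g N z) := by
  suffices h : ∀ m ≤ N, ∫⁻ t in Ico 0 (chainLength z m), ENNReal.ofReal (g (chainCurve N z t)) ≤
      ENNReal.ofReal (chainCost g m z) from h N le_rfl
  intro m
  induction m with
  | zero => simp [chainLength_zero]
  | succ m ih =>
    intro hm
    have hunion : Ico 0 (chainLength z (m + 1)) =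
        Ico 0 (chainLength z m) ∪ Ico (chainLength z m) (chainLength z (m + 1)) :=
      (Ico_union_Ico_eq_Ico (chainLength_nonneg z m) (chainLength_mono z m.le_succ)).symm
    rw [hunion]
    refine (lintegral_union_le _ _ _).trans ?_
    rw [chainCost, Finset.sum_range_succ, ENNReal.ofReal_add
      (Finset.sum_nonneg fun _ _ => mul_nonneg (hg _) dist_nonneg)
      (mul_nonneg (hg _) dist_nonneg)]
    refine add_le_add (ih (by omega)) (le_of_eq ?_)
    rw [setLIntegral_congr_fun (g := fun _ => ENNReal.ofReal (g (z m))) measurableSet_Ico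
      fun t ht => ?_]
    · rw [setLIntegral_const, Real.volume_Ico, chainLength_succ, add_sub_cancel_left,
        ← ENNReal.ofReal_mul (hg _)]
    · simp only [chainCurve, chainIndex_eq (Nat.lt_of_succ_le hm) ht.1 ht.2]

end ChainCurve

/-! ### Limits along ultrafilters -/

section Ultralimits

variable {X : Type*} [MetricSpace X]

/-- At each scale finitely many balls cover the compact set, and the ultrafilter must choose one of
the slightly larger balls. So the image filter is Cauchy, and completeness of `Y` suffices although
`Y` need not be compact. -/
theorem exists_tendsto_ultrafilter_of_near_compact {ι : Type*} (𝒰 : Ultrafilter ι) {Y : Set X}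
    (hY : IsComplete Y) {p : ι → X} (hp : ∀ i, p i ∈ Y)
    (h : ∀ s > 0, ∃ C, IsCompact C ∧ ∀ᶠ i in (𝒰 : Filter ι), ∃ y ∈ C, dist (p i) y < s) :
    ∃ x ∈ Y, Tendsto p 𝒰 (𝓝 x) := by
  have hcauchy : Cauchy (map p (𝒰 : Filter ι)) := by
    rw [Metric.cauchy_iff]
    refine ⟨inferInstance, fun ε hε => ?_⟩
    obtain ⟨C, hC, hev⟩ := h (ε / 4) (by linarith)
    obtain ⟨T, -, hTfin, hT⟩ := hC.finite_cover_balls (show 0 < ε / 4 by linarith)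
    have hmem : (⋃ y ∈ T, p ⁻¹' Metric.ball y (ε / 2)) ∈ 𝒰 := by
      filter_upwards [hev] with i ⟨y, hy, hiy⟩
      obtain ⟨y', hy', hyy'⟩ := mem_iUnion₂.1 (hT hy)
      refine mem_iUnion₂.2 ⟨y', hy', ?_⟩
      rw [Metric.mem_ball] at hyy'
      rw [mem_preimage, Metric.mem_ball]
      linarith [dist_triangle (p i) y y']
    obtain ⟨y, -, hy⟩ := (Ultrafilter.finite_biUnion_mem_iff hTfin).1 hmem
    refine ⟨Metric.ball y (ε / 2), hy, fun a ha b hb => ?_⟩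
    rw [Metric.mem_ball] at ha hb
    linarith [dist_triangle_right a b y]
  obtain ⟨x, hx, hle⟩ := hY _ hcauchy (le_principal_iff.2 (mem_map.2 (univ_mem' hp)))
  exact ⟨x, hx, hle⟩

theorem exists_tendsto_ultrafilter_of_eventually_mem_Icc {ι : Type*} (𝒰 : Ultrafilter ι)
    {p : ι → ℝ} {a b : ℝ} (h : ∀ᶠ i in (𝒰 : Filter ι), p i ∈ Icc a b) :
    ∃ x ∈ Icc a b, Tendsto p 𝒰 (𝓝 x) :=
  isCompact_Icc.ultrafilter_le_nhds (𝒰.map p) (le_principal_iff.2 h)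

/-- Equi-Lipschitz functions, up to errors tending to zero, which converge pointwise along a
filter converge uniformly on compact intervals. -/
theorem eventually_forall_dist_lt_of_tendsto {ι : Type*} {l : Filter ι} {c : ι → ℝ → X}
    {γ : ℝ → X} {δ : ι → ℝ} (hδ : Tendsto δ l (𝓝 0))
    (hc : ∀ i s t, dist (c i s) (c i t) ≤ |s - t| + δ i) (hγ : LipschitzWith 1 γ)
    (hlim : ∀ t, Tendsto (fun i => c i t) l (𝓝 (γ t))) (L : ℝ) {η : ℝ} (hη : 0 < η) :
    ∀ᶠ i in l, ∀ t ∈ Icc 0 L, dist (c i t) (γ t) < η := by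
  obtain ⟨T, -, hTfin, hT⟩ := (isCompact_Icc (a := 0) (b := L)).finite_cover_balls
    (show 0 < η / 5 by linarith)
  have h1 : ∀ᶠ i in l, ∀ τ ∈ T, dist (c i τ) (γ τ) < η / 5 :=
    (hTfin.eventually_all).2 fun τ _ => (Metric.tendsto_nhds.1 (hlim τ)) _ (by linarith)
  filter_upwards [h1, hδ.eventually_lt_const (show 0 < η / 5 by linarith)] with i hi hδi t ht
  obtain ⟨τ, hτ, htτ⟩ := mem_iUnion₂.1 (hT ht)
  rw [Metric.mem_ball, Real.dist_eq] at htτ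
  have h2 := hc i t τ
  have h3 := hγ.dist_le_mul τ t
  rw [NNReal.coe_one, one_mul, Real.dist_eq, abs_sub_comm] at h3
  have h4 := dist_triangle4 (c i t) (c i τ) (γ τ) (γ t)
  linarith [hi τ hτ]

end Ultralimits

/-! ### Chains of bounded cost stay near compact sets -/

section Compactness

variable {X : Type*} [MetricSpace X]

/-- Suppose that `z i` is far from `K ∪ K'`. Then the weight is at least `j` on the ball of radius
`2 * r` about `z i`, where `r = min s d / 4`, and by the condition on its ends the chain has a
vertex at distance at least `r` from `z i`. The test function `Φ`, a cone of height `j * r` over the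
ball of radius `r`, shows that this costs at least `j * r`, more than the budget `a`. -/
theorem IsChainIn.exists_dist_lt_of_penalty {Y : Set X} {δ : ℝ} {N : ℕ} {z : ℕ → X}
    (hz : IsChainIn Y δ N z) {g : X → ℝ} (hg : ∀ x, 0 ≤ g x) {K K' : Set X} {s d j a : ℝ}
    (hs : 0 < s) (hd : 0 < d) (hj : 0 ≤ j) (hδ : δ ≤ min s d / 4)
    (hpen : ∀ x ∈ Y, (∀ y ∈ K', s / 2 ≤ dist x y) → j ≤ g x)
    (hend : z 0 ∈ K ∨ z N ∈ K ∨ d ≤ dist (z 0) (z N)) (hcost : chainCost g N z ≤ a)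
    (hja : a < j * (min s d / 4)) {i : ℕ} (hi : i ≤ N) : ∃ y ∈ K ∪ K', dist (z i) y < s := by
  by_contra! hfar
  have hr : 0 < min s d := lt_min hs hd
  have hrs : min s d ≤ s := min_le_left _ _
  have hrd : min s d ≤ d := min_le_right _ _
  set r := min s d / 4 with hrdef
  set Φ : X → ℝ := fun y => j * max 0 (r - dist y (z i)) with hΦ
  have hout : ∀ y, r ≤ dist y (z i) → Φ y = 0 := fun y hy => by
    simp only [hΦ, max_eq_left (sub_nonpos.2 hy), mul_zero]
  have hstep : ∀ k < N, |Φ (z (k + 1)) - Φ (z k)| ≤ g (z k) * dist (z k) (z (k + 1)) := by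
    intro k hk
    by_cases hki : dist (z k) (z i) < 2 * r
    · have hgk : j ≤ g (z k) := by
        refine hpen _ (hz.mem k hk.le) fun y hy => ?_
        have h1 := hfar y (Or.inr hy)
        have h2 := dist_triangle_left (z i) y (z k)
        linarith
      simp only [hΦ]
      rw [← mul_sub, abs_mul, abs_of_nonneg hj]
      refine mul_le_mul hgk ?_ (abs_nonneg _) (hg _)
      rw [max_comm 0, max_comm 0]
      refine (abs_max_sub_max_le_abs _ _ _).trans ?_
      rw [sub_sub_sub_cancel_left]
      exact abs_dist_sub_le _ _ _
    -- Steps are no longer than `r`, so a step starting outside the ball of radius `2 * r` stays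
    -- outside the support of `Φ`.
    · have h1 := hz.step k hk
      have h2 := dist_triangle (z k) (z (k + 1)) (z i)
      rw [hout (z k) (by linarith), hout (z (k + 1)) (by linarith), sub_self, abs_zero]
      exact mul_nonneg (hg _) dist_nonneg
  have hexit : ∃ l ≤ N, r ≤ dist (z l) (z i) := by
    rcases hend with h | h | h
    · refine ⟨0, Nat.zero_le _, ?_⟩
      have := hfar _ (Or.inl h)
      rw [dist_comm]
      linarith
    · refine ⟨N, le_rfl, ?_⟩
      have := hfar _ (Or.inl h)
      rw [dist_comm]
      linarith
    · by_contra! hl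
      have h1 := hl 0 (Nat.zero_le _)
      have h2 := hl N le_rfl
      have h3 := dist_triangle_right (z 0) (z N) (z i)
      linarith
  obtain ⟨l, hl, hlr⟩ := hexit
  have h1 := abs_sub_le_chainCost hg hstep hi hl
  have h2 : Φ (z i) = j * r := by
    simp only [hΦ, dist_self, sub_zero]
    rw [max_eq_right (by linarith)]
  rw [hout _ hlr, h2, sub_zero, abs_of_nonneg (mul_nonneg hj (by linarith))] at h1
  linarith

theorem mul_chainLength_le_chainCost {Y : Set X} {δ : ℝ} {N : ℕ} {z : ℕ → X}
    (hz : IsChainIn Y δ N z) {g : X → ℝ} {c : ℝ} (hc : ∀ x ∈ Y, c ≤ g x) :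
    c * chainLength z N ≤ chainCost g N z := by
  rw [chainLength, chainCost, Finset.mul_sum]
  refine Finset.sum_le_sum fun i hi => ?_
  have := hc _ (hz.mem i (Finset.mem_range.1 hi).le)
  gcongr

end Compactness

/-! ### Coercive weights and lower semicontinuity of the cost -/

section Coercive

variable {X : Type*} [MetricSpace X]

/-- The weight `ρ` is coercive on `Y`: its Lipschitz approximations are eventually bounded below by
a positive constant on `Y`, and by any given number away from a suitable compact set. -/
structure IsCoerciveOn (ρ : X → ℝ≥0∞) (Y : Set X) : Prop where
  lower : ∃ c > 0, ∀ᶠ n in atTop, ∀ x ∈ Y, c ≤ lipApprox ρ n x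
  penalty : ∀ j : ℕ, ∃ C, IsCompact C ∧ ∀ s > 0, ∀ᶠ n in atTop, ∀ x ∈ Y,
    (∀ y ∈ C, s ≤ dist x y) → (j : ℝ) ≤ lipApprox ρ n x

/-- Points of chains of bounded cost accumulate at a compact set. -/
theorem IsCoerciveOn.exists_compact_near {ρ : X → ℝ≥0∞} {Y : Set X} (hρY : IsCoerciveOn ρ Y)
    {K : Set X} (hK : IsCompact K) {d : ℝ} (hd : 0 < d) {𝒰 : Filter ℕ}
    (h𝒰 : 𝒰 ≤ atTop) {δ : ℕ → ℝ} (hδ : Tendsto δ 𝒰 (𝓝 0)) {N : ℕ → ℕ}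
    {z : ℕ → ℕ → X} (hz : ∀ n, IsChainIn Y (δ n) (N n) (z n)) {a : ℝ}
    (hcost : ∀ᶠ n in 𝒰, chainCost (lipApprox ρ n) (N n) (z n) ≤ a)
    (hend : ∀ n, z n 0 ∈ K ∨ z n (N n) ∈ K ∨ d ≤ dist (z n 0) (z n (N n))) {s : ℝ} (hs : 0 < s) :
    ∃ C, IsCompact C ∧ ∀ᶠ n in 𝒰, ∀ i ≤ N n, ∃ y ∈ C, dist (z n i) y < s := by
  have hr : 0 < min s d / 4 := by positivity
  obtain ⟨j, hj⟩ := exists_nat_gt (a / (min s d / 4))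
  rw [div_lt_iff₀ hr] at hj
  obtain ⟨C, hC, hpen⟩ := hρY.penalty j
  refine ⟨K ∪ C, hK.union hC, ?_⟩
  filter_upwards [hcost, hδ.eventually_le_const hr, h𝒰 (hpen (s / 2) (by linarith))]
    with n h1 h2 h3 i hi
  exact (hz n).exists_dist_lt_of_penalty (lipApprox_nonneg ρ n) hs hd j.cast_nonneg h2 h3 (hend n)
    h1 hj hi

/-- The index `m` of the integrand is frozen while the chains vary with `n`. For `n ≥ m` the `m`-th
approximation is dominated by the `n`-th, and it is `m`-Lipschitz, so replacing `γ` by the chain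
curve costs `m * η` per unit of time. The part of `[0, L]` beyond the length of the chain is short,
and there the integrand is at most `m`. -/
theorem eventually_lintegral_lipApprox_le {ρ : X → ℝ≥0∞} {𝒰 : Filter ℕ} (h𝒰 : 𝒰 ≤ atTop)
    {N : ℕ → ℕ} {z : ℕ → ℕ → X} {γ : ℝ → X} {L : ℝ} (hL : 0 ≤ L)
    (hlen : Tendsto (fun n => chainLength (z n) (N n)) 𝒰 (𝓝 L))
    (hunif : ∀ η > 0, ∀ᶠ n in 𝒰, ∀ t ∈ Icc 0 L, dist (chainCurve (N n) (z n) t) (γ t) < η)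
    (m : ℕ) {ε : ℝ} (hε : 0 < ε) :
    ∀ᶠ n in 𝒰, ∫⁻ t in Icc 0 L, ENNReal.ofReal (lipApprox ρ m (γ t)) ≤
      ENNReal.ofReal (chainCost (lipApprox ρ n) (N n) (z n) + ε) := by
  set η : ℝ := ε / (2 * (m + 1) * (L + 1)) with hη
  have hm : (0 : ℝ) < m + 1 := by positivity
  have hηpos : 0 < η := by positivity
  have hηL : m * η * L ≤ ε / 2 := by
    have h1 : (m + 1) * η * (L + 1) = ε / 2 := by rw [hη]; field_simp
    have h2 : (m : ℝ) * η * L ≤ (m + 1) * η * (L + 1) := by gcongr <;> linarith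
    linarith
  have hlen' : ∀ᶠ n in 𝒰, m * (L - chainLength (z n) (N n)) < ε / 2 := by
    have : Tendsto (fun n => m * (L - chainLength (z n) (N n))) 𝒰 (𝓝 (m * (L - L))) :=
      (tendsto_const_nhds.sub hlen).const_mul _
    refine this.eventually_lt_const ?_
    rw [sub_self, mul_zero]
    linarith
  filter_upwards [hunif η hηpos, hlen', h𝒰 (eventually_ge_atTop m)] with n h1 h2 h3
  set ℓ := chainLength (z n) (N n)
  have hℓ0 : 0 ≤ ℓ := chainLength_nonneg _ _
  set c := chainCurve (N n) (z n)
  have hsub : Icc 0 L ⊆ (Ico 0 ℓ ∩ Icc 0 L) ∪ Icc ℓ L := by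
    intro t ht
    rcases lt_or_ge t ℓ with h | h
    · exact Or.inl ⟨⟨ht.1, h⟩, ht⟩
    · exact Or.inr ⟨h, ht.2⟩
  have hA : ∫⁻ t in Ico 0 ℓ ∩ Icc 0 L, ENNReal.ofReal (lipApprox ρ m (γ t)) ≤
      ENNReal.ofReal (chainCost (lipApprox ρ n) (N n) (z n)) + ENNReal.ofReal (m * η * L) := by
    calc ∫⁻ t in Ico 0 ℓ ∩ Icc 0 L, ENNReal.ofReal (lipApprox ρ m (γ t))
        ≤ ∫⁻ t in Ico 0 ℓ ∩ Icc 0 L,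
          (ENNReal.ofReal (lipApprox ρ n (c t)) + ENNReal.ofReal (m * η)) := by
          refine setLIntegral_mono' (measurableSet_Ico.inter measurableSet_Icc) fun t ht => ?_
          rw [← ENNReal.ofReal_add (lipApprox_nonneg _ _ _) (by positivity)]
          refine ENNReal.ofReal_le_ofReal ?_
          have h4 := (lipschitzWith_lipApprox ρ m).dist_le_mul (γ t) (c t)
          rw [Real.dist_eq, dist_comm] at h4
          have h5 := (h1 t ht.2).le
          have h6 : (m : ℝ) * dist (c t) (γ t) ≤ m * η := by gcongr
          have h7 := lipApprox_mono ρ (c t) h3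
          have h8 := (le_abs_self _).trans h4
          simp only [NNReal.coe_natCast] at h8 h7
          linarith
      _ ≤ (∫⁻ t in Ico 0 ℓ ∩ Icc 0 L, ENNReal.ofReal (lipApprox ρ n (c t))) +
          ∫⁻ _ in Ico 0 ℓ ∩ Icc 0 L, ENNReal.ofReal (m * η) := by
          rw [lintegral_add_right _ measurable_const]
      _ ≤ _ := by
          refine add_le_add ((lintegral_mono_set inter_subset_left).trans
            (lintegral_chainCurve_le (lipApprox_nonneg ρ n) _ _)) ?_
          refine (lintegral_mono_set inter_subset_right).trans ?_
          rw [setLIntegral_const, Real.volume_Icc, sub_zero, ← ENNReal.ofReal_mul (by positivity)]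
  have hB : ∫⁻ t in Icc ℓ L, ENNReal.ofReal (lipApprox ρ m (γ t)) ≤ ENNReal.ofReal (ε / 2) := by
    calc ∫⁻ t in Icc ℓ L, ENNReal.ofReal (lipApprox ρ m (γ t))
        ≤ ∫⁻ _ in Icc ℓ L, ENNReal.ofReal m :=
          lintegral_mono fun t => ENNReal.ofReal_le_ofReal (lipApprox_le_natCast ρ m _)
      _ ≤ _ := by
          rw [setLIntegral_const, Real.volume_Icc, ← ENNReal.ofReal_mul (by positivity)]
          exact ENNReal.ofReal_le_ofReal h2.le
  refine (lintegral_mono_set hsub).trans ((lintegral_union_le _ _ _).trans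
    ((add_le_add hA hB).trans ?_))
  have h0 := chainCost_nonneg (lipApprox_nonneg ρ n) (N n) (z n)
  rw [← ENNReal.ofReal_add h0 (by positivity), ← ENNReal.ofReal_add (by positivity) (by positivity)]
  exact ENNReal.ofReal_le_ofReal (by linarith)

/-- Chains of bounded cost with finer and finer steps subconverge to a curve, and the cost is
lower semicontinuous. -/
theorem IsCoerciveOn.exists_curve {ρ : X → ℝ≥0∞} {Y : Set X} (hρY : IsCoerciveOn ρ Y)
    (hY : IsComplete Y) (hρ : LowerSemicontinuous ρ) {M : X → ℝ} (hM : LowerSemicontinuous M)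
    (hM0 : ∀ x, 0 ≤ M x) {K : Set X} (hK : IsCompact K) {d : ℝ} (hd : 0 < d) {𝒰 : Ultrafilter ℕ}
    (h𝒰 : (𝒰 : Filter ℕ) ≤ atTop) {δ : ℕ → ℝ} (hδ0 : ∀ n, 0 ≤ δ n)
    (hδ : Tendsto δ atTop (𝓝 0)) {N : ℕ → ℕ} {z : ℕ → ℕ → X}
    (hz : ∀ n, IsChainIn Y (δ n) (N n) (z n)) {A : ℕ → ℝ} {a : ℝ} (hA : Tendsto A 𝒰 (𝓝 a))
    (hcost : ∀ n, M (z n 0) + chainCost (lipApprox ρ n) (N n) (z n) ≤ A n)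
    (hend : ∀ n, z n 0 ∈ K ∨ z n (N n) ∈ K ∨ d ≤ dist (z n 0) (z n (N n))) :
    ∃ (γ : ℝ → X) (L : ℝ), 0 ≤ L ∧ LipschitzWith 1 γ ∧ (∀ t, γ t ∈ Y) ∧
      Tendsto (fun n => z n 0) 𝒰 (𝓝 (γ 0)) ∧ Tendsto (fun n => z n (N n)) 𝒰 (𝓝 (γ L)) ∧
      ENNReal.ofReal (M (γ 0)) + ∫⁻ t in Icc 0 L, ρ (γ t) ≤ ENNReal.ofReal a := by
  have hδ𝒰 : Tendsto δ 𝒰 (𝓝 0) := hδ.mono_left h𝒰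
  have hbound : ∀ᶠ n in (𝒰 : Filter ℕ), chainCost (lipApprox ρ n) (N n) (z n) ≤ a + 1 := by
    filter_upwards [hA.eventually_le_const (lt_add_one a)] with n hn
    linarith [hcost n, hM0 (z n 0)]
  -- Every value of the chain curve is a vertex of the chain, hence close to a compact set. One
  -- ultrafilter serves all times at once, so no diagonal subsequence is needed.
  have hlim : ∀ t, ∃ x ∈ Y, Tendsto (fun n => chainCurve (N n) (z n) t) 𝒰 (𝓝 x) := fun t => by
    refine exists_tendsto_ultrafilter_of_near_compact 𝒰 hY (fun n => (hz n).chainCurve_mem t)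
      fun s hs => ?_
    obtain ⟨C, hC, hev⟩ := hρY.exists_compact_near hK hd h𝒰 hδ𝒰 hz hbound hend hs
    refine ⟨C, hC, ?_⟩
    filter_upwards [hev] with n hn
    exact hn _ (chainIndex_le _ _ _)
  choose γ hγY hγ using hlim
  have hlip : LipschitzWith 1 γ := by
    refine LipschitzWith.of_dist_le_mul fun s t => ?_
    rw [NNReal.coe_one, one_mul, Real.dist_eq]
    have h1 : Tendsto (fun n => |s - t| + δ n) 𝒰 (𝓝 (|s - t| + 0)) := hδ𝒰.const_add _
    rw [add_zero] at h1
    exact le_of_tendsto_of_tendsto' ((hγ s).dist (hγ t)) h1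
      fun n => (hz n).dist_chainCurve_le (hδ0 n) s t
  obtain ⟨c, hc, hlow⟩ := hρY.lower
  -- The positive lower bound of the weight turns the bound on the cost into a bound on the length.
  have hlen : ∀ᶠ n in (𝒰 : Filter ℕ), chainLength (z n) (N n) ∈ Icc 0 ((a + 1) / c) := by
    filter_upwards [hbound, h𝒰 hlow] with n h1 h2
    refine ⟨chainLength_nonneg _ _, ?_⟩
    rw [le_div_iff₀ hc, mul_comm]
    exact (mul_chainLength_le_chainCost (hz n) h2).trans h1
  obtain ⟨L, hL, hLlim⟩ := exists_tendsto_ultrafilter_of_eventually_mem_Icc 𝒰 hlen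
  have hstart : Tendsto (fun n => z n 0) 𝒰 (𝓝 (γ 0)) := by
    simpa only [chainCurve_zero] using hγ 0
  have hfinish : Tendsto (fun n => z n (N n)) 𝒰 (𝓝 (γ L)) := by
    refine (hγ L).congr_dist ?_
    have h1 : Tendsto (fun n => |L - chainLength (z n) (N n)| + δ n) 𝒰 (𝓝 (|L - L| + 0)) :=
      (tendsto_const_nhds.sub hLlim).abs.add hδ𝒰
    rw [sub_self, abs_zero, add_zero] at h1
    refine squeeze_zero (fun _ => dist_nonneg) (fun n => ?_) h1
    have := (hz n).dist_chainCurve_le (hδ0 n) L (chainLength (z n) (N n))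
    rwa [chainCurve_chainLength] at this
  refine ⟨γ, L, hL.1, hlip, hγY, hstart, hfinish, ?_⟩
  have hunif : ∀ η > 0, ∀ᶠ n in (𝒰 : Filter ℕ), ∀ t ∈ Icc 0 L,
      dist (chainCurve (N n) (z n) t) (γ t) < η := fun η hη =>
    eventually_forall_dist_lt_of_tendsto hδ𝒰 (fun n => (hz n).dist_chainCurve_le (hδ0 n)) hlip hγ
      L hη
  have hm : ∀ m, ENNReal.ofReal (M (γ 0)) +
      ∫⁻ t in Icc 0 L, ENNReal.ofReal (lipApprox ρ m (γ t)) ≤ ENNReal.ofReal a := by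
    intro m
    refine ENNReal.le_of_forall_pos_le_add fun ε hε _ => ?_
    have hε' : (0 : ℝ) < ε := hε
    have h1 := eventually_lintegral_lipApprox_le (ρ := ρ) h𝒰 hL.1 hLlim hunif m
      (show (0 : ℝ) < ε / 3 by linarith)
    have h2 : ∀ᶠ n in (𝒰 : Filter ℕ), M (γ 0) - ε / 3 < M (z n 0) :=
      hstart.eventually (hM (γ 0) _ (by linarith))
    have h3 : ∀ᶠ n in (𝒰 : Filter ℕ), A n < a + ε / 3 := hA.eventually_lt_const (by linarith)
    obtain ⟨n, h1, h2, h3⟩ := (h1.and (h2.and h3)).exists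
    have h4 := hcost n
    have h5 := chainCost_nonneg (lipApprox_nonneg ρ n) (N n) (z n)
    calc _ ≤ ENNReal.ofReal (M (γ 0)) +
          ENNReal.ofReal (chainCost (lipApprox ρ n) (N n) (z n) + ε / 3) := by gcongr
      _ = ENNReal.ofReal (M (γ 0) + (chainCost (lipApprox ρ n) (N n) (z n) + ε / 3)) :=
          (ENNReal.ofReal_add (hM0 _) (by positivity)).symm
      _ ≤ ENNReal.ofReal (a + ε) := ENNReal.ofReal_le_ofReal (by linarith)
      _ ≤ ENNReal.ofReal a + ENNReal.ofReal ε := ENNReal.ofReal_add_le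
      _ = _ := by rw [ENNReal.ofReal_coe_nnreal]
  have hsup : ∫⁻ t in Icc 0 L, ρ (γ t) =
      ⨆ m, ∫⁻ t in Icc 0 L, ENNReal.ofReal (lipApprox ρ m (γ t)) := by
    rw [← lintegral_iSup]
    · simp only [ofReal_lipApprox, iSup_infConv hρ]
    · intro m
      have : Continuous fun t => lipApprox ρ m (γ t) :=
        (lipschitzWith_lipApprox ρ m).continuous.comp hlip.continuous
      exact this.measurable.ennreal_ofReal
    · intro m n hmn t
      exact ENNReal.ofReal_le_ofReal (lipApprox_mono ρ _ hmn)
  rw [hsup, ENNReal.add_iSup]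
  exact iSup_le hm

end Coercive

/-! ### Exhaustion of a locally complete space by complete sets -/

section Exhaustion

variable {X : Type*} [MetricSpace X]

/-- A nonnegative function with complete sublevel sets, uniformly locally Lipschitz on each of
them. -/
structure IsCompleteExhaustion (h : X → ℝ) : Prop where
  nonneg : ∀ x, 0 ≤ h x
  complete : ∀ k : ℕ, IsComplete {x | h x ≤ k}
  lip : ∀ k : ℕ, ∃ C ≥ (1 : ℝ), ∀ x y, h x ≤ k → dist x y ≤ 1 / C → |h x - h y| ≤ C * dist x y

theorem IsCompleteExhaustion.continuous {h : X → ℝ} (hh : IsCompleteExhaustion h) :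
    Continuous h := by
  rw [continuous_iff_continuousAt]
  intro x
  obtain ⟨k, hk⟩ := exists_nat_ge (h x)
  obtain ⟨C, hC, hlip⟩ := hh.lip k
  rw [ContinuousAt, tendsto_iff_dist_tendsto_zero]
  have hlim : Tendsto (fun y => C * dist x y) (𝓝 x) (𝓝 0) := by
    have : Continuous fun y => C * dist x y := by fun_prop
    simpa using this.tendsto x
  refine squeeze_zero' (Eventually.of_forall fun _ => dist_nonneg) ?_ hlim
  filter_upwards [Metric.closedBall_mem_nhds x (show 0 < 1 / C by positivity)] with y hy
  rw [dist_comm (h y), Real.dist_eq]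
  exact hlip x y hk (by rwa [dist_comm])

theorem IsCompleteExhaustion.isClosed {h : X → ℝ} (hh : IsCompleteExhaustion h) (k : ℕ) :
    IsClosed {x | h x ≤ k} :=
  isClosed_le hh.continuous continuous_const

theorem IsCompleteExhaustion.exists_radius {h : X → ℝ} (hh : IsCompleteExhaustion h) (k : ℕ) :
    ∃ r > 0, ∀ x y, h x ≤ k → dist x y < r → h y < k + 1 := by
  obtain ⟨C, hC, hlip⟩ := hh.lip k
  refine ⟨1 / C, by positivity, fun x y hx hxy => ?_⟩
  have h1 := hlip x y hx hxy.le
  rw [lt_div_iff₀ (by positivity), mul_comm] at hxy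
  linarith [neg_abs_le (h x - h y)]

theorem IsComplete.of_isClosed_subset {s t : Set X} (ht : IsComplete t) (hs : IsClosed s)
    (hst : s ⊆ t) : IsComplete s := by
  intro F hF hFs
  obtain ⟨x, -, hx⟩ := ht F hF (hFs.trans (principal_mono.2 hst))
  have := hF.1
  exact ⟨x, hs.mem_of_frequently_of_tendsto (f := id)
    (Eventually.frequently (le_principal_iff.1 hFs)) hx, hx⟩

/-- The supremum of the radii at most `1` of complete closed balls centred at `x`. -/
noncomputable def completenessRadius (x : X) : ℝ :=
  sSup {s | s ≤ 1 ∧ IsComplete (Metric.closedBall x s)}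

theorem bddAbove_completenessRadius (x : X) :
    BddAbove {s | s ≤ 1 ∧ IsComplete (Metric.closedBall x s)} :=
  ⟨1, fun _ hs => hs.1⟩

theorem nonempty_completenessRadius (x : X) :
    {s | s ≤ 1 ∧ IsComplete (Metric.closedBall x s)}.Nonempty :=
  -- A negative radius gives the empty ball, so the set of radii is non-empty at every point,
  -- whether or not the space is locally complete.
  ⟨-1, by norm_num, by
    rw [Metric.closedBall_eq_empty.2 (by norm_num)]
    exact isCompact_empty.isComplete⟩

theorem completenessRadius_pos (hX : IsLocallyComplete X) (x : X) : 0 < completenessRadius x := by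
  obtain ⟨U, hU, hUc⟩ := hX x
  obtain ⟨s, hs, hsU⟩ := Metric.nhds_basis_closedBall.mem_iff.1 hU
  refine (lt_min hs one_pos).trans_le (le_csSup (bddAbove_completenessRadius x)
    ⟨min_le_right _ _, hUc.of_isClosed_subset Metric.isClosed_closedBall
      ((Metric.closedBall_subset_closedBall (min_le_left _ _)).trans hsU)⟩)

theorem completenessRadius_le_add (x y : X) :
    completenessRadius x ≤ completenessRadius y + dist x y := by
  refine csSup_le (nonempty_completenessRadius x) fun s hs => ?_
  rw [← sub_le_iff_le_add]
  refine le_csSup (bddAbove_completenessRadius y) ⟨by linarith [hs.1, dist_nonneg (x := x) (y := y)],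
    hs.2.of_isClosed_subset Metric.isClosed_closedBall
      (Metric.closedBall_subset_closedBall' ?_)⟩
  rw [dist_comm y x]
  linarith

theorem isComplete_closedBall_of_lt_completenessRadius {x : X} {s : ℝ}
    (hs : s < completenessRadius x) : IsComplete (Metric.closedBall x s) := by
  obtain ⟨t, ht, hst⟩ := exists_lt_of_lt_csSup (nonempty_completenessRadius x) hs
  exact ht.2.of_isClosed_subset Metric.isClosed_closedBall
    (Metric.closedBall_subset_closedBall hst.le)

theorem abs_completenessRadius_sub_le (x y : X) :
    |completenessRadius x - completenessRadius y| ≤ dist x y := by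
  rw [abs_sub_le_iff]
  have h1 := completenessRadius_le_add x y
  have h2 := completenessRadius_le_add y x
  rw [dist_comm y x] at h2
  constructor <;> linarith

/-- The reciprocal provides completeness: on the sublevel set of `k > 0` every closed ball of radius
`1 / (2 * k)` is complete, and a Cauchy filter contains a set inside one of them. The distance term
makes the sublevel sets bounded, so that they have finite measure later on. -/
theorem isCompleteExhaustion_dist_add_inv (hX : IsLocallyComplete X) (x₀ : X) :
    IsCompleteExhaustion fun x => dist x x₀ + (completenessRadius x)⁻¹ := by
  have hpos := completenessRadius_pos hX
  have hinv : ∀ x : X, 0 < (completenessRadius x)⁻¹ := fun x => inv_pos.2 (hpos x)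
  have hlow : ∀ (k : ℕ) x, dist x x₀ + (completenessRadius x)⁻¹ ≤ k →
      0 < (k : ℝ) ∧ (k : ℝ)⁻¹ ≤ completenessRadius x := by
    intro k x hx
    have hk : (completenessRadius x)⁻¹ ≤ k := by linarith [dist_nonneg (x := x) (y := x₀)]
    exact ⟨(hinv x).trans_le hk, inv_le_of_inv_le₀ (hpos x) hk⟩
  have hcont : Continuous fun x : X => dist x x₀ + (completenessRadius x)⁻¹ := by
    have : Continuous (completenessRadius (X := X)) :=
      (LipschitzWith.of_le_add completenessRadius_le_add).continuous
    exact (continuous_id.dist continuous_const).add (this.inv₀ fun x => (hpos x).ne')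
  refine ⟨fun x => add_nonneg dist_nonneg (hinv x).le, fun k => ?_, fun k => ?_⟩
  · intro F hF hFk
    rcases k.eq_zero_or_pos with rfl | hk
    · obtain ⟨x, hx⟩ := hF.1.nonempty_of_mem (le_principal_iff.1 hFk)
      exact absurd (hlow 0 x hx).1 (by simp)
    have hk' : (0 : ℝ) < (k : ℝ)⁻¹ := by positivity
    obtain ⟨t, ht, htd⟩ := (Metric.cauchy_iff.1 hF).2 ((k : ℝ)⁻¹ / 2) (by linarith)
    have := hF.1
    obtain ⟨x, hxt, hx⟩ := Filter.nonempty_of_mem (inter_mem ht (le_principal_iff.1 hFk))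
    have hball : t ⊆ Metric.closedBall x ((k : ℝ)⁻¹ / 2) := fun y hy => (htd y hy x hxt).le
    obtain ⟨y, -, hy⟩ := isComplete_closedBall_of_lt_completenessRadius
      (show (k : ℝ)⁻¹ / 2 < completenessRadius x by linarith [(hlow k x hx).2]) F hF
      (le_principal_iff.2 (mem_of_superset ht hball))
    refine ⟨y, ?_, hy⟩
    exact (isClosed_le hcont continuous_const).mem_of_frequently_of_tendsto
      (f := id) (Eventually.frequently (le_principal_iff.1 hFk)) hy
  -- If the completeness radius is at least `1 / k` at `x` and `dist x y ≤ 1 / (2 * k)`, then it is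
  -- at least `1 / (2 * k)` at `y`, so the reciprocals differ by at most `2 * k ^ 2 * dist x y`. The
  -- summand `1` accounts for the distance to `x₀`.
  · refine ⟨1 + 2 * (k : ℝ) ^ 2, by nlinarith [sq_nonneg (k : ℝ)], fun x y hx hxy => ?_⟩
    obtain ⟨hk, hrx⟩ := hlow k x hx
    have h1 : (1 : ℝ) / (1 + 2 * (k : ℝ) ^ 2) ≤ (k : ℝ)⁻¹ / 2 := by
      rw [div_le_iff₀ (by positivity), inv_eq_one_div, div_div, div_mul_eq_mul_div, one_mul,
        le_div_iff₀ (by positivity)]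
      nlinarith [sq_nonneg ((k : ℝ) - 1), sq_nonneg (k : ℝ)]
    have hr := abs_completenessRadius_sub_le x y
    have hry : (k : ℝ)⁻¹ / 2 ≤ completenessRadius y := by
      linarith [(abs_sub_le_iff.1 hr).1]
    have h2 : |(completenessRadius x)⁻¹ - (completenessRadius y)⁻¹| ≤ 2 * (k : ℝ) ^ 2 * dist x y := by
      rw [inv_sub_inv (hpos x).ne' (hpos y).ne', abs_div, div_le_iff₀ (by positivity [hpos x, hpos y]),
        abs_sub_comm, abs_of_pos (mul_pos (hpos x) (hpos y))]
      have h3 : (k : ℝ)⁻¹ * ((k : ℝ)⁻¹ / 2) ≤ completenessRadius x * completenessRadius y := by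
        gcongr
        exact (hpos x).le
      have h4 : 2 * (k : ℝ) ^ 2 * ((k : ℝ)⁻¹ * ((k : ℝ)⁻¹ / 2)) = 1 := by field_simp
      calc |completenessRadius x - completenessRadius y| ≤ dist x y := hr
        _ = 2 * (k : ℝ) ^ 2 * dist x y * ((k : ℝ)⁻¹ * ((k : ℝ)⁻¹ / 2)) := by
          rw [mul_right_comm, h4, one_mul]
        _ ≤ _ := by gcongr
    have h5 : |dist x x₀ - dist y x₀| ≤ dist x y := abs_dist_sub_le _ _ _
    calc |dist x x₀ + (completenessRadius x)⁻¹ - (dist y x₀ + (completenessRadius y)⁻¹)|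
        = |(dist x x₀ - dist y x₀) + ((completenessRadius x)⁻¹ - (completenessRadius y)⁻¹)| := by
          congr 1; ring
      _ ≤ dist x y + 2 * (k : ℝ) ^ 2 * dist x y := (abs_add_le _ _).trans (add_le_add h5 h2)
      _ = _ := by ring

end Exhaustion

/-! ### Tightness and Lusin's theorem on complete sets -/

section Regularity

variable {X : Type*} [MetricSpace X] [MeasurableSpace X] [BorelSpace X]

/-- As a subspace `Y` is complete and separable, so the finite measure which `μ` induces on it is
tight. -/
theorem IsComplete.exists_isCompact_measure_diff_lt [TopologicalSpace.SeparableSpace X]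
    {Y : Set X} (hY : IsComplete Y) {μ : Measure X} (hμ : μ Y ≠ ⊤) {ε : ℝ≥0∞} (hε : ε ≠ 0) :
    ∃ K ⊆ Y, IsCompact K ∧ μ (Y \ K) < ε := by
  have : SecondCountableTopology X := UniformSpace.secondCountable_of_separable X
  have hYm : MeasurableSet Y := hY.isClosed.measurableSet
  have : CompleteSpace Y := completeSpace_coe_iff_isComplete.2 hY
  have hemb : MeasurableEmbedding ((↑) : Y → X) := MeasurableEmbedding.subtype_coe hYm
  have : IsFiniteMeasure (μ.comap ((↑) : Y → X)) := ⟨by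
    rw [hemb.comap_apply, image_univ, Subtype.range_coe]
    exact hμ.lt_top⟩
  obtain ⟨K, hK, hKε⟩ := exists_isCompact_closure_measure_compl_lt (μ.comap ((↑) : Y → X)) ε
    (pos_iff_ne_zero.2 hε)
  refine ⟨(↑) '' closure K, Subtype.coe_image_subset _ _, hK.image continuous_subtype_val, ?_⟩
  refine lt_of_le_of_lt ?_ hKε
  rw [hemb.comap_apply]
  refine measure_mono fun x hx => ⟨⟨x, hx.1⟩, fun hxK => hx.2 ⟨_, subset_closure hxK, rfl⟩, rfl⟩

/-- **Lusin's theorem** for a real function and a finite measure. -/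
theorem Measurable.exists_isClosed_continuousOn {u : X → ℝ} (hu : Measurable u) (ν : Measure X)
    [IsFiniteMeasure ν] {ε : ℝ≥0∞} (hε : ε ≠ 0) :
    ∃ C, IsClosed C ∧ ContinuousOn u C ∧ ν Cᶜ < ε := by
  obtain ⟨b, hbc, -, hb⟩ := TopologicalSpace.exists_countable_basis ℝ
  have : Countable b := hbc.to_subtype
  obtain ⟨ε', hε'pos, hε'⟩ := ENNReal.exists_pos_sum_of_countable hε b
  have hchoose : ∀ U : b, ∃ F G : Set X, IsClosed F ∧ IsOpen G ∧ F ⊆ u ⁻¹' U ∧ u ⁻¹' U ⊆ G ∧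
      ν (G \ F) ≤ ε' U := by
    intro U
    have hUm : MeasurableSet (u ⁻¹' (U : Set ℝ)) := hu (hb.isOpen U.2).measurableSet
    have hpos : (ε' U / 2 : ℝ≥0∞) ≠ 0 := by simp [(hε'pos U).ne']
    obtain ⟨F, hFU, hF, hFε⟩ := hUm.exists_isClosed_sdiff_lt (measure_ne_top ν _) hpos
    obtain ⟨G, hUG, hG, -, hGε⟩ := hUm.exists_isOpen_sdiff_lt (measure_ne_top ν _) hpos
    refine ⟨F, G, hF, hG, hFU, hUG, ?_⟩
    have hsub : G \ F ⊆ (G \ u ⁻¹' U) ∪ (u ⁻¹' U \ F) := fun x hx => by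
      by_cases hxU : x ∈ u ⁻¹' (U : Set ℝ)
      · exact Or.inr ⟨hxU, hx.2⟩
      · exact Or.inl ⟨hx.1, hxU⟩
    calc ν (G \ F) ≤ ν (G \ u ⁻¹' U) + ν (u ⁻¹' U \ F) :=
          (measure_mono hsub).trans (measure_union_le _ _)
      _ ≤ ε' U / 2 + ε' U / 2 := add_le_add hGε.le hFε.le
      _ = ε' U := ENNReal.add_halves _
  choose F G hF hG hFU hUG hν using hchoose
  refine ⟨⋂ U, (F U ∪ (G U)ᶜ), isClosed_iInter fun U => (hF U).union (hG U).isClosed_compl, ?_, ?_⟩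
  · intro x hx
    rw [ContinuousWithinAt, hb.nhds_hasBasis.tendsto_right_iff]
    rintro V ⟨hV, hxV⟩
    have hxG : x ∈ G ⟨V, hV⟩ := hUG ⟨V, hV⟩ hxV
    filter_upwards [self_mem_nhdsWithin, nhdsWithin_le_nhds ((hG ⟨V, hV⟩).mem_nhds hxG)]
      with y hy hyG
    rcases mem_iInter.1 hy ⟨V, hV⟩ with hyF | hyG'
    · exact hFU ⟨V, hV⟩ hyF
    · exact absurd hyG hyG'
  · refine lt_of_le_of_lt ?_ hε'
    rw [compl_iInter]
    refine (measure_iUnion_le _).trans (ENNReal.tsum_le_tsum fun U => ?_)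
    rw [compl_union, compl_compl, inter_comm]
    exact hν U

theorem IsComplete.exists_isCompact_continuousOn [TopologicalSpace.SeparableSpace X]
    {Y : Set X} (hY : IsComplete Y) {μ : Measure X} (hμ : μ Y ≠ ⊤) {u : X → ℝ} (hu : Measurable u)
    {ε : ℝ≥0∞} (hε : ε ≠ 0) :
    ∃ K ⊆ Y, IsCompact K ∧ ContinuousOn u K ∧ μ (Y \ K) < ε := by
  have hε2 : ε / 2 ≠ 0 := by simp [hε]
  obtain ⟨K, hKY, hK, hKε⟩ := hY.exists_isCompact_measure_diff_lt hμ hε2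
  have : IsFiniteMeasure (μ.restrict Y) := ⟨by
    rw [Measure.restrict_apply_univ]
    exact hμ.lt_top⟩
  obtain ⟨C, hC, hCu, hCε⟩ := hu.exists_isClosed_continuousOn (μ.restrict Y) hε2
  rw [Measure.restrict_apply hC.measurableSet.compl] at hCε
  refine ⟨K ∩ C, inter_subset_left.trans hKY, hK.inter_right hC, hCu.mono inter_subset_right, ?_⟩
  have hsub : Y \ (K ∩ C) ⊆ (Y \ K) ∪ (Cᶜ ∩ Y) := fun x hx => by
    by_cases hxK : x ∈ K
    · exact Or.inr ⟨fun hxC => hx.2 ⟨hxK, hxC⟩, hx.1⟩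
    · exact Or.inl ⟨hx.1, hxK⟩
  calc μ (Y \ (K ∩ C)) ≤ μ (Y \ K) + μ (Cᶜ ∩ Y) := (measure_mono hsub).trans (measure_union_le _ _)
    _ < ε / 2 + ε / 2 := ENNReal.add_lt_add hKε hCε
    _ = ε := ENNReal.add_halves _

end Regularity

/-! ### Coercive majorants at small cost -/

section Majorant

variable {X : Type*} [MetricSpace X] [MeasurableSpace X] [BorelSpace X]

/-- A supremum is taken instead of a sum because its `p`-th power is at most the sum of the `p`-th
powers, which makes the cost additive for every `p`. -/
theorem exists_lowerSemicontinuous_sup_indicator {ι : Type*} [Countable ι] {μ : Measure X} {p : ℝ}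
    (hp : 1 ≤ p) {ρ : X → ℝ≥0∞} (hρ : LowerSemicontinuous ρ) {O : ι → Set X}
    (hO : ∀ i, IsOpen (O i)) {b : ι → ℝ≥0∞} {ε : ℝ≥0∞} (hε : ∑' i, b i ^ p * μ (O i) ≤ ε) :
    ∃ ρ' : X → ℝ≥0∞, LowerSemicontinuous ρ' ∧ ρ ≤ ρ' ∧ (∀ i, ∀ x ∈ O i, b i ≤ ρ' x) ∧
      ∫⁻ x, ρ' x ^ p ∂μ ≤ (∫⁻ x, ρ x ^ p ∂μ) + ε := by
  have hp0 : 0 < p := one_pos.trans_le hp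
  refine ⟨fun x => ρ x ⊔ ⨆ i, (O i).indicator (fun _ => b i) x, ?_, fun x => le_sup_left, ?_, ?_⟩
  · exact hρ.sup (lowerSemicontinuous_iSup fun i => (hO i).lowerSemicontinuous_indicator zero_le)
  · intro i x hx
    refine le_sup_of_le_right (le_iSup_of_le i ?_)
    rw [indicator_of_mem hx]
  · have hpt : ∀ x, (ρ x ⊔ ⨆ i, (O i).indicator (fun _ => b i) x) ^ p ≤
        ρ x ^ p + ∑' i, (O i).indicator (fun _ => b i ^ p) x := by
      intro x
      rw [← ENNReal.le_rpow_inv_iff hp0]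
      refine sup_le ?_ (iSup_le fun i => ?_)
      · rw [ENNReal.le_rpow_inv_iff hp0]
        exact le_self_add
      · rw [ENNReal.le_rpow_inv_iff hp0]
        refine le_add_left (le_trans (le_of_eq ?_) (ENNReal.le_tsum i))
        by_cases hx : x ∈ O i
        · simp [hx]
        · simp [hx, hp0]
    refine (lintegral_mono hpt).trans ?_
    rw [lintegral_add_left (hρ.measurable.pow_const p), lintegral_tsum fun i =>
      (measurable_const.indicator (hO i).measurableSet).aemeasurable]
    simp_rw [lintegral_indicator_const (hO _).measurableSet]
    gcongr

theorem exists_coercive_majorant [TopologicalSpace.SeparableSpace X] {μ : Measure X} {p : ℝ}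
    (hp : 1 ≤ p) {h : X → ℝ} (hh : IsCompleteExhaustion h) (hμ : ∀ k : ℕ, μ {x | h x ≤ k} ≠ ⊤)
    {ρ : X → ℝ≥0∞} (hρ : LowerSemicontinuous ρ) {ε : ℝ≥0∞} (hε : ε ≠ 0) :
    ∃ ρ' : X → ℝ≥0∞, LowerSemicontinuous ρ' ∧ ρ ≤ ρ' ∧
      (∀ k : ℕ, IsCoerciveOn ρ' {x | h x ≤ k}) ∧
      ∫⁻ x, ρ' x ^ p ∂μ ≤ (∫⁻ x, ρ x ^ p ∂μ) + ε := by
  have hp0 : 0 < p := one_pos.trans_le hp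
  -- The index `(k, none)` stands for the lower bound on the `k`-th layer, and `(k, some j)` for the
  -- penalty `j` off a compact subset of it.
  obtain ⟨ε', hε'pos, hε'⟩ := ENNReal.exists_pos_sum_of_countable hε (ℕ × Option ℕ)
  have hopen : ∀ k : ℕ, IsOpen {x | h x < k + 1} := fun k =>
    isOpen_lt hh.continuous continuous_const
  have hsub : ∀ k : ℕ, {x | h x < k + 1} ⊆ {x | h x ≤ (k + 1 : ℕ)} := fun k x hx => by
    simpa using (show h x < k + 1 from hx).le
  have hlower : ∀ k : ℕ, ∃ c : ℝ≥0, 0 < c ∧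
      (c : ℝ≥0∞) ^ p * μ {x | h x < k + 1} ≤ ε' (k, none) := by
    intro k
    have hfin : μ {x | h x < k + 1} ≠ ⊤ := ne_top_of_le_ne_top (hμ (k + 1)) (measure_mono (hsub k))
    lift μ {x | h x < k + 1} to ℝ≥0 using hfin with m
    -- A constant at most `1` satisfies `c ^ p ≤ c`, since `p ≥ 1`.
    refine ⟨min 1 (ε' (k, none) / (m + 1)), lt_min one_pos (div_pos (hε'pos _) (by positivity)), ?_⟩
    set c : ℝ≥0 := min 1 (ε' (k, none) / (m + 1)) with hc
    have hc1 : (c : ℝ≥0∞) ^ p ≤ c := by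
      refine (ENNReal.rpow_le_rpow_of_exponent_ge ?_ hp).trans_eq (ENNReal.rpow_one _)
      exact_mod_cast min_le_left _ _
    refine (mul_le_mul_left hc1 _).trans ?_
    rw [← ENNReal.coe_mul, ENNReal.coe_le_coe]
    calc c * m ≤ ε' (k, none) / (m + 1) * (m + 1) := by
          gcongr
          · exact min_le_right _ _
          · exact le_self_add
      _ = ε' (k, none) := div_mul_cancel₀ _ (by positivity)
  choose c hc0 hc using hlower
  have hpen : ∀ k j : ℕ, ∃ K, IsCompact K ∧
      (j : ℝ≥0∞) ^ p * μ ({x | h x < k + 1} \ K) ≤ ε' (k, some j) := by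
    intro k j
    have hjtop : (j : ℝ≥0∞) ^ p ≠ ⊤ :=
      ENNReal.rpow_ne_top_of_nonneg hp0.le (ENNReal.natCast_ne_top j)
    have hδ : (ε' (k, some j) : ℝ≥0∞) / ((j : ℝ≥0∞) ^ p + 1) ≠ 0 := by
      refine ENNReal.div_ne_zero.2 ⟨by exact_mod_cast (hε'pos _).ne', ?_⟩
      exact ENNReal.add_ne_top.2 ⟨hjtop, ENNReal.one_ne_top⟩
    obtain ⟨K, -, hK, hKδ⟩ := (hh.complete (k + 1)).exists_isCompact_measure_diff_lt (hμ (k + 1)) hδ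
    refine ⟨K, hK, ?_⟩
    calc (j : ℝ≥0∞) ^ p * μ ({x | h x < k + 1} \ K)
        ≤ ((j : ℝ≥0∞) ^ p + 1) * (ε' (k, some j) / ((j : ℝ≥0∞) ^ p + 1)) := by
          gcongr
          · exact le_self_add
          · exact (measure_mono (sdiff_subset_sdiff_left (hsub k))).trans hKδ.le
      _ ≤ ε' (k, some j) := ENNReal.mul_div_le
  choose K hK hKε using hpen
  have hO : ∀ i : ℕ × Option ℕ, IsOpen (i.2.elim {x | h x < i.1 + 1}
      fun j => {x | h x < i.1 + 1} \ K i.1 j) := by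
    rintro ⟨k, _ | j⟩
    · exact hopen k
    · exact (hopen k).sdiff (hK k j).isClosed
  have hsum : ∑' i : ℕ × Option ℕ, (i.2.elim (c i.1 : ℝ≥0∞) fun j => (j : ℝ≥0∞)) ^ p *
      μ (i.2.elim {x | h x < i.1 + 1} fun j => {x | h x < i.1 + 1} \ K i.1 j) ≤ ε := by
    refine le_trans (ENNReal.tsum_le_tsum ?_) hε'.le
    rintro ⟨k, _ | j⟩
    · exact hc k
    · exact hKε k j
  obtain ⟨ρ', hρ', hle, hbig, hint⟩ := exists_lowerSemicontinuous_sup_indicator hp hρ hO hsum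
  refine ⟨ρ', hρ', hle, fun k => ?_, hint⟩
  -- The weight was raised on `{h < k + 1}`, which contains the `r`-neighbourhood of `{h ≤ k}`. This
  -- margin lets the inf-convolutions inherit the bounds on `{h ≤ k}`.
  obtain ⟨r, hr, hrk⟩ := hh.exists_radius k
  refine ⟨⟨c k, hc0 k, ?_⟩, fun j => ⟨K k j, hK k j, fun s hs => ?_⟩⟩
  · filter_upwards [eventually_le_natCast_mul (c k) hr] with n hn x hx
    refine le_lipApprox (le_infConv (r := r) (fun y hy => ?_) hn.1 hn.2)
    exact hbig (k, none) y (hrk x y hx hy)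
  · filter_upwards [eventually_le_natCast_mul (j : ℝ≥0) (lt_min hr hs)] with n hn x hx hxK
    have := le_lipApprox (ρ := ρ') (x := x) (le_infConv (fun y hy => ?_) hn.1 hn.2)
    · simpa using this
    · have h1 : y ∈ {x | h x < k + 1} \ K k j :=
        ⟨hrk x y hx (hy.trans_le (min_le_left _ _)), fun hyK =>
          absurd (hxK y hyK) (not_le.2 (hy.trans_le (min_le_right _ _)))⟩
      simpa using hbig (k, some j) y h1

end Majorant

/-! ### The potential of a weight and its approximation by chain costs -/

section Potential

variable {X : Type*} [MetricSpace X]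

/-- The function `u` vanishes on `E`, equals `1` on `F`, and has `ρ` as an upper gradient with
respect to `1`-Lipschitz parametrized curves. -/
structure IsCondenserPotential (ρ : X → ℝ≥0∞) (E F : Set X) (u : X → ℝ) : Prop where
  nonneg : ∀ x, 0 ≤ u x
  le_one : ∀ x, u x ≤ 1
  eq_zero : ∀ x ∈ E, u x = 0
  eq_one : ∀ x ∈ F, u x = 1
  le_add : ∀ (γ : ℝ → X) (L : ℝ), 0 ≤ L → LipschitzWith 1 γ →
    ENNReal.ofReal (u (γ L)) ≤ ENNReal.ofReal (u (γ 0)) + ∫⁻ t in Icc 0 L, ρ (γ t)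

theorem continuous_lipApprox (ρ : X → ℝ≥0∞) (n : ℕ) : Continuous (lipApprox ρ n) :=
  (lipschitzWith_lipApprox ρ n).continuous

/-- There is a measurable potential as soon as `ρ` is lower semicontinuous, coercive and
admissible. -/
theorem exists_measurable_potential [MeasurableSpace X] [BorelSpace X] {h : X → ℝ}
    (hh : IsCompleteExhaustion h) {ρ : X → ℝ≥0∞} (hρ : LowerSemicontinuous ρ)
    (hcoer : ∀ k : ℕ, IsCoerciveOn ρ {x | h x ≤ k}) {E F : Set X} (hE : IsClosed E)
    (hadm : ∀ (γ : ℝ → X) (L : ℝ), 0 ≤ L → LipschitzWith 1 γ → γ 0 ∈ E → γ L ∈ F →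
      1 ≤ ∫⁻ t in Icc 0 L, ρ (γ t)) :
    ∃ u : X → ℝ, Measurable u ∧ IsCondenserPotential ρ E F u := by
  classical
  set M : X → ℝ := Eᶜ.indicator 1 with hMdef
  have hM0 : ∀ x, 0 ≤ M x := fun x => indicator_nonneg (fun _ _ => zero_le_one) x
  have hMlsc : LowerSemicontinuous M := hE.isOpen_compl.lowerSemicontinuous_indicator zero_le_one
  have hδ : ∀ n : ℕ, (0 : ℝ) < 1 / ((n : ℝ) + 1) := fun n => by positivity
  set P : ℕ → ℕ → X → ℝ :=
    fun k n => chainInf {x | h x ≤ k} (1 / ((n : ℝ) + 1)) (lipApprox ρ n) M with hP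
  have hP0 : ∀ k n x, 0 ≤ P k n x := fun k n x => chainInf_nonneg (lipApprox_nonneg ρ n) hM0 x
  have hP1 : ∀ k n x, P k n x ≤ 1 := fun k n x => chainInf_le_one (lipApprox_nonneg ρ n) hM0 x
  have hPm : ∀ k n, Measurable (P k n) := fun k n => measurable_chainInf (hh.isClosed k) (hδ n)
    (continuous_lipApprox ρ n) (lipApprox_nonneg ρ n) hM0
  have hPanti : ∀ {k k'}, k ≤ k' → ∀ n x, P k' n x ≤ P k n x := fun {k k'} hkk' n x =>
    chainInf_anti_set (lipApprox_nonneg ρ n) hM0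
      (fun y (hy : h y ≤ k) => hy.trans (by exact_mod_cast hkk')) x
  have hbdd : ∀ k x, BddAbove (range fun n => P k n x) := fun k x =>
    ⟨1, by rintro _ ⟨n, rfl⟩; exact hP1 k n x⟩
  set S : ℕ → X → ℝ := fun k x => ⨆ n, P k n x with hS
  have hS0 : ∀ k x, 0 ≤ S k x := fun k x => Real.iSup_nonneg fun n => hP0 k n x
  have hS1 : ∀ k x, S k x ≤ 1 := fun k x => ciSup_le fun n => hP1 k n x
  have hSbdd : ∀ x, BddBelow (range fun k => S k x) := fun x =>
    ⟨0, by rintro _ ⟨k, rfl⟩; exact hS0 k x⟩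
  -- The supremum over scales comes first because the compactness argument takes place inside one
  -- complete layer. Both operations are countable, so measurability persists.
  refine ⟨fun x => ⨅ k, S k x, Measurable.iInf fun k => Measurable.iSup fun n => hPm k n,
    fun x => Real.iInf_nonneg fun k => hS0 k x, fun x => (ciInf_le (hSbdd x) 0).trans (hS1 0 x),
    fun x hx => ?_, fun x hx => ?_, fun γ₀ L hL hγ₀ => ?_⟩
  · obtain ⟨k, hk⟩ := exists_nat_ge (h x)
    refine le_antisymm ((ciInf_le (hSbdd x) k).trans (ciSup_le fun n => ?_))
      (Real.iInf_nonneg fun k => hS0 k x)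
    refine (chainInf_le_initial (lipApprox_nonneg ρ n) hM0 hk).trans (le_of_eq ?_)
    rw [hMdef, indicator_of_notMem (not_not.2 hx)]
  · refine le_antisymm ((ciInf_le (hSbdd x) 0).trans (hS1 0 x)) (le_ciInf fun k => ?_)
    -- Otherwise chains ending at `x` of cost less than some `b < 1` converge to a curve ending at
    -- `x`. Lower semicontinuity of `M` forces this curve to start in `E`, and its `ρ`-length, at
    -- most `b`, contradicts admissibility.
    by_contra! hlt
    obtain ⟨b, hSb, hb⟩ := exists_between hlt
    have hchain : ∀ n : ℕ, ∃ N z, IsChainIn {x | h x ≤ k} (1 / ((n : ℝ) + 1)) N z ∧ z N = x ∧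
        M (z 0) + chainCost (lipApprox ρ n) N z < b := fun n =>
      exists_chain_of_chainInf_lt ((le_ciSup (hbdd k x) n).trans_lt hSb) hb.le
    choose N z hz hzx hcost using hchain
    obtain ⟨γ, L, hL, hγ, -, -, hend, hle⟩ := (hcoer k).exists_curve (hh.complete k) hρ hMlsc hM0
      (isCompact_singleton (x := x)) one_pos (Nat.hyperfilter_le_atTop) (fun n => (hδ n).le)
      tendsto_one_div_add_atTop_nhds_zero_nat hz (tendsto_const_nhds (x := b))
      (fun n => (hcost n).le) (fun n => Or.inr (Or.inl (hzx n)))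
    simp only [hzx] at hend
    have hγL : γ L = x := tendsto_nhds_unique tendsto_const_nhds hend ▸ rfl
    have hb1 : ENNReal.ofReal b < 1 := by
      rw [← ENNReal.ofReal_one]
      exact (ENNReal.ofReal_lt_ofReal_iff one_pos).2 hb
    have hγ0 : γ 0 ∈ E := by
      by_contra hγE
      rw [hMdef, indicator_of_mem hγE, Pi.one_apply, ENNReal.ofReal_one] at hle
      exact absurd (le_self_add.trans hle) (not_le.2 hb1)
    have h1 := hadm γ L hL hγ hγ0 (hγL ▸ hx)
    exact absurd (h1.trans (le_add_self.trans hle)) (not_le.2 hb1)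
  -- Freezing the curve outside `[0, L]` gives it a compact image, contained in a single layer.
  · set γ : ℝ → X := fun t => γ₀ (projIcc 0 L hL t) with hγdef
    have hγeq : EqOn γ γ₀ (Icc 0 L) := fun t ht => by simp only [hγdef, projIcc_of_mem hL ht]
    have hγ : LipschitzWith 1 γ := by
      have := hγ₀.comp ((LipschitzWith.subtype_val (Icc 0 L)).comp (LipschitzWith.projIcc hL))
      rwa [one_mul, one_mul] at this
    rw [← hγeq (left_mem_Icc.2 hL), ← hγeq (right_mem_Icc.2 hL),
      ← setLIntegral_congr_fun measurableSet_Icc fun t ht => congrArg ρ (hγeq ht)]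
    obtain ⟨m, hm⟩ : ∃ m : ℕ, ∀ t, h (γ t) ≤ m := by
      obtain ⟨b, hb⟩ := (isCompact_Icc.image (f := fun t => h (γ₀ t)) (s := Icc (0 : ℝ) L)
        (hh.continuous.comp hγ₀.continuous)).bddAbove
      obtain ⟨m, hm⟩ := exists_nat_ge b
      exact ⟨m, fun t => (hb ⟨_, (projIcc 0 L hL t).2, rfl⟩).trans hm⟩
    rcases eq_or_ne (∫⁻ t in Icc 0 L, ρ (γ t)) ⊤ with htop | htop
    · rw [htop, add_top]
      exact le_top
    set I := ∫⁻ t in Icc 0 L, ρ (γ t) with hI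
    have hk : ∀ k ≥ m, S k (γ L) ≤ S k (γ 0) + I.toReal := by
      intro k hk
      refine ciSup_le fun n => ?_
      have h1 := chainInf_le_add_lintegral (hδ n) (continuous_lipApprox ρ n) (lipApprox_nonneg ρ n)
        hM0 hγ (Y := {x | h x ≤ k}) (fun t => (hm t).trans (by exact_mod_cast hk)) hL
      have h2 : ∫⁻ t in Icc 0 L, ENNReal.ofReal (lipApprox ρ n (γ t)) ≤ ENNReal.ofReal I.toReal := by
        rw [ENNReal.ofReal_toReal htop]
        exact lintegral_mono fun t => (ofReal_lipApprox ρ n _).trans_le (infConv_le ρ n _)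
      have h3 := h1.trans (add_le_add le_rfl h2)
      rw [← ENNReal.ofReal_add (hP0 k n _) ENNReal.toReal_nonneg,
        ENNReal.ofReal_le_ofReal_iff (add_nonneg (hP0 k n _) ENNReal.toReal_nonneg)] at h3
      exact h3.trans (add_le_add (le_ciSup (hbdd k _) n) le_rfl)
    have hmain : ⨅ k, S k (γ L) ≤ (⨅ k, S k (γ 0)) + I.toReal := by
      refine le_of_forall_pos_le_add fun ε hε => ?_
      obtain ⟨k, hkε⟩ := exists_lt_of_ciInf_lt (lt_add_of_pos_right (⨅ k, S k (γ 0)) hε)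
      have h1 := hk (max k m) (le_max_right _ _)
      have h2 : S (max k m) (γ 0) ≤ S k (γ 0) :=
        ciSup_mono (hbdd k _) fun n => hPanti (le_max_left _ _) n _
      have h3 := ciInf_le (hSbdd (γ L)) (max k m)
      linarith
    rw [← ENNReal.ofReal_toReal htop, ← ENNReal.ofReal_add (Real.iInf_nonneg fun k => hS0 k _)
      ENNReal.toReal_nonneg]
    exact ENNReal.ofReal_le_ofReal hmain

open Classical in
/-- The initial cost which is `0` on `E`, `u` on `K` and `1` elsewhere. -/
noncomputable def initialCost (E K : Set X) (u : X → ℝ) (x : X) : ℝ :=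
  if x ∈ E then 0 else if x ∈ K then u x else 1

/-- The sublevel sets are empty below level `0`, equal to `E ∪ (K ∩ {u ≤ y})` for `0 ≤ y < 1`, and
everything from level `1` on. Closedness of the middle ones needs continuity of `u` only along `K`.
-/
theorem lowerSemicontinuous_initialCost {E K : Set X} (hE : IsClosed E) (hK : IsClosed K)
    {u : X → ℝ} (hu : ContinuousOn u K) (hu0 : ∀ x, 0 ≤ u x)
    (hu1 : ∀ x, u x ≤ 1) : LowerSemicontinuous (initialCost E K u) := by
  rw [lowerSemicontinuous_iff_isClosed_preimage]
  intro y
  have hclosed : IsClosed (K ∩ u ⁻¹' Iic y) := hu.preimage_isClosed_of_isClosed hK isClosed_Iic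
  rcases lt_or_ge y 1 with hy1 | hy1
  · rcases lt_or_ge y 0 with hy0 | hy0
    · convert isClosed_empty using 1
      rw [eq_empty_iff_forall_notMem]
      intro x
      simp only [initialCost, mem_preimage, mem_Iic, not_le]
      split_ifs
      · exact hy0
      · exact hy0.trans_le (hu0 x)
      · linarith
    · convert hE.union hclosed using 1
      ext x
      simp only [initialCost, mem_preimage, mem_Iic, mem_union, mem_inter_iff]
      split_ifs with h1 h2
      · simp [h1, hy0]
      · simp [h1, h2]
      · simp [h1, h2, hy1]
  · convert isClosed_univ using 1
    rw [eq_univ_iff_forall]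
    intro x
    simp only [initialCost, mem_preimage, mem_Iic]
    split_ifs
    · linarith
    · exact (hu1 x).trans hy1
    · exact hy1

theorem initialCost_nonneg {X : Type*} {E K : Set X} {u : X → ℝ} (hu0 : ∀ x, 0 ≤ u x) (x : X) :
    0 ≤ initialCost E K u x := by
  rw [initialCost]
  split_ifs
  exacts [le_rfl, hu0 x, zero_le_one]

theorem IsCondenserPotential.le_initialCost {ρ : X → ℝ≥0∞} {E F K : Set X} {u : X → ℝ}
    (hu : IsCondenserPotential ρ E F u) (x : X) : u x ≤ initialCost E K u x := by
  rw [initialCost]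
  split_ifs with h1 h2
  exacts [(hu.eq_zero x h1).le, le_rfl, hu.le_one x]

theorem IsCondenserPotential.initialCost_of_mem {ρ : X → ℝ≥0∞} {E F K : Set X} {u : X → ℝ}
    (hu : IsCondenserPotential ρ E F u) {x : X} (hx : x ∈ K) : initialCost E K u x = u x := by
  rw [initialCost]
  split_ifs with h1
  · exact (hu.eq_zero x h1).symm
  · rfl

/-- The truncated chain costs converge to the potential from below, uniformly on `K ∪ F`. -/
theorem IsCondenserPotential.exists_le_chainInf {ρ : X → ℝ≥0∞} {E F K Y : Set X} {u : X → ℝ}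
    (hu : IsCondenserPotential ρ E F u) (hρ : LowerSemicontinuous ρ) (hY : IsComplete Y)
    (hρY : IsCoerciveOn ρ Y) (hE : IsClosed E) (hF : IsClosed F) {d : ℝ} (hd : 0 < d)
    (hEF : ∀ a ∈ E, ∀ b ∈ F, d ≤ dist a b) (hK : IsCompact K) (huK : ContinuousOn u K)
    {κ : ℝ} (hκ : 0 < κ) :
    ∃ n : ℕ, ∀ x ∈ K ∪ F,
      u x - κ ≤ chainInf Y (1 / ((n : ℝ) + 1)) (lipApprox ρ n) (initialCost E K u) x := by
  by_contra! hbad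
  choose x hx hlt using hbad
  have hM0 := initialCost_nonneg (E := E) (K := K) hu.nonneg
  have hMlsc := lowerSemicontinuous_initialCost hE hK.isClosed huK hu.nonneg hu.le_one
  have hchain := fun n : ℕ => exists_chain_of_chainInf_lt (hlt n) (by linarith [hu.le_one (x n)])
  choose N z hz hzx hcost using hchain
  obtain ⟨a, -, ha⟩ := exists_tendsto_ultrafilter_of_eventually_mem_Icc (hyperfilter ℕ)
    (Eventually.of_forall fun n => ⟨hu.nonneg (x n), hu.le_one (x n)⟩)
  -- The compactness of chains requires an end in the compact set or distant ends. A chain from `E`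
  -- to `F` has distant ends; one starting outside `E ∪ K` has initial cost `1` and is too
  -- expensive.
  have hend : ∀ n, z n 0 ∈ K ∨ z n (N n) ∈ K ∨ d ≤ dist (z n 0) (z n (N n)) := by
    intro n
    rw [hzx n]
    rcases hx n with hxK | hxF
    · exact Or.inr (Or.inl hxK)
    · by_cases hzE : z n 0 ∈ E
      · exact Or.inr (Or.inr (hEF _ hzE _ hxF))
      by_cases hzK : z n 0 ∈ K
      · exact Or.inl hzK
      have h1 := hcost n
      rw [initialCost, if_neg hzE, if_neg hzK] at h1
      linarith [chainCost_nonneg (lipApprox_nonneg ρ n) (N n) (z n), hu.le_one (x n)]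
  obtain ⟨γ, L, hL, hγ, -, -, hlim, hle⟩ := hρY.exists_curve hY hρ hMlsc hM0 hK hd
    Nat.hyperfilter_le_atTop (fun n => by positivity) tendsto_one_div_add_atTop_nhds_zero_nat hz
    (ha.sub_const κ) (fun n => (hcost n).le) hend
  simp only [hzx] at hlim
  -- The ultrafilter decides whether the endpoints lie in `K`, where `u` is continuous, or in `F`,
  -- where `u` is constantly `1`.
  have hua : u (γ L) = a := by
    rcases Ultrafilter.eventually_or.1 (Eventually.of_forall hx) with hev | hev
    · have hγK : γ L ∈ K := hK.isClosed.mem_of_tendsto hlim hev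
      exact tendsto_nhds_unique ((huK _ hγK).tendsto.comp
        (tendsto_nhdsWithin_iff.2 ⟨hlim, hev⟩)) ha
    · have hγF : γ L ∈ F := hF.mem_of_tendsto hlim hev
      rw [hu.eq_one _ hγF]
      refine tendsto_nhds_unique (tendsto_const_nhds.congr' ?_) ha
      filter_upwards [hev] with n hn
      exact (hu.eq_one _ hn).symm
  have hpos : 0 ≤ a - κ := ge_of_tendsto' (ha.sub_const κ) fun n =>
    (add_nonneg (hM0 _) (chainCost_nonneg (lipApprox_nonneg ρ n) (N n) (z n))).trans (hcost n).le
  -- The upper gradient inequality along the limit curve bounds `u (γ L) = a` by the limiting cost,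
  -- which is at most `a - κ`.
  have h1 := (hu.le_add γ L hL hγ).trans ((add_le_add
    (ENNReal.ofReal_le_ofReal (hu.le_initialCost (K := K) (γ 0))) le_rfl).trans hle)
  rw [hua, ENNReal.ofReal_le_ofReal_iff hpos] at h1
  linarith

/-- Local approximation of a potential by a locally Lipschitz function with a Lipschitz upper
gradient below `ρ`. -/
theorem IsCondenserPotential.exists_approx [MeasurableSpace X] [BorelSpace X] {ρ : X → ℝ≥0∞}
    {E F K Y : Set X} {u : X → ℝ}
    (hu : IsCondenserPotential ρ E F u) (hρ : LowerSemicontinuous ρ) (hY : IsComplete Y)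
    (hρY : IsCoerciveOn ρ Y) (hE : IsClosed E) (hF : IsClosed F) {d : ℝ} (hd : 0 < d)
    (hEF : ∀ a ∈ E, ∀ b ∈ F, d ≤ dist a b) (hK : IsCompact K) (hKY : K ⊆ Y)
    (huK : ContinuousOn u K) {κ : ℝ} (hκ : 0 < κ) :
    ∃ (f : X → ℝ) (n : ℕ) (δ : ℝ), Measurable f ∧ (∀ x, 0 ≤ f x) ∧ (∀ x, f x ≤ 1) ∧
      (∀ x ∈ E ∩ Y, f x = 0) ∧ (∀ x ∈ F, 1 - κ ≤ f x) ∧ (∀ x ∈ K, |f x - u x| ≤ κ) ∧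
      0 < δ ∧ ∀ x ∈ Y, ∀ y ∈ Y, dist x y ≤ δ →
        |f x - f y| ≤ max (lipApprox ρ n x) (lipApprox ρ n y) * dist x y := by
  obtain ⟨n, hn⟩ := hu.exists_le_chainInf hρ hY hρY hE hF hd hEF hK huK hκ
  have hM0 := initialCost_nonneg (E := E) (K := K) hu.nonneg
  have hg := lipApprox_nonneg ρ n
  have hδ : (0 : ℝ) < 1 / ((n : ℝ) + 1) := by positivity
  refine ⟨_, n, _, measurable_chainInf hY.isClosed hδ (continuous_lipApprox ρ n) hg hM0,
    chainInf_nonneg hg hM0, chainInf_le_one hg hM0, fun x hx => ?_, fun x hx => ?_, fun x hx => ?_,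
    hδ, fun x hx y hy hxy => abs_chainInf_sub_le hg hM0 hx hy hxy⟩
  · refine le_antisymm ((chainInf_le_initial hg hM0 hx.2).trans (le_of_eq ?_))
      (chainInf_nonneg hg hM0 x)
    rw [initialCost, if_pos hx.1]
  · have h1 := hn x (Or.inr hx)
    rwa [hu.eq_one x hx] at h1
  · have h1 := chainInf_le_initial (δ := 1 / ((n : ℝ) + 1)) hg hM0 (hKY hx)
    rw [hu.initialCost_of_mem hx] at h1
    rw [abs_sub_le_iff]
    constructor
    · linarith
    · linarith [hn x (Or.inl hx)]

end Potential

/-! ### Calculus of asymptotic Lipschitz constants -/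

section PointwiseLipschitz

variable {X : Type*} [MetricSpace X]

/-- The asymptotic Lipschitz constant of `v` at `x` is at most `c`. -/
def HasLipAt (v : X → ℝ) (x : X) (c : ℝ) : Prop :=
  ∀ ε > 0, ∀ᶠ q : X × X in 𝓝 x ×ˢ 𝓝 x, |v q.1 - v q.2| ≤ (c + ε) * dist q.1 q.2

variable {v w : X → ℝ} {x : X} {c c' : ℝ}

theorem HasLipAt.mono (hv : HasLipAt v x c) (hc : c ≤ c') : HasLipAt v x c' := by
  intro ε hε
  filter_upwards [hv ε hε] with q hq
  exact hq.trans (by gcongr)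

theorem HasLipAt.congr (hv : HasLipAt v x c) (h : v =ᶠ[𝓝 x] w) : HasLipAt w x c := by
  intro ε hε
  filter_upwards [hv ε hε, h.prod_inl (𝓝 x), h.prod_inr (𝓝 x)] with q hq h1 h2
  rwa [← h1, ← h2]

theorem HasLipAt.const (a : ℝ) (x : X) : HasLipAt (fun _ => a) x 0 := by
  intro ε hε
  refine Eventually.of_forall fun q => ?_
  rw [sub_self, abs_zero, zero_add]
  positivity

theorem HasLipAt.eventually_abs_sub_le (hv : HasLipAt v x c) {ε : ℝ} (hε : 0 < ε) :
    ∀ᶠ y in 𝓝 x, |v y - v x| ≤ (c + ε) * dist y x :=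
  (tendsto_id.prodMk tendsto_const_nhds : Tendsto (fun y => (y, x)) (𝓝 x) (𝓝 x ×ˢ 𝓝 x)).eventually
    (hv ε hε)

theorem HasLipAt.continuousAt (hv : HasLipAt v x c) : ContinuousAt v x := by
  rw [ContinuousAt, tendsto_iff_dist_tendsto_zero]
  have hlim : Tendsto (fun y => (c + 1) * dist y x) (𝓝 x) (𝓝 0) := by
    have : Continuous fun y => (c + 1) * dist y x := by fun_prop
    simpa using this.tendsto x
  refine squeeze_zero' (Eventually.of_forall fun _ => dist_nonneg) ?_ hlim
  exact hv.eventually_abs_sub_le one_pos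

theorem HasLipAt.add (hv : HasLipAt v x c) (hw : HasLipAt w x c') :
    HasLipAt (fun y => v y + w y) x (c + c') := by
  intro ε hε
  filter_upwards [hv (ε / 2) (by linarith), hw (ε / 2) (by linarith)] with q h1 h2
  rw [add_sub_add_comm]
  refine (abs_add_le _ _).trans ((add_le_add h1 h2).trans (le_of_eq ?_))
  ring

theorem HasLipAt.sum {ι : Type*} (s : Finset ι) {v : ι → X → ℝ} {c : ι → ℝ}
    (h : ∀ i ∈ s, HasLipAt (v i) x (c i)) :
    HasLipAt (fun y => ∑ i ∈ s, v i y) x (∑ i ∈ s, c i) := by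
  classical
  induction s using Finset.induction_on with
  | empty => simpa using HasLipAt.const 0 x
  | insert i s hi ih =>
    simp only [Finset.sum_insert hi]
    exact (h i (Finset.mem_insert_self i s)).add
      (ih fun j hj => h j (Finset.mem_insert_of_mem hj))

theorem HasLipAt.mul (hv : HasLipAt v x c) (hw : HasLipAt w x c') :
    HasLipAt (fun y => v y * w y) x (|v x| * c' + |w x| * c) := by
  intro ε hε
  have hη : ∀ᶠ η in 𝓝[>] (0 : ℝ), (|v x| + η) * (c' + η) + (|w x| + η) * (c + η) <
      |v x| * c' + |w x| * c + ε := by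
    have hcont : Continuous fun η : ℝ => (|v x| + η) * (c' + η) + (|w x| + η) * (c + η) := by
      fun_prop
    refine nhdsWithin_le_nhds ((hcont.tendsto 0).eventually_lt_const ?_)
    simp only [add_zero]
    linarith
  obtain ⟨η, hη, hη0⟩ := (hη.and self_mem_nhdsWithin).exists
  replace hη0 : 0 < η := hη0
  have h1 : ∀ᶠ y in 𝓝 x, |v y| < |v x| + η :=
    hv.continuousAt.abs.eventually_lt_const (by linarith)
  have h2 : ∀ᶠ y in 𝓝 x, |w y| < |w x| + η :=
    hw.continuousAt.abs.eventually_lt_const (by linarith)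
  filter_upwards [hv η hη0, hw η hη0, h1.prod_inl (𝓝 x), h2.prod_inr (𝓝 x)] with q hvq hwq h1 h2
  have hsplit : v q.1 * w q.1 - v q.2 * w q.2 =
      v q.1 * (w q.1 - w q.2) + w q.2 * (v q.1 - v q.2) := by ring
  rw [hsplit]
  calc |v q.1 * (w q.1 - w q.2) + w q.2 * (v q.1 - v q.2)|
      ≤ |v q.1| * |w q.1 - w q.2| + |w q.2| * |v q.1 - v q.2| := by
        rw [← abs_mul, ← abs_mul]
        exact abs_add_le _ _
    _ ≤ (|v x| + η) * ((c' + η) * dist q.1 q.2) + (|w x| + η) * ((c + η) * dist q.1 q.2) := by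
        gcongr
    _ = ((|v x| + η) * (c' + η) + (|w x| + η) * (c + η)) * dist q.1 q.2 := by ring
    _ ≤ _ := by gcongr

theorem HasLipAt.comp_lipschitz (hv : HasLipAt v x c) {φ : ℝ → ℝ} (hφ : LipschitzWith 1 φ) :
    HasLipAt (fun y => φ (v y)) x c := by
  intro ε hε
  filter_upwards [hv ε hε] with q hq
  have := hφ.dist_le_mul (v q.1) (v q.2)
  rw [NNReal.coe_one, one_mul, Real.dist_eq, Real.dist_eq] at this
  exact this.trans hq

theorem HasLipAt.abs (hv : HasLipAt v x c) : HasLipAt (fun y => |v y|) x c :=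
  hv.comp_lipschitz (LipschitzWith.of_dist_le_mul fun a b => by
    simpa [Real.dist_eq] using abs_abs_sub_abs_le a b)

theorem HasLipAt.neg (hv : HasLipAt v x c) : HasLipAt (fun y => -v y) x c :=
  hv.comp_lipschitz (LipschitzWith.id.neg)

theorem HasLipAt.sub (hv : HasLipAt v x c) (hw : HasLipAt w x c') :
    HasLipAt (fun y => v y - w y) x (c + c') := by
  simpa only [sub_eq_add_neg] using hv.add hw.neg

theorem HasLipAt.const_mul (hv : HasLipAt v x c) (a : ℝ) :
    HasLipAt (fun y => a * v y) x (|a| * c) := by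
  simpa using (HasLipAt.const a x).mul hv

theorem LipschitzWith.hasLipAt {K : ℝ≥0} (hv : LipschitzWith K v) (x : X) : HasLipAt v x K := by
  intro ε hε
  refine Eventually.of_forall fun q => (hv.dist_le_mul q.1 q.2).trans ?_
  gcongr
  linarith

theorem locallyLipschitz_of_hasLipAt (h : ∀ x, ∃ c, HasLipAt v x c) : LocallyLipschitz v := by
  intro x
  obtain ⟨c, hc⟩ := h x
  obtain ⟨t, ht, hts⟩ := mem_prod_same_iff.1 (hc 1 one_pos)
  refine ⟨(c + 1).toNNReal, t, ht, LipschitzOnWith.of_dist_le_mul fun y hy z hz => ?_⟩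
  refine (hts (mk_mem_prod hy hz)).trans ?_
  gcongr
  exact Real.le_coe_toNNReal _

/-- A continuous bound for the asymptotic Lipschitz constant is an upper gradient along
`1`-Lipschitz curves. -/
theorem ofReal_abs_sub_le_lintegral_of_hasLipAt {G : X → ℝ} (hG : Continuous G)
    (hG0 : ∀ x, 0 ≤ G x) (hv : ∀ x, HasLipAt v x (G x)) {γ : ℝ → X} (hγ : LipschitzWith 1 γ)
    {L : ℝ} (hL : 0 ≤ L) :
    ENNReal.ofReal |v (γ L) - v (γ 0)| ≤ ∫⁻ t in Icc 0 L, ENNReal.ofReal (G (γ t)) := by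
  have hvc : Continuous v := continuous_iff_continuousAt.2 fun x => (hv x).continuousAt
  have hGγ : Continuous fun t => G (γ t) := hG.comp hγ.continuous
  have hmain := abs_sub_le_integral_of_slope_le (hvc.comp hγ.continuous) hGγ (fun t ε hε => ?_) hL
  · refine (ENNReal.ofReal_le_ofReal hmain).trans (le_of_eq ?_)
    rw [intervalIntegral.integral_of_le hL, ← integral_Icc_eq_integral_Ioc,
      ofReal_integral_eq_lintegral_ofReal hGγ.integrableOn_Icc
        (Eventually.of_forall fun t => hG0 _)]
  · have h1 : ∀ᶠ y in 𝓝 (γ t), |v y - v (γ t)| ≤ (G (γ t) + ε) * dist y (γ t) :=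
      (hv (γ t)).eventually_abs_sub_le hε
    filter_upwards [nhdsWithin_le_nhds ((hγ.continuous.tendsto t).eventually h1),
      self_mem_nhdsWithin] with z hz htz
    refine hz.trans ?_
    have h2 := hγ.dist_le_mul z t
    rw [NNReal.coe_one, one_mul, Real.dist_eq, abs_of_pos (sub_pos.2 htz)] at h2
    have := hG0 (γ t)
    gcongr

theorem hasLipAt_of_abs_sub_le_max {g : X → ℝ} (hg : ContinuousAt g x) {U : Set X}
    (hU : U ∈ 𝓝 x) {δ : ℝ} (hδ : 0 < δ)
    (h : ∀ y ∈ U, ∀ z ∈ U, dist y z ≤ δ → |v y - v z| ≤ max (g y) (g z) * dist y z) :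
    HasLipAt v x (g x) := by
  intro ε hε
  have h1 : ∀ᶠ y in 𝓝 x, y ∈ U ∧ g y < g x + ε ∧ dist y x < δ / 2 :=
    (show ∀ᶠ y in 𝓝 x, y ∈ U from hU).and ((hg.eventually_lt_const (by linarith)).and (Metric.ball_mem_nhds x (by linarith)))
  filter_upwards [h1.prod_inl (𝓝 x), h1.prod_inr (𝓝 x)] with q h1 h2
  have h3 := dist_triangle_right q.1 q.2 x
  refine (h _ h1.1 _ h2.1 (by linarith [h1.2.2, h2.2.2])).trans ?_
  gcongr
  exact max_le h1.2.1.le h2.2.1.le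

end PointwiseLipschitz

/-! ### Gluing along the layers of the exhaustion -/

section Gluing

variable {X : Type*}

/-- The projection of `t` to `[0, 1]`. -/
noncomputable def clamp (t : ℝ) : ℝ := max 0 (min 1 t)

theorem lipschitzWith_clamp : LipschitzWith 1 clamp :=
  (LipschitzWith.id.const_min 1).const_max 0

theorem clamp_nonneg (t : ℝ) : 0 ≤ clamp t := le_max_left _ _

theorem clamp_le_one (t : ℝ) : clamp t ≤ 1 := max_le zero_le_one (min_le_left _ _)

theorem clamp_mono : Monotone clamp := fun _ _ h => max_le_max le_rfl (min_le_min le_rfl h)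

theorem clamp_of_nonpos {t : ℝ} (ht : t ≤ 0) : clamp t = 0 :=
  max_eq_left ((min_le_right _ _).trans ht)

theorem clamp_of_one_le {t : ℝ} (ht : 1 ≤ t) : clamp t = 1 := by
  rw [clamp, min_eq_left ht, max_eq_right zero_le_one]

/-- The partition of unity subordinate to the layers `{i - 1 < h < i + 1}`. -/
noncomputable def tent (h : X → ℝ) (i : ℕ) (x : X) : ℝ :=
  clamp (h x - i + 1) - clamp (h x - (i + 1 : ℕ) + 1)

/-- A cutoff function equal to `1` on `{i - 1 ≤ h ≤ i + 1}` and vanishing off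
`{i - 2 < h < i + 2}`. -/
noncomputable def bump (h : X → ℝ) (i : ℕ) (x : X) : ℝ := clamp (2 - |h x - i|)

variable {h : X → ℝ}

theorem tent_nonneg (h : X → ℝ) (i : ℕ) (x : X) : 0 ≤ tent h i x :=
  sub_nonneg.2 (clamp_mono (by push_cast; linarith))

theorem tent_eq_zero {i : ℕ} {x : X} (hx : 1 ≤ |h x - i|) : tent h i x = 0 := by
  rw [tent]
  rcases le_abs.1 hx with hx | hx
  · rw [clamp_of_one_le (by linarith), clamp_of_one_le (by push_cast; linarith), sub_self]
  · rw [clamp_of_nonpos (by linarith), clamp_of_nonpos (by push_cast; linarith), sub_self]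

theorem abs_sub_lt_of_tent_ne_zero {i : ℕ} {x : X} (hx : tent h i x ≠ 0) : |h x - i| < 1 := by
  by_contra! hle
  exact hx (tent_eq_zero hle)

theorem sum_tent {x : X} (h0 : 0 ≤ h x) {N : ℕ} (hN : h x + 1 ≤ N) :
    ∑ i ∈ Finset.range N, tent h i x = 1 := by
  have := Finset.sum_range_sub' (fun i : ℕ => clamp (h x - i + 1)) N
  rw [clamp_of_one_le (show 1 ≤ h x - (0 : ℕ) + 1 by push_cast; linarith),
    clamp_of_nonpos (show h x - N + 1 ≤ 0 by linarith), sub_zero] at this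
  exact this

theorem bump_nonneg (h : X → ℝ) (i : ℕ) (x : X) : 0 ≤ bump h i x := clamp_nonneg _

theorem bump_le_one (h : X → ℝ) (i : ℕ) (x : X) : bump h i x ≤ 1 := clamp_le_one _

theorem bump_eq_one {i : ℕ} {x : X} (hx : |h x - i| ≤ 1) : bump h i x = 1 :=
  clamp_of_one_le (by linarith)

theorem bump_eq_zero {i : ℕ} {x : X} (hx : 2 ≤ |h x - i|) : bump h i x = 0 :=
  clamp_of_nonpos (by linarith)

theorem HasLipAt.tent [MetricSpace X] {c : ℝ} {x : X} (hx : HasLipAt h x c) (i : ℕ) :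
    HasLipAt (tent h i) x (2 * c) := by
  have h1 : ∀ j : ℕ, HasLipAt (fun y => clamp (h y - j + 1)) x c := fun j => by
    have := ((hx.sub (HasLipAt.const (j : ℝ) x)).add (HasLipAt.const 1 x)).comp_lipschitz
      lipschitzWith_clamp
    simpa using this
  rw [two_mul]
  exact (h1 i).sub (h1 (i + 1))

theorem HasLipAt.bump [MetricSpace X] {c : ℝ} {x : X} (hx : HasLipAt h x c) (i : ℕ) :
    HasLipAt (bump h i) x c := by
  have := ((HasLipAt.const 2 x).sub (hx.sub (HasLipAt.const (i : ℝ) x)).abs).comp_lipschitz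
    lipschitzWith_clamp
  rw [zero_add, add_zero] at this
  exact this

theorem IsCompleteExhaustion.exists_hasLipAt [MetricSpace X] {h : X → ℝ}
    (hh : IsCompleteExhaustion h) (k : ℕ) :
    ∃ C ≥ (0 : ℝ), ∀ x, h x < k → HasLipAt h x C := by
  obtain ⟨C, hC, hlip⟩ := hh.lip k
  refine ⟨C, zero_le_one.trans hC, fun x hx => ?_⟩
  refine hasLipAt_of_abs_sub_le_max (g := fun _ => C) continuousAt_const
    ((isOpen_lt hh.continuous continuous_const).mem_nhds hx) (δ := 1 / C)
    (div_pos one_pos (one_pos.trans_le hC)) fun y hy z _ hyz => ?_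
  rw [max_self]
  exact hlip y z (le_of_lt hy) hyz

/-- The sum of a family of functions, the `i`-th of which vanishes where `h + 2 ≤ i`. -/
noncomputable def layerSum (h : X → ℝ) (a : ℕ → X → ℝ) (x : X) : ℝ :=
  ∑ i ∈ Finset.range (⌈h x⌉₊ + 3), a i x

theorem layerSum_eq {a : ℕ → X → ℝ} {x : X} (ha : ∀ i : ℕ, h x + 2 ≤ i → a i x = 0) {N : ℕ}
    (hN : ⌈h x⌉₊ + 3 ≤ N) : layerSum h a x = ∑ i ∈ Finset.range N, a i x := by
  refine Finset.sum_subset (Finset.range_mono hN) fun i _ hi => ha i ?_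
  rw [Finset.mem_range, not_lt] at hi
  have h1 : ((⌈h x⌉₊ + 3 : ℕ) : ℝ) ≤ i := by exact_mod_cast hi
  push_cast at h1
  linarith [Nat.le_ceil (h x)]

theorem eventually_layerSum_eq [MetricSpace X] (hc : Continuous h) {a : ℕ → X → ℝ}
    (ha : ∀ (i : ℕ) x, h x + 2 ≤ i → a i x = 0) (x : X) :
    layerSum h a =ᶠ[𝓝 x] fun y => ∑ i ∈ Finset.range (⌈h x⌉₊ + 4), a i y := by
  filter_upwards [(hc.tendsto x).eventually_lt_const (lt_add_one (h x))] with y hy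
  refine layerSum_eq (fun i => ha i y) ?_
  have : ⌈h y⌉₊ ≤ ⌈h x⌉₊ + 1 := by
    rw [Nat.ceil_le]
    push_cast
    linarith [Nat.le_ceil (h x)]
  omega

/-- Functions `f i` which on `{h ≤ i + 3}` are locally Lipschitz with constant given by `g i`. -/
structure IsLayerApprox [MetricSpace X] (h : X → ℝ) (f g : ℕ → X → ℝ) : Prop where
  g_nonneg : ∀ i x, 0 ≤ g i x
  g_lipschitz : ∀ i, ∃ K, LipschitzWith K (g i)
  lip : ∀ i : ℕ, ∃ δ > 0, ∀ x y, h x ≤ i + 3 → h y ≤ i + 3 → dist x y ≤ δ →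
    |f i x - f i y| ≤ max (g i x) (g i y) * dist x y

variable {f g : ℕ → X → ℝ}

theorem IsLayerApprox.hasLipAt [MetricSpace X] (hfg : IsLayerApprox h f g) (hc : Continuous h) {i : ℕ} {x : X}
    (hx : h x < i + 3) : HasLipAt (f i) x (g i x) := by
  obtain ⟨δ, hδ, hlip⟩ := hfg.lip i
  obtain ⟨K, hK⟩ := hfg.g_lipschitz i
  exact hasLipAt_of_abs_sub_le_max hK.continuous.continuousAt
    ((isOpen_lt hc continuous_const).mem_nhds hx) hδ
    fun y hy z hz hyz => hlip y z (le_of_lt hy) (le_of_lt hz) hyz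

/-- The functions `f i` glued by the partition of unity `tent h i`. -/
noncomputable def gluedFun (h : X → ℝ) (f : ℕ → X → ℝ) : X → ℝ :=
  layerSum h fun i y => tent h i y * f i y

/-- The natural bound for the asymptotic Lipschitz constant of `gluedFun h f`. -/
noncomputable def gluedWeight (h : X → ℝ) (B : ℕ → ℝ) (f g : ℕ → X → ℝ) : X → ℝ :=
  layerSum h fun i y => tent h i y * g i y + bump h i y * (B i * |f i y - gluedFun h f y|)

theorem tent_eq_zero_of_le {i : ℕ} {x : X} (hx : h x + 2 ≤ i) : tent h i x = 0 :=
  tent_eq_zero (by rw [le_abs]; right; linarith)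

theorem bump_eq_zero_of_le {i : ℕ} {x : X} (hx : h x + 2 ≤ i) : bump h i x = 0 :=
  bump_eq_zero (by rw [le_abs]; right; linarith)

theorem sum_tent_ceil {x : X} (h0 : 0 ≤ h x) {N : ℕ} (hN : ⌈h x⌉₊ + 3 ≤ N) :
    ∑ i ∈ Finset.range N, tent h i x = 1 := by
  refine sum_tent h0 ?_
  have h1 : ((⌈h x⌉₊ + 3 : ℕ) : ℝ) ≤ N := by exact_mod_cast hN
  push_cast at h1
  linarith [Nat.le_ceil (h x)]

theorem gluedFun_le {x : X} (h0 : 0 ≤ h x) {c : ℝ} (hf : ∀ i : ℕ, h x ≤ i + 3 → f i x ≤ c) :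
    gluedFun h f x ≤ c := by
  calc gluedFun h f x ≤ ∑ i ∈ Finset.range (⌈h x⌉₊ + 3), tent h i x * c := by
        rw [gluedFun, layerSum]
        refine Finset.sum_le_sum fun i _ => ?_
        rcases eq_or_ne (tent h i x) 0 with hi | hi
        · rw [hi, zero_mul, zero_mul]
        · have := abs_sub_lt_iff.1 (abs_sub_lt_of_tent_ne_zero hi)
          exact mul_le_mul_of_nonneg_left (hf i (by linarith)) (tent_nonneg h i x)
    _ = c := by rw [← Finset.sum_mul, sum_tent_ceil h0 le_rfl, one_mul]

theorem le_gluedFun {x : X} (h0 : 0 ≤ h x) {c : ℝ} (hf : ∀ i : ℕ, h x ≤ i + 3 → c ≤ f i x) :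
    c ≤ gluedFun h f x := by
  calc c = ∑ i ∈ Finset.range (⌈h x⌉₊ + 3), tent h i x * c := by
        rw [← Finset.sum_mul, sum_tent_ceil h0 le_rfl, one_mul]
    _ ≤ gluedFun h f x := by
        rw [gluedFun, layerSum]
        refine Finset.sum_le_sum fun i _ => ?_
        rcases eq_or_ne (tent h i x) 0 with hi | hi
        · rw [hi, zero_mul, zero_mul]
        · have := abs_sub_lt_iff.1 (abs_sub_lt_of_tent_ne_zero hi)
          exact mul_le_mul_of_nonneg_left (hf i (by linarith)) (tent_nonneg h i x)

theorem gluedWeight_nonneg {B : ℕ → ℝ} (hB : ∀ i, 0 ≤ B i) (hg : ∀ i x, 0 ≤ g i x) (x : X) :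
    0 ≤ gluedWeight h B f g x := by
  rw [gluedWeight, layerSum]
  exact Finset.sum_nonneg fun i _ => add_nonneg (mul_nonneg (tent_nonneg h i x) (hg i x))
    (mul_nonneg (bump_nonneg h i x) (mul_nonneg (hB i) (abs_nonneg _)))

/-- Since the tents sum to `1`, near `x` the glued function is `c + ∑ tent h i * (f i - c)` with the
constant `c = gluedFun h f x`. In the product rule the Lipschitz constant of a tent is then
multiplied only by `|f i x - c|`. -/
theorem IsLayerApprox.hasLipAt_gluedFun [MetricSpace X] (hfg : IsLayerApprox h f g)
    (hh : IsCompleteExhaustion h)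
    {B : ℕ → ℝ} (hB0 : ∀ i, 0 ≤ B i)
    (hB : ∀ (i : ℕ) x, h x < i + 3 → HasLipAt (tent h i) x (B i)) (x : X) :
    HasLipAt (gluedFun h f) x (gluedWeight h B f g x) := by
  set c := gluedFun h f x with hc
  set N := ⌈h x⌉₊ + 4 with hN
  have hterm : ∀ i ∈ Finset.range N, HasLipAt (fun y => tent h i y * (f i y - c)) x
      (tent h i x * g i x + bump h i x * (B i * |f i x - c|)) := by
    intro i _
    have hnn : 0 ≤ tent h i x * g i x + bump h i x * (B i * |f i x - c|) :=
      add_nonneg (mul_nonneg (tent_nonneg h i x) (hfg.g_nonneg i x))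
        (mul_nonneg (bump_nonneg h i x) (mul_nonneg (hB0 i) (abs_nonneg _)))
    -- Where `|h x - i| = 1` the tent vanishes at `x` but perhaps not nearby; the bump is still `1`
    -- there.
    rcases le_or_gt |h x - i| 1 with hi | hi
    · have hx : h x < i + 3 := by linarith [(abs_sub_le_iff.1 hi).1]
      have := (hB i x hx).mul ((hfg.hasLipAt hh.continuous hx).sub (HasLipAt.const c x))
      rw [abs_of_nonneg (tent_nonneg h i x), add_zero, mul_comm |f i x - c|] at this
      rwa [bump_eq_one hi, one_mul]
    · refine ((HasLipAt.const 0 x).mono hnn).congr ?_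
      have hcont : Continuous fun y => |h y - i| := (hh.continuous.sub continuous_const).abs
      filter_upwards [(hcont.tendsto x).eventually_const_lt hi] with y hy
      rw [tent_eq_zero hy.le, zero_mul]
  have hsum := (HasLipAt.const c x).add (HasLipAt.sum _ hterm)
  rw [zero_add] at hsum
  rw [gluedWeight, layerSum_eq (fun i hi => by
    rw [tent_eq_zero_of_le hi, bump_eq_zero_of_le hi, zero_mul, zero_mul, add_zero])
    (show ⌈h x⌉₊ + 3 ≤ N by omega)]
  refine hsum.congr ?_
  have hloc := eventually_layerSum_eq hh.continuous
    (a := fun i y => tent h i y * f i y)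
    (fun i y hi => by simp only [tent_eq_zero_of_le hi, zero_mul]) x
  have hlt : ∀ᶠ y in 𝓝 x, h y < h x + 1 :=
    (hh.continuous.tendsto x).eventually_lt_const (lt_add_one _)
  filter_upwards [hloc, hlt] with y hy hyx
  rw [gluedFun, hy]
  simp only [mul_sub, Finset.sum_sub_distrib]
  rw [← Finset.sum_mul, sum_tent (hh.nonneg y), one_mul]
  · ring
  · rw [hN]
    push_cast
    linarith [Nat.le_ceil (h x)]

/-- The error term compares `f i` with the glued function, which is locally Lipschitz, and not with
the merely measurable `u`; it is cut off by a Lipschitz bump and not by an indicator. Off the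
support of the bump nothing is required of `f i`. -/
theorem IsLayerApprox.locallyLipschitz_gluedWeight [MetricSpace X] (hfg : IsLayerApprox h f g)
    (hh : IsCompleteExhaustion h) {B : ℕ → ℝ} (hB0 : ∀ i, 0 ≤ B i)
    (hB : ∀ (i : ℕ) x, h x < i + 3 → HasLipAt (tent h i) x (B i)) :
    LocallyLipschitz (gluedWeight h B f g) := by
  refine locallyLipschitz_of_hasLipAt fun x => ?_
  obtain ⟨k, hk⟩ := exists_nat_gt (h x)
  obtain ⟨C, -, hC⟩ := hh.exists_hasLipAt k
  have hhx := hC x hk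
  have hterm : ∀ i : ℕ, ∃ c, HasLipAt (fun y => tent h i y * g i y +
      bump h i y * (B i * |f i y - gluedFun h f y|)) x c := by
    intro i
    obtain ⟨K, hK⟩ := hfg.g_lipschitz i
    have h1 := (hhx.tent i).mul (hK.hasLipAt x)
    rcases le_or_gt |h x - i| 2 with hi | hi
    · have hx : h x < i + 3 := by linarith [(abs_sub_le_iff.1 hi).1]
      exact ⟨_, h1.add ((hhx.bump i).mul (((hfg.hasLipAt hh.continuous hx).sub
        (hfg.hasLipAt_gluedFun hh hB0 hB x)).abs.const_mul (B i)))⟩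
    · refine ⟨_, h1.congr ?_⟩
      have hcont : Continuous fun y => |h y - i| := (hh.continuous.sub continuous_const).abs
      filter_upwards [(hcont.tendsto x).eventually_const_lt hi] with y hy
      rw [bump_eq_zero hy.le, zero_mul, add_zero]
  choose c hc using hterm
  exact ⟨_, (HasLipAt.sum _ fun i _ => hc i).congr (eventually_layerSum_eq hh.continuous
    (fun i y hi => by
      simp only [tent_eq_zero_of_le hi, bump_eq_zero_of_le hi, zero_mul, add_zero]) x).symm⟩

theorem sum_bump_mul_le {B : ℕ → ℝ} (hB : ∀ i, 0 ≤ B i) {x : X} {j : ℕ} (hj : tent h j x ≠ 0)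
    (N : ℕ) : ∑ i ∈ Finset.range N, bump h i x * B i ≤ ∑ i ∈ Finset.range (j + 3), B i := by
  have hj' := abs_sub_lt_iff.1 (abs_sub_lt_of_tent_ne_zero hj)
  calc ∑ i ∈ Finset.range N, bump h i x * B i
      ≤ ∑ i ∈ Finset.range (max N (j + 3)), bump h i x * B i :=
        Finset.sum_le_sum_of_subset_of_nonneg (Finset.range_mono (le_max_left _ _))
          fun i _ _ => mul_nonneg (bump_nonneg h i x) (hB i)
    _ = ∑ i ∈ Finset.range (j + 3), bump h i x * B i := by
        refine (Finset.sum_subset (Finset.range_mono (le_max_right _ _)) fun i _ hi => ?_).symm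
        rw [Finset.mem_range, not_lt] at hi
        have : ((j + 3 : ℕ) : ℝ) ≤ i := by exact_mod_cast hi
        push_cast at this
        rw [bump_eq_zero_of_le (by linarith), zero_mul]
    _ ≤ _ := Finset.sum_le_sum fun i _ => mul_le_of_le_one_left (hB i) (bump_le_one h i x)

/-- The difference `u - gluedFun h f` is an average of the `u - f j` with the tents as weights, so
the error can be measured against `u`. Where the `j`-th tent is non-zero, only bumps of index below
`j + 3` contribute, so the coefficient of `|f j - u|` depends on `j` alone. -/
theorem sum_bump_mul_abs_sub_gluedFun_le {B : ℕ → ℝ} (hB : ∀ i, 0 ≤ B i) (u : X → ℝ) {x : X}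
    (h0 : 0 ≤ h x) {N : ℕ} (hN : N = ⌈h x⌉₊ + 3) :
    ∑ i ∈ Finset.range N, bump h i x * (B i * |f i x - gluedFun h f x|) ≤
      ∑ i ∈ Finset.range N, {y | h y ≤ i + 3}.indicator
        (fun y => (B i + ∑ j ∈ Finset.range (i + 3), B j) * |f i y - u y|) x := by
  set v := gluedFun h f x with hv
  have hBsum : ∀ i : ℕ, 0 ≤ ∑ j ∈ Finset.range i, B j := fun i =>
    Finset.sum_nonneg fun j _ => hB j
  have hsum1 : ∑ j ∈ Finset.range N, tent h j x = 1 := sum_tent_ceil h0 hN.ge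
  have huv : |u x - v| ≤ ∑ j ∈ Finset.range N, tent h j x * |f j x - u x| := by
    have h1 : u x - v = ∑ j ∈ Finset.range N, tent h j x * (u x - f j x) := by
      simp only [mul_sub, Finset.sum_sub_distrib]
      rw [← Finset.sum_mul, hsum1, one_mul, hv, gluedFun, layerSum, hN]
    rw [h1]
    refine (Finset.abs_sum_le_sum_abs _ _).trans (Finset.sum_le_sum fun j _ => ?_)
    rw [abs_mul, abs_of_nonneg (tent_nonneg h j x), abs_sub_comm]
  have hsplit : ∀ i, |f i x - v| ≤ |f i x - u x| + |u x - v| := fun i => abs_sub_le _ _ _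
  calc ∑ i ∈ Finset.range N, bump h i x * (B i * |f i x - v|)
      ≤ ∑ i ∈ Finset.range N, (bump h i x * B i * |f i x - u x| + bump h i x * B i * |u x - v|) := by
        refine Finset.sum_le_sum fun i _ => ?_
        rw [← mul_add, ← mul_assoc]
        exact mul_le_mul_of_nonneg_left (hsplit i) (mul_nonneg (bump_nonneg h i x) (hB i))
    _ = (∑ i ∈ Finset.range N, bump h i x * B i * |f i x - u x|) +
          (∑ i ∈ Finset.range N, bump h i x * B i) * |u x - v| := by
        rw [Finset.sum_add_distrib, Finset.sum_mul]
    _ ≤ (∑ i ∈ Finset.range N, bump h i x * B i * |f i x - u x|) +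
          (∑ i ∈ Finset.range N, bump h i x * B i) *
            ∑ j ∈ Finset.range N, tent h j x * |f j x - u x| := by
        gcongr
        exact Finset.sum_nonneg fun i _ => mul_nonneg (bump_nonneg h i x) (hB i)
    _ = ∑ j ∈ Finset.range N, (bump h j x * B j +
          (∑ i ∈ Finset.range N, bump h i x * B i) * tent h j x) * |f j x - u x| := by
        rw [Finset.mul_sum, ← Finset.sum_add_distrib]
        refine Finset.sum_congr rfl fun j _ => ?_
        ring
    _ ≤ _ := by
        refine Finset.sum_le_sum fun j _ => ?_
        by_cases hj : h x ≤ j + 3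
        · rw [indicator_of_mem (show x ∈ {y | h y ≤ j + 3} from hj)]
          refine mul_le_mul_of_nonneg_right (add_le_add
            (mul_le_of_le_one_left (hB j) (bump_le_one h j x)) ?_) (abs_nonneg _)
          rcases eq_or_ne (tent h j x) 0 with hj0 | hj0
          · rw [hj0, mul_zero]
            exact hBsum _
          · have htent : tent h j x ≤ 1 := (sub_le_self _ (clamp_nonneg _)).trans (clamp_le_one _)
            exact (mul_le_of_le_one_right (Finset.sum_nonneg fun i _ =>
              mul_nonneg (bump_nonneg h i x) (hB i)) htent).trans (sum_bump_mul_le hB hj0 N)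
        · rw [indicator_of_notMem (show x ∉ {y | h y ≤ j + 3} from hj)]
          rw [not_le] at hj
          rw [tent_eq_zero (by rw [le_abs]; left; linarith),
            bump_eq_zero (by rw [le_abs]; left; linarith)]
          simp

theorem ofReal_sum_tent_mul_le {x : X} (h0 : 0 ≤ h x) {r : ℝ≥0∞}
    (hg : ∀ i, ENNReal.ofReal (g i x) ≤ r) {N : ℕ} (hN : ⌈h x⌉₊ + 3 ≤ N) :
    ENNReal.ofReal (∑ i ∈ Finset.range N, tent h i x * g i x) ≤ r := by
  rcases eq_or_ne r ⊤ with rfl | hr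
  · exact le_top
  refine ENNReal.ofReal_le_of_le_toReal ?_
  calc ∑ i ∈ Finset.range N, tent h i x * g i x ≤ ∑ i ∈ Finset.range N, tent h i x * r.toReal := by
        refine Finset.sum_le_sum fun i _ => mul_le_mul_of_nonneg_left ?_ (tent_nonneg h i x)
        exact (ENNReal.ofReal_le_iff_le_toReal hr).1 (hg i)
    _ = r.toReal := by rw [← Finset.sum_mul, sum_tent_ceil h0 hN, one_mul]

/-- Gluing local approximants of `u` along an exhaustion: the weight of the glued function exceeds
the local weights by an error which is controlled by the distances of the approximants to `u`. -/
theorem IsCompleteExhaustion.exists_glued [MetricSpace X] (hh : IsCompleteExhaustion h) :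
    ∃ b : ℕ → ℝ, (∀ i, 0 ≤ b i) ∧ ∀ (f g : ℕ → X → ℝ), IsLayerApprox h f g →
      ∃ v G : X → ℝ, (∀ x, HasLipAt v x (G x)) ∧ (∀ x, 0 ≤ G x) ∧ LocallyLipschitz G ∧
        (∀ x c, (∀ i : ℕ, h x ≤ i + 3 → f i x ≤ c) → v x ≤ c) ∧
        (∀ x c, (∀ i : ℕ, h x ≤ i + 3 → c ≤ f i x) → c ≤ v x) ∧
        ∀ (u : X → ℝ) (x : X) (r : ℝ≥0∞), (∀ i, ENNReal.ofReal (g i x) ≤ r) →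
          ENNReal.ofReal (G x) ≤ r + ∑' i : ℕ, {y | h y ≤ i + 3}.indicator
            (fun y => ENNReal.ofReal (b i * |f i y - u y|)) x := by
  have hC : ∀ i : ℕ, ∃ C ≥ (0 : ℝ), ∀ x, h x < i + 3 → HasLipAt h x C := fun i => by
    simpa using hh.exists_hasLipAt (i + 3)
  choose C hC0 hC using hC
  set B : ℕ → ℝ := fun i => 2 * C i with hBdef
  have hB0 : ∀ i, 0 ≤ B i := fun i => mul_nonneg zero_le_two (hC0 i)
  have hB : ∀ (i : ℕ) x, h x < i + 3 → HasLipAt (tent h i) x (B i) := fun i x hx =>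
    (hC i x hx).tent i
  have hb0 : ∀ i, 0 ≤ B i + ∑ j ∈ Finset.range (i + 3), B j := fun i =>
    add_nonneg (hB0 i) (Finset.sum_nonneg fun j _ => hB0 j)
  refine ⟨fun i => B i + ∑ j ∈ Finset.range (i + 3), B j, hb0, fun f g hfg => ?_⟩
  refine ⟨gluedFun h f, gluedWeight h B f g, hfg.hasLipAt_gluedFun hh hB0 hB,
    gluedWeight_nonneg hB0 hfg.g_nonneg, hfg.locallyLipschitz_gluedWeight hh hB0 hB,
    fun x c => gluedFun_le (hh.nonneg x), fun x c => le_gluedFun (hh.nonneg x),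
    fun u x r hr => ?_⟩
  rw [gluedWeight, layerSum, Finset.sum_add_distrib, ENNReal.ofReal_add
    (Finset.sum_nonneg fun i _ => mul_nonneg (tent_nonneg h i x) (hfg.g_nonneg i x))
    (Finset.sum_nonneg fun i _ => mul_nonneg (bump_nonneg h i x)
      (mul_nonneg (hB0 i) (abs_nonneg _)))]
  refine add_le_add (ofReal_sum_tent_mul_le (hh.nonneg x) hr le_rfl) ?_
  refine (ENNReal.ofReal_le_ofReal
    (sum_bump_mul_abs_sub_gluedFun_le hB0 u (hh.nonneg x) rfl)).trans ?_
  rw [ENNReal.ofReal_sum_of_nonneg fun i _ => indicator_nonneg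
    (fun y _ => mul_nonneg (hb0 i) (abs_nonneg _)) x]
  refine (Finset.sum_le_sum fun i _ => ?_).trans (ENNReal.sum_le_tsum _)
  by_cases hx : h x ≤ i + 3
  · simp only [indicator, mem_ofPred_eq, hx, if_true, le_refl]
  · simp only [indicator, mem_ofPred_eq, hx, if_false, ENNReal.ofReal_zero, le_refl]

end Gluing

/-! ### Inequalities between capacities and moduli -/

section Capacities

variable {X : Type*} [MetricSpace X] [MeasurableSpace X]

theorem condenserCapacityWith_anti {W W' : Set ((X → EReal) × (X → ℝ≥0∞))} (hW : W ⊆ W')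
    (μ : Measure X) (p : ℝ) (E F : Set X) :
    condenserCapacityWith W' μ p E F ≤ condenserCapacityWith W μ p E F :=
  biInf_mono fun _ hq => ⟨hW hq.1, hq.2⟩

theorem IsUpperGradient.mem_admissibleFunctions {g : X → ℝ≥0∞} {u : X → EReal}
    (hg : IsUpperGradient g u) {E F : Set X} (hE : ∀ x ∈ E, u x = 0) (hF : ∀ x ∈ F, u x = 1) :
    g ∈ admissibleFunctions (curvesBetween E F) := by
  refine ⟨hg.1, fun γ hγ => ?_⟩
  have h1 := hg.2 γ hγ.1
  rw [hE _ hγ.2.1, hF _ hγ.2.2] at h1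
  simpa [EReal.abs_neg, ← EReal.coe_one, EReal.abs_def] using h1

theorem curveModulus_le_condenserCapacity (μ : Measure X) (p : ℝ) (E F : Set X) :
    curveModulus μ p (curvesBetween E F) ≤ condenserCapacity μ p E F :=
  le_iInf₂ fun q hq => iInf₂_le q.2 (IsUpperGradient.mem_admissibleFunctions hq.1 hq.2.1 hq.2.2)

theorem continuousCurveModulus_le_condenserCapacityWith_lipLipPairs (μ : Measure X) (p : ℝ)
    (E F : Set X) : continuousCurveModulus μ p (curvesBetween E F) ≤
      condenserCapacityWith (lipLipPairs X) μ p E F := by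
  refine le_iInf₂ fun q hq => iInf₂_le q.2 ⟨IsUpperGradient.mem_admissibleFunctions hq.1.1.1
    hq.2.1 hq.2.2, ?_⟩
  obtain ⟨k, hk, hqk⟩ := hq.1.2
  exact ⟨k, hk.continuous, hqk⟩

theorem curveModulus_le_continuousCurveModulus (μ : Measure X) (p : ℝ) (Γ : Set (ℝ → X)) :
    curveModulus μ p Γ ≤ continuousCurveModulus μ p Γ :=
  biInf_mono fun _ hρ => hρ.1

theorem condenserCapacityWith_lipLipPairs_le [BorelSpace X] {v G : X → ℝ}
    (hv : ∀ x, HasLipAt v x (G x)) (hG0 : ∀ x, 0 ≤ G x) (hG : LocallyLipschitz G) {E F : Set X}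
    (hE : ∀ x ∈ E, v x = 0) (hF : ∀ x ∈ F, v x = 1) (μ : Measure X) (p : ℝ) :
    condenserCapacityWith (lipLipPairs X) μ p E F ≤ ∫⁻ x, ENNReal.ofReal (G x) ^ p ∂μ := by
  refine iInf₂_le (⟨fun x => (v x : EReal), fun x => ENNReal.ofReal (G x)⟩ :
    (X → EReal) × (X → ℝ≥0∞)) ⟨⟨⟨⟨hG.continuous.measurable.ennreal_ofReal, fun γ hγ => ?_⟩, v,
      locallyLipschitz_of_hasLipAt fun x => ⟨_, hv x⟩, rfl⟩, fun x => (G x).toNNReal, ?_, rfl⟩,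
      fun x hx => ?_, fun x hx => ?_⟩
  · obtain ⟨c, L, hL, hc, h0, h1, hint⟩ := hγ.exists_lipschitz
    simp only [hint, ← h0, ← h1]
    rw [← EReal.coe_sub, EReal.abs_def, abs_sub_comm]
    exact ofReal_abs_sub_le_lintegral_of_hasLipAt hG.continuous hG0 hv hc hL
  · exact Real.lipschitzWith_toNNReal.locallyLipschitz.comp hG
  · simp [hE x hx]
  · simp [hF x hx]

end Capacities

/-! ### Approximation in `L^p` -/

section Integrals

/-- Each `s i` is at most the `ℓ^p` norm of the sequence, and the weights sum to at most `1`. This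
allows countably many errors to be summed by adding their `p`-th powers. -/
theorem tsum_mul_le_rpow_tsum {w : ℕ → ℝ≥0∞} (hw : ∑' i, w i ≤ 1) {p : ℝ} (hp : 0 < p)
    (s : ℕ → ℝ≥0∞) : ∑' i, w i * s i ≤ (∑' i, s i ^ p) ^ p⁻¹ := by
  have hs : ∀ i, s i ≤ (∑' i, s i ^ p) ^ p⁻¹ := fun i => by
    rw [ENNReal.le_rpow_inv_iff hp]
    exact ENNReal.le_tsum (f := fun i => s i ^ p) i
  calc ∑' i, w i * s i ≤ ∑' i, w i * (∑' i, s i ^ p) ^ p⁻¹ :=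
        ENNReal.tsum_le_tsum fun i => mul_le_mul' le_rfl (hs i)
    _ = (∑' i, w i) * (∑' i, s i ^ p) ^ p⁻¹ := ENNReal.tsum_mul_right
    _ ≤ _ := mul_le_of_le_one_left' hw

theorem exists_pos_mul_le {a η : ℝ≥0∞} (ha : a ≠ ⊤) (hη : η ≠ 0) :
    ∃ κ : ℝ, 0 < κ ∧ κ ≤ 1 ∧ ENNReal.ofReal κ * a ≤ η := by
  lift a to ℝ≥0 using ha
  obtain ⟨r, hr0, hr⟩ := ENNReal.lt_iff_exists_nnreal_btwn.1 (pos_iff_ne_zero.2 hη)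
  have hr0 : 0 < r := by exact_mod_cast hr0
  refine ⟨min 1 (r / (a + 1) : ℝ≥0), lt_min one_pos (NNReal.coe_pos.2 (by positivity)),
    min_le_left _ _, le_trans ?_ hr.le⟩
  calc ENNReal.ofReal (min 1 (r / (a + 1) : ℝ≥0)) * a
      ≤ ENNReal.ofReal (r / (a + 1) : ℝ≥0) * a := by
        gcongr
        exact min_le_right _ _
    _ = ((r / (a + 1) * a : ℝ≥0) : ℝ≥0∞) := by rw [ENNReal.ofReal_coe_nnreal, ENNReal.coe_mul]
    _ ≤ r := by
        rw [ENNReal.coe_le_coe]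
        calc r / (a + 1) * a ≤ r / (a + 1) * (a + 1) := by gcongr; exact le_self_add
          _ = r := div_mul_cancel₀ _ (by positivity)

variable {X : Type*} [MetricSpace X] [MeasurableSpace X] [BorelSpace X]

/-- Local approximation of a potential in `L^p`. -/
theorem IsCondenserPotential.exists_approx_lintegral [TopologicalSpace.SeparableSpace X]
    {ρ : X → ℝ≥0∞} {E F Y : Set X} {u : X → ℝ} (hu : IsCondenserPotential ρ E F u)
    (hum : Measurable u) (hρ : LowerSemicontinuous ρ) (hY : IsComplete Y)
    (hρY : IsCoerciveOn ρ Y) (hE : IsClosed E) (hF : IsClosed F) {d : ℝ} (hd : 0 < d)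
    (hEF : ∀ a ∈ E, ∀ b ∈ F, d ≤ dist a b) {μ : Measure X} (hμ : μ Y ≠ ⊤) {p : ℝ} (hp : 1 ≤ p)
    {ε : ℝ} (hε : 0 < ε) (b : ℝ≥0) {η : ℝ≥0∞} (hη : η ≠ 0) :
    ∃ (f : X → ℝ) (n : ℕ) (δ : ℝ), Measurable f ∧ (∀ x, f x ≤ 1) ∧
      (∀ x ∈ E ∩ Y, f x = 0) ∧ (∀ x ∈ F, 1 - ε ≤ f x) ∧ 0 < δ ∧
      (∀ x ∈ Y, ∀ y ∈ Y, dist x y ≤ δ →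
        |f x - f y| ≤ max (lipApprox ρ n x) (lipApprox ρ n y) * dist x y) ∧
      ∫⁻ x in Y, (b * ENNReal.ofReal |f x - u x|) ^ p ∂μ ≤ η := by
  have hp0 : 0 < p := one_pos.trans_le hp
  have hbp : (b : ℝ≥0∞) ^ p ≠ ⊤ := ENNReal.rpow_ne_top_of_nonneg hp0.le ENNReal.coe_ne_top
  have hη2 : η / 2 ≠ 0 := by simp [hη]
  have hδ : η / 2 / ((b : ℝ≥0∞) ^ p + 1) ≠ 0 :=
    ENNReal.div_ne_zero.2 ⟨hη2, ENNReal.add_ne_top.2 ⟨hbp, ENNReal.one_ne_top⟩⟩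
  obtain ⟨K, hKY, hK, huK, hKδ⟩ := hY.exists_isCompact_continuousOn hμ hum hδ
  -- The bound `κ ≤ 1` gives `κ ^ p ≤ κ`, so the error on `K` is controlled linearly in `κ`; off `K`
  -- it is at most `b ^ p` on a set of small measure.
  obtain ⟨κ, hκ0, hκ1, hκ⟩ := exists_pos_mul_le (ENNReal.mul_ne_top hbp hμ) hη2
  obtain ⟨f, n, δ, hfm, hf0, hf1, hfE, hfF, hfK, hδ, hlip⟩ := hu.exists_approx hρ hY hρY hE hF hd
    hEF hK hKY huK (lt_min hκ0 hε)
  refine ⟨f, n, δ, hfm, hf1, hfE, fun x hx => ?_, hδ, hlip, ?_⟩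
  · linarith [hfF x hx, min_le_right κ ε]
  have hpt1 : ∀ x ∈ K, (b * ENNReal.ofReal |f x - u x|) ^ p ≤ (b : ℝ≥0∞) ^ p * ENNReal.ofReal κ := by
    intro x hx
    rw [ENNReal.mul_rpow_of_nonneg _ _ hp0.le]
    gcongr
    have h1 : ENNReal.ofReal |f x - u x| ≤ ENNReal.ofReal κ :=
      ENNReal.ofReal_le_ofReal ((hfK x hx).trans (min_le_left _ _))
    refine (ENNReal.rpow_le_rpow h1 hp0.le).trans ?_
    refine (ENNReal.rpow_le_rpow_of_exponent_ge ?_ hp).trans_eq (ENNReal.rpow_one _)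
    exact ENNReal.ofReal_le_one.2 hκ1
  have hpt2 : ∀ x, (b * ENNReal.ofReal |f x - u x|) ^ p ≤ (b : ℝ≥0∞) ^ p := by
    intro x
    refine ENNReal.rpow_le_rpow (mul_le_of_le_one_right' (ENNReal.ofReal_le_one.2 ?_)) hp0.le
    rw [abs_sub_le_iff]
    constructor <;> linarith [hf0 x, hf1 x, hu.nonneg x, hu.le_one x]
  have hYK : Y ⊆ K ∪ (Y \ K) := fun x hx => by
    by_cases hxK : x ∈ K
    · exact Or.inl hxK
    · exact Or.inr ⟨hx, hxK⟩
  calc ∫⁻ x in Y, (b * ENNReal.ofReal |f x - u x|) ^ p ∂μ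
      ≤ (∫⁻ x in K, (b * ENNReal.ofReal |f x - u x|) ^ p ∂μ) +
        ∫⁻ x in Y \ K, (b * ENNReal.ofReal |f x - u x|) ^ p ∂μ :=
        (lintegral_mono_set hYK).trans (lintegral_union_le _ _ _)
    _ ≤ (∫⁻ _ in K, (b : ℝ≥0∞) ^ p * ENNReal.ofReal κ ∂μ) + ∫⁻ _ in Y \ K, (b : ℝ≥0∞) ^ p ∂μ :=
        add_le_add (setLIntegral_mono' hK.measurableSet hpt1) (lintegral_mono hpt2)
    _ ≤ ENNReal.ofReal κ * ((b : ℝ≥0∞) ^ p * μ Y) +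
          ((b : ℝ≥0∞) ^ p + 1) * (η / 2 / ((b : ℝ≥0∞) ^ p + 1)) := by
        rw [setLIntegral_const, setLIntegral_const]
        refine add_le_add ?_ (mul_le_mul' le_self_add hKδ.le)
        rw [mul_comm ((b : ℝ≥0∞) ^ p), mul_assoc]
        gcongr
    _ ≤ η / 2 + η / 2 := add_le_add hκ ENNReal.mul_div_le
    _ = η := ENNReal.add_halves η

end Integrals

theorem isLocallyFiniteMeasure_of_ball_lt_top {X : Type*} [MetricSpace X] [MeasurableSpace X]
    {μ : Measure X}
    (hμ : ∀ (x : X) (r : ℝ), 0 < r → μ (Metric.ball x r) < ⊤) : IsLocallyFiniteMeasure μ :=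
  ⟨fun x => ⟨_, Metric.ball_mem_nhds x one_pos, hμ x 1 one_pos⟩⟩

theorem exists_pos_le_dist_of_setDistance_pos {X : Type*} [MetricSpace X] {E F : Set X}
    (hdist : 0 < setDistance E F) :
    ∃ d : ℝ, 0 < d ∧ ∀ a ∈ E, ∀ b ∈ F, d ≤ dist a b := by
  obtain ⟨d, hd0, hd⟩ := ENNReal.lt_iff_exists_nnreal_btwn.1 hdist
  refine ⟨d, by exact_mod_cast hd0, fun a ha b hb => ?_⟩
  have : (d : ℝ≥0∞) ≤ edist a b := hd.le.trans ((iInf₂_le a ha).trans (iInf₂_le b hb))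
  rw [edist_nndist, ENNReal.coe_le_coe] at this
  exact_mod_cast this

/-! ### The Lipschitz capacity is at most the modulus -/

section Main

variable {X : Type*} [MetricSpace X] [MeasurableSpace X] [BorelSpace X] {μ : Measure X} {p : ℝ}
  {h : X → ℝ} {E F : Set X}

/-- The capacity for locally Lipschitz pairs is controlled by `∫ ρ ^ p` whenever there is a
measurable potential for the lower semicontinuous coercive function `ρ`. -/
theorem IsCondenserPotential.rpow_condenserCapacityWith_lipLipPairs_le
    [TopologicalSpace.SeparableSpace X] {ρ : X → ℝ≥0∞} {u : X → ℝ}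
    (hu : IsCondenserPotential ρ E F u) (hum : Measurable u) (hh : IsCompleteExhaustion h)
    (hμ : ∀ k : ℕ, μ {x | h x ≤ k} ≠ ⊤) (hρ : LowerSemicontinuous ρ)
    (hcoer : ∀ k : ℕ, IsCoerciveOn ρ {x | h x ≤ k}) (hE : IsClosed E) (hF : IsClosed F) {d : ℝ}
    (hd : 0 < d) (hEF : ∀ a ∈ E, ∀ b ∈ F, d ≤ dist a b) (hp : 1 ≤ p) {ε : ℝ} (hε : 0 < ε)
    (hε1 : ε < 1) :
    condenserCapacityWith (lipLipPairs X) μ p E F ^ (1 / p) ≤ ENNReal.ofReal (1 - ε)⁻¹ *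
      ((∫⁻ x, ρ x ^ p ∂μ) ^ (1 / p) + ENNReal.ofReal ε ^ (1 / p)) := by
  have hp0 : 0 < p := one_pos.trans_le hp
  obtain ⟨b, hb, hglue⟩ := hh.exists_glued
  obtain ⟨w, hw0, hw⟩ := ENNReal.exists_pos_sum_of_countable one_ne_zero ℕ
  obtain ⟨η, hη0, hη⟩ := ENNReal.exists_pos_sum_of_countable
    (ENNReal.ofReal_pos.2 hε).ne' ℕ
  have hcast : ∀ i : ℕ, ((i + 3 : ℕ) : ℝ) = i + 3 := fun i => by push_cast; rfl
  -- The gluing coefficient `b i` is divided by the summable weight `w i` in advance, so that the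
  -- total error is `∑ w i * s i`. The layer `i + 3` is the one on which `IsLayerApprox` requires
  -- control of `f i`.
  have hloc := fun i : ℕ => hu.exists_approx_lintegral hum hρ (hh.complete (i + 3))
    (hcoer (i + 3)) hE hF hd hEF (hμ (i + 3)) hp hε ((b i).toNNReal / w i)
    (ENNReal.coe_ne_zero.2 (hη0 i).ne')
  simp only [hcast] at hloc
  choose f n δ hfm _ hfE hfF hδ hlip hint using hloc
  obtain ⟨v, G, hv, hG0, hG, hvle, hlev, hGle⟩ := hglue f (fun i => lipApprox ρ (n i))
    ⟨fun i x => lipApprox_nonneg ρ (n i) x, fun i => ⟨_, lipschitzWith_lipApprox ρ (n i)⟩,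
      fun i => ⟨δ i, hδ i, fun x y hx hy hxy => hlip i x hx y hy hxy⟩⟩
  set s : ℕ → X → ℝ≥0∞ := fun i => {y | h y ≤ i + 3}.indicator fun y =>
    ((b i).toNNReal / w i : ℝ≥0) * ENNReal.ofReal |f i y - u y| with hs
  have hYm : ∀ i : ℕ, MeasurableSet {y | h y ≤ (i : ℝ) + 3} := fun i =>
    (isClosed_le hh.continuous continuous_const).measurableSet
  have hsm : ∀ i, Measurable (s i) := fun i =>
    (((hfm i).sub hum).abs.ennreal_ofReal.const_mul _).indicator (hYm i)
  set Q : X → ℝ≥0∞ := fun x => (∑' i, s i x ^ p) ^ p⁻¹ with hQ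
  have hGQ : ∀ x, ENNReal.ofReal (G x) ≤ ρ x + Q x := by
    intro x
    refine (hGle u x (ρ x) fun i => ?_).trans ?_
    · rw [ofReal_lipApprox]
      exact infConv_le ρ (n i) x
    · refine add_le_add le_rfl (le_trans (ENNReal.tsum_le_tsum fun i => ?_)
        (tsum_mul_le_rpow_tsum hw.le hp0 fun i => s i x))
      by_cases hx : x ∈ {y | h y ≤ (i : ℝ) + 3}
      · simp only [hs, indicator_of_mem hx]
        rw [ENNReal.ofReal_mul (hb i), ← mul_assoc, ← ENNReal.coe_mul,
          mul_div_cancel₀ _ (hw0 i).ne']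
        rfl
      · simp [indicator_of_notMem hx]
  have hQint : ∫⁻ x, Q x ^ p ∂μ ≤ ENNReal.ofReal ε := by
    calc ∫⁻ x, Q x ^ p ∂μ = ∫⁻ x, ∑' i, s i x ^ p ∂μ := by
          simp only [hQ, ENNReal.rpow_inv_rpow hp0.ne']
      _ = ∑' i, ∫⁻ x, s i x ^ p ∂μ :=
          lintegral_tsum fun i => ((hsm i).pow_const p).aemeasurable
      _ ≤ ∑' i, (η i : ℝ≥0∞) := by
          refine ENNReal.tsum_le_tsum fun i => le_trans (le_of_eq ?_) (hint i)
          rw [← lintegral_indicator (hYm i)]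
          refine lintegral_congr fun x => ?_
          by_cases hx : x ∈ {y | h y ≤ (i : ℝ) + 3}
          · simp only [hs, indicator_of_mem hx]
          · simp only [hs, indicator_of_notMem hx, ENNReal.zero_rpow_of_pos hp0]
      _ ≤ ENNReal.ofReal ε := hη.le
  have hQm : Measurable Q := (Measurable.tsum fun i => (hsm i).pow_const p).pow_const _
  have hε' : 0 < (1 - ε)⁻¹ := inv_pos.2 (by linarith)
  -- The glued function vanishes on `E` but is only known to be at least `1 - ε` on `F`. Division by
  -- `1 - ε` and truncation at `1` restore the boundary values.
  have hcap := condenserCapacityWith_lipLipPairs_le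
    (v := fun x => min 1 ((1 - ε)⁻¹ * v x)) (G := fun x => (1 - ε)⁻¹ * G x) (E := E) (F := F)
    (fun x => by
      have := ((hv x).const_mul (1 - ε)⁻¹).comp_lipschitz
        (φ := fun t => min 1 t) (LipschitzWith.id.const_min 1)
      rwa [abs_of_pos hε'] at this)
    (fun x => mul_nonneg hε'.le (hG0 x))
    ((lipschitzWith_smul (1 - ε)⁻¹).locallyLipschitz.comp hG)
    (fun x hx => by
      have h0 : v x = 0 := le_antisymm
        (hvle x 0 fun i hi => (hfE i x ⟨hx, hi⟩).le) (hlev x 0 fun i hi => (hfE i x ⟨hx, hi⟩).ge)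
      simp [h0])
    (fun x hx => by
      have h1 : 1 - ε ≤ v x := hlev x (1 - ε) fun i _ => hfF i x hx
      refine min_eq_left ?_
      rw [inv_mul_eq_div, le_div_iff₀ (by linarith)]
      linarith) μ p
  calc condenserCapacityWith (lipLipPairs X) μ p E F ^ (1 / p)
      ≤ (∫⁻ x, ENNReal.ofReal ((1 - ε)⁻¹ * G x) ^ p ∂μ) ^ (1 / p) := by gcongr
    _ = (ENNReal.ofReal (1 - ε)⁻¹ ^ p * ∫⁻ x, ENNReal.ofReal (G x) ^ p ∂μ) ^ (1 / p) := by
        simp only [ENNReal.ofReal_mul hε'.le, ENNReal.mul_rpow_of_nonneg _ _ hp0.le]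
        rw [lintegral_const_mul' _ _
          (ENNReal.rpow_ne_top_of_nonneg hp0.le ENNReal.ofReal_ne_top)]
    _ = ENNReal.ofReal (1 - ε)⁻¹ * (∫⁻ x, ENNReal.ofReal (G x) ^ p ∂μ) ^ (1 / p) := by
        rw [ENNReal.mul_rpow_of_nonneg _ _ (by positivity), one_div, ENNReal.rpow_rpow_inv hp0.ne']
    _ ≤ ENNReal.ofReal (1 - ε)⁻¹ * (∫⁻ x, (ρ + Q) x ^ p ∂μ) ^ (1 / p) := by
        gcongr with x
        exact hGQ x
    _ ≤ ENNReal.ofReal (1 - ε)⁻¹ *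
          ((∫⁻ x, ρ x ^ p ∂μ) ^ (1 / p) + (∫⁻ x, Q x ^ p ∂μ) ^ (1 / p)) := by
        gcongr
        exact ENNReal.lintegral_Lp_add_le hρ.measurable.aemeasurable hQm.aemeasurable hp
    _ ≤ _ := by gcongr

/-- Vitali–Carathéodory for `p`-th powers. -/
theorem exists_lowerSemicontinuous_majorant_rpow [μ.WeaklyRegular] [SigmaFinite μ] (hp : 0 < p)
    {ρ : X → ℝ≥0∞} (hρ : Measurable ρ) {ε : ℝ≥0∞} (hε : ε ≠ 0) :
    ∃ ρ' : X → ℝ≥0∞, LowerSemicontinuous ρ' ∧ ρ ≤ ρ' ∧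
      ∫⁻ x, ρ' x ^ p ∂μ ≤ (∫⁻ x, ρ x ^ p ∂μ) + ε := by
  obtain ⟨g, hg, hgl, hgi⟩ :=
    exists_le_lowerSemicontinuous_lintegral_ge μ (fun x => ρ x ^ p) (hρ.pow_const p) hε
  refine ⟨fun x => g x ^ p⁻¹, ENNReal.continuous_rpow_const.comp_lowerSemicontinuous hgl
    (ENNReal.monotone_rpow_of_nonneg (inv_nonneg.2 hp.le)),
    fun x => (ENNReal.le_rpow_inv_iff hp).2 (hg x), ?_⟩
  simpa only [ENNReal.rpow_inv_rpow hp.ne'] using hgi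

/-- Enlarging an admissible weight keeps it admissible, so the lower semicontinuous and coercive
majorants each cost only `ε`. The estimate is carried out for `p`-th roots, where Minkowski's
inequality separates the weight from the gluing error. -/
theorem condenserCapacityWith_lipLipPairs_le_curveModulus [TopologicalSpace.SeparableSpace X]
    (hX : IsLocallyComplete X) (hμ : ∀ (x : X) (r : ℝ), 0 < r → μ (Metric.ball x r) < ⊤)
    (hE : IsClosed E) (hF : IsClosed F) (hE₀ : E.Nonempty) (hdist : 0 < setDistance E F)
    (hp : 1 ≤ p) :
    condenserCapacityWith (lipLipPairs X) μ p E F ≤ curveModulus μ p (curvesBetween E F) := by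
  have hp0 : 0 < p := one_pos.trans_le hp
  refine le_iInf₂ fun ρ₀ hρ₀ => ?_
  set A := ∫⁻ x, ρ₀ x ^ p ∂μ with hA
  obtain ⟨x₀, -⟩ := hE₀
  obtain ⟨d, hd, hEF⟩ := exists_pos_le_dist_of_setDistance_pos hdist
  have := UniformSpace.secondCountable_of_separable X
  have := isLocallyFiniteMeasure_of_ball_lt_top hμ
  have hh := isCompleteExhaustion_dist_add_inv hX x₀
  set h : X → ℝ := fun x => dist x x₀ + (completenessRadius x)⁻¹ with hhdef
  have hμh : ∀ k : ℕ, μ {x | h x ≤ k} ≠ ⊤ := fun k => by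
    refine ((measure_mono fun x hx => ?_).trans_lt (hμ x₀ (k + 1) (by positivity))).ne
    have h1 : dist x x₀ + (completenessRadius x)⁻¹ ≤ k := hx
    have h2 := inv_pos.2 (completenessRadius_pos hX x)
    exact Metric.mem_ball.2 (by linarith)
  have key : ∀ ε : ℝ, 0 < ε → ε < 1 →
      condenserCapacityWith (lipLipPairs X) μ p E F ^ (1 / p) ≤ ENNReal.ofReal (1 - ε)⁻¹ *
        ((A + ENNReal.ofReal ε + ENNReal.ofReal ε) ^ (1 / p) + ENNReal.ofReal ε ^ (1 / p)) := by
    intro ε hε hε1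
    have hε0 := (ENNReal.ofReal_pos.2 hε).ne'
    obtain ⟨ρ₁, hρ₁, h01, hρ₁A⟩ := exists_lowerSemicontinuous_majorant_rpow (μ := μ) hp0 hρ₀.1 hε0
    obtain ⟨ρ, hρ, h1ρ, hcoer, hρA⟩ := exists_coercive_majorant hp hh hμh hρ₁ hε0
    have hadm : ∀ (γ : ℝ → X) (L : ℝ), 0 ≤ L → LipschitzWith 1 γ → γ 0 ∈ E → γ L ∈ F →
        1 ≤ ∫⁻ t in Icc 0 L, ρ (γ t) := by
      intro γ L hL hγ h0 hL1
      obtain ⟨hrect, hle⟩ := hγ.pathIntegral_mul_le hL ρ₀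
      exact (hρ₀.2 _ ⟨hrect, by simpa using h0, by simpa using hL1⟩).trans
        (hle.trans (lintegral_mono fun t => (h01 _).trans (h1ρ _)))
    obtain ⟨u, hum, hu⟩ := exists_measurable_potential hh hρ hcoer hE hadm
    refine (hu.rpow_condenserCapacityWith_lipLipPairs_le hum hh hμh hρ hcoer hE hF hd hEF hp hε
      hε1).trans ?_
    gcongr
    exact hρA.trans (by gcongr)
  have hlim : Tendsto (fun ε : ℝ => ENNReal.ofReal (1 - ε)⁻¹ *
      ((A + ENNReal.ofReal ε + ENNReal.ofReal ε) ^ (1 / p) + ENNReal.ofReal ε ^ (1 / p)))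
      (𝓝[>] 0) (𝓝 (A ^ (1 / p))) := by
    have h0 : Tendsto (fun ε : ℝ => ENNReal.ofReal ε) (𝓝[>] 0) (𝓝 0) := by
      simpa using (ENNReal.continuous_ofReal.tendsto 0).mono_left nhdsWithin_le_nhds
    have h1 : Tendsto (fun ε : ℝ => ENNReal.ofReal (1 - ε)⁻¹) (𝓝[>] 0) (𝓝 1) := by
      have : ContinuousAt (fun ε : ℝ => ENNReal.ofReal (1 - ε)⁻¹) 0 :=
        ENNReal.continuous_ofReal.continuousAt.comp
          ((continuousAt_const.sub continuousAt_id).inv₀ (by simp))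
      simpa [ContinuousAt] using this.tendsto.mono_left (nhdsWithin_le_nhds (s := Ioi 0))
    have h2 : Tendsto (fun ε : ℝ => (A + ENNReal.ofReal ε + ENNReal.ofReal ε) ^ (1 / p) +
        ENNReal.ofReal ε ^ (1 / p)) (𝓝[>] 0) (𝓝 (A ^ (1 / p))) := by
      have h3 := (((tendsto_const_nhds (x := A)).add h0).add h0).ennrpow_const (1 / p)
      have h4 := h3.add (h0.ennrpow_const (1 / p))
      rwa [ENNReal.zero_rpow_of_pos (by positivity), add_zero, add_zero, add_zero] at h4
    simpa using ENNReal.Tendsto.mul h1 (Or.inl one_ne_zero) h2 (Or.inr ENNReal.one_ne_top)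
  have hle := ge_of_tendsto hlim (by
    filter_upwards [Ioo_mem_nhdsGT (zero_lt_one (α := ℝ))] with ε hε using key ε hε.1 hε.2)
  rwa [ENNReal.rpow_le_rpow_iff (by positivity)] at hle

end Main

theorem mainTheorem1 {X : Type*} [MetricSpace X] [TopologicalSpace.SeparableSpace X]
    [MeasurableSpace X] [BorelSpace X] (hX : IsLocallyComplete X)
    (μ : Measure X) (hμ : ∀ (x : X) (r : ℝ), 0 < r →
      0 < μ (Metric.ball x r) ∧ μ (Metric.ball x r) < ⊤)
    (E F : Set X) (hE : IsClosed E) (hF : IsClosed F) (hE₀ : E.Nonempty) (hF₀ : F.Nonempty)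
    (hEF : Disjoint E F) (hdist : 0 < setDistance E F)
    (p : ℝ) (hp : 1 ≤ p) :
    (condenserCapacity μ p E F = condenserCapacityWith (contPairs X) μ p E F ∧
      condenserCapacity μ p E F = condenserCapacityWith (lipPairs X) μ p E F ∧
      condenserCapacity μ p E F = condenserCapacityWith (lipLipPairs X) μ p E F) ∧
    (condenserCapacity μ p E F = curveModulus μ p (curvesBetween E F) ∧
      curveModulus μ p (curvesBetween E F) =
        continuousCurveModulus μ p (curvesBetween E F)) := by
  have h1 : condenserCapacity μ p E F ≤ condenserCapacityWith (contPairs X) μ p E F :=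
    condenserCapacityWith_anti (fun _ hq => hq.1) μ p E F
  have h2 : condenserCapacityWith (contPairs X) μ p E F ≤
      condenserCapacityWith (lipPairs X) μ p E F :=
    condenserCapacityWith_anti (show lipPairs X ⊆ contPairs X from fun _ hq =>
      ⟨hq.1, hq.2.imp fun _ hv => ⟨hv.1.continuous, hv.2⟩⟩) μ p E F
  have h3 : condenserCapacityWith (lipPairs X) μ p E F ≤
      condenserCapacityWith (lipLipPairs X) μ p E F :=
    condenserCapacityWith_anti (fun _ hq => hq.1) μ p E F
  -- This closes the circle: both chains of inequalities, through the capacities and through the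
  -- continuous modulus, lead from the modulus up to the locally Lipschitz capacity and back.
  have h4 := condenserCapacityWith_lipLipPairs_le_curveModulus hX (fun x r hr => (hμ x r hr).2)
    hE hF hE₀ hdist hp
  have h5 := curveModulus_le_condenserCapacity μ p E F
  have h6 := curveModulus_le_continuousCurveModulus μ p (curvesBetween E F)
  have h7 := continuousCurveModulus_le_condenserCapacityWith_lipLipPairs μ p E F
  exact ⟨⟨h1.antisymm (h2.trans (h3.trans (h4.trans h5))),
    (h1.trans h2).antisymm (h3.trans (h4.trans h5)),
    (h1.trans (h2.trans h3)).antisymm (h4.trans h5)⟩,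
    (h1.trans (h2.trans (h3.trans h4))).antisymm h5,
    h6.antisymm (h7.trans h4)⟩
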